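/- Let $N\ge 1$, $n=\lfloor N/2\rfloor$, and let $q\in\mathbb C$ be nonzero and not a root of unity. Let $E_{ij}$ be the matrix units of $\mathrm{End}\,\mathbb C^N$ and $$R(u,v)=(u-v)\sum_{i\ne j}E_{ii}\otimes E_{jj}+(q^{-1}u-qv)\sum_iE_{ii}\otimes E_{ii}+(q^{-1}-q)u\sum_{i>j}E_{ij}\otimes E_{ji}+(q^{-1}-q)v\sum_{i<j}E_{ij}\otimes E_{ji};$$ let $R^{t}(u,v)$ be obtained from it by transposing the first tensor factor. The algebra $\mathrm U_q(\widehat{\mathfrak{gl}}_N)$ is the associative unital $\mathbb C$-algebra with generators $t_{ij}^{(r)},\bar t_{ij}^{\,(r)}$ ($1\le i,j\le N$, $r\ge0$) and, with $T(u)=\big(\sum_{r\ge 0} t_{ij}^{(r)}u^{-r}\big)_{i,j}$ and $\overline T(u)=\big(\sum_{r\ge 0}\bar t_{ij}^{\,(r)}u^{r}\big)_{i,j}$, the defining relations $t_{ij}^{(0)}=\bar t_{ji}^{\,(0)}=0$ for $i<j$, $t_{ii}^{(0)}\bar t_{ii}^{\,(0)}=\bar t_{ii}^{\,(0)}t_{ii}^{(0)}=1$,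 and $$R(u,v)T_1(u)T_2(v)=T_2(v)T_1(u)R(u,v),\quad R(u,v)\overline T_1(u)\overline T_2(v)=\overline T_2(v)\overline T_1(u)R(u,v),\quad R(u,v)\overline T_1(u)T_2(v)=T_2(v)\overline T_1(u)R(u,v).$$ Here and below subscripts indicate the tensor factors in which an operator acts. Put $S(u)=(s_{ij}(u))=T(u)\,\overline T(u^{-1})^t$ and $\overline S(u)=(\bar s_{ij}(u))=\overline T(u)\,T(u^{-1})^t$, and let $\bar s^{\,t}_{ij}(u)=\bar s_{ji}(u)$ be the entries of $\overline S(u)^t$. Let $P^q=\sum_iE_{ii}\otimes E_{ii}+q\sum_{i>j}E_{ij}\otimes E_{ji}+q^{-1}\sum_{i<j}E_{ij}\otimes E_{ji}$, and let $A^q_N=\sum_{\sigma\in\mathfrak S_N}\mathrm{sgn}\,\sigma\cdot P^q_\sigma$ on $(\mathbb C^N)^{\otimes N}$, where $P^q_\sigma=P^q_{i_1,i_1+1}\cdots P^q_{i_l,i_l+1}$ for a reduced decomposition $\sigma=s_{i_1}\cdots s_{i_l}$ into adjacent transpositions. With $u_i=q^{-2i+2}u$ and $R^t_{ij}=R^t_{ij}(u_i^{-1},u_j)$,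 the Sklyanin determinant $\mathrm{sdet}\,S(u)$ is the Laurent series in $u^{-1}$ over $\mathrm U_q(\widehat{\mathfrak{gl}}_N)$ such that $$A^q_N\,S_1(u_1)R^t_{12}\cdots R^t_{1N}\,S_2(u_2)R^t_{23}\cdots R^t_{2N}\,S_3(u_3)\cdots R^t_{N-1,N}\,S_N(u_N)=\mathrm{sdet}\,S(u)\,A^q_N,$$ and $$c(u)=\gamma_N(u)^{-1}\,\mathrm{sdet}\,S(u),\qquad \gamma_N(u)=\prod_{1\le i<j\le N}\big(q^{2i-2}u^{-1}-q^{-2j+2}u\big),$$ where $\gamma_N(u)$ is inverted in the field $\mathbb C((u^{-1}))$. The map $\pi_N:p\mapsto p'$ on permutations $p=(p_1,\dots,p_N)$ of a set $\omega_1<\dots<\omega_N$ of positive integers is defined inductively. $\pi_1$ is the identity, and for $N=2$ always $p'=(\omega_1,\omega_2)$. For $N>2$ consider the map on ordered pairs of distinct elements $$(\omega_k,\omega_l)\mapsto(\omega_l,\omega_k)\ (k,l<N),\quad(\omega_k,\omega_N)\mapsto(\omega_{N-1},\omega_k),\ \ (\omega_N,\omega_k)\mapsto(\omega_k,\omega_{N-1})\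 (k<N-1),$$ $$(\omega_{N-1},\omega_N)\mapsto(\omega_{N-1},\omega_{N-2}),\quad(\omega_N,\omega_{N-1})\mapsto(\omega_{N-1},\omega_{N-2}).$$ Then $p'=(p'_1,\dots,p'_{N-1},\omega_N)$, where $(p'_1,p'_{N-1})$ is the image of $(p_1,p_N)$ under this map, and $(p'_2,\dots,p'_{N-2})$ is the image under $\pi_{N-2}$ of the permutation $(p_2,\dots,p_{N-1})$ of $\{\omega_1,\dots,\omega_N\}\setminus\{p_1,p_N\}$ with its last entry dropped. Let $l(p)$ be the number of inversions of $p$. Theorem. The Sklyanin determinant $\mathrm{sdet}\,S(u)$ exists and is unique, and $$c(u)=\sum_{p\in\mathfrak S_N}(-q)^{-l(p)+l(p')}\,\bar s^{\,t}_{p_1p'_1}(u^{-1})\cdots\bar s^{\,t}_{p_np'_n}(q^{2n-2}u^{-1})\; s_{p_{n+1}p'_{n+1}}(q^{-2n}u)\cdots s_{p_Np'_N}(q^{-2N+2}u),$$ where $\mathfrak S_N$ is the group of permutations of $\{1,\dots,N\}$, and in each product the factors are ordered by increasing $i$. -/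

import Mathlib

open scoped Kronecker

namespace TwistedQYangian

noncomputable section

/-! ### The trigonometric `R`-matrix and tensor leg notation -/

/-- Matrix unit `E_{ij}` with entries in `K`. -/
def E {N : ℕ} (K : Type*) [Ring K] (i j : Fin N) : Matrix (Fin N) (Fin N) K :=
  Matrix.single i j 1

/-- The trigonometric `R`-matrix `R(u,v)`, an element of `End ℂ^N ⊗ End ℂ^N` with coefficients
in a `ℂ`-algebra `K` containing the parameters `u`, `v`. -/
def trigR (N : ℕ) {K : Type*} [Ring K] [Algebra ℂ K] (q : ℂ) (u v : K) :
    Matrix (Fin N × Fin N) (Fin N × Fin N) K :=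
  (∑ i : Fin N, ∑ j : Fin N, if i ≠ j then (u - v) • (E K i i ⊗ₖ E K j j) else 0)
  + (∑ i : Fin N, (q⁻¹ • u - q • v) • (E K i i ⊗ₖ E K i i))
  + (∑ i : Fin N, ∑ j : Fin N,
      if j < i then ((q⁻¹ - q) • u) • (E K i j ⊗ₖ E K j i) else 0)
  + (∑ i : Fin N, ∑ j : Fin N,
      if i < j then ((q⁻¹ - q) • v) • (E K i j ⊗ₖ E K j i) else 0)

/-- Transposition in the first tensor factor. -/
def transpose₁ {N : ℕ} {K : Type*} (M : Matrix (Fin N × Fin N) (Fin N × Fin N) K) :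
    Matrix (Fin N × Fin N) (Fin N × Fin N) K :=
  Matrix.of fun x y => M (y.1, x.2) (x.1, y.2)

/-- `X_k`: the matrix `X` acting in the `k`-th factor of `(ℂ^N)^{⊗ r}`. -/
def oneSite {N r : ℕ} {K : Type*} [Zero K] (X : Matrix (Fin N) (Fin N) K) (k : Fin r) :
    Matrix (Fin r → Fin N) (Fin r → Fin N) K :=
  Matrix.of fun a b => if ∀ l, l ≠ k → a l = b l then X (a k) (b k) else 0

/-- `M_{kl}` for `k ≠ l`: the first tensor factor of `M` acts in the `k`-th factor of
`(ℂ^N)^{⊗ r}`, the second one in the `l`-th factor. -/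
def twoSite {N r : ℕ} {K : Type*} [Zero K] (M : Matrix (Fin N × Fin N) (Fin N × Fin N) K)
    (k l : Fin r) : Matrix (Fin r → Fin N) (Fin r → Fin N) K :=
  Matrix.of fun a b =>
    if ∀ m, m ≠ k → m ≠ l → a m = b m then M (a k, a l) (b k, b l) else 0

/-! ### The quantum affine algebra `U_q(ĝl_N)` -/

/-- The generators `t_{ij}^{(r)}` and `t̄_{ij}^{(r)}`. -/
inductive Gen (N : ℕ) : Type
  | t (i j : Fin N) (r : ℕ) : Gen N
  | tbar (i j : Fin N) (r : ℕ) : Gen N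

/-- The coefficient of `u^a` in `T(u) = ∑_{r ≥ 0} T^{(r)} u^{-r}`, over the free algebra. -/
def freeT (N : ℕ) (a : ℤ) : Matrix (Fin N) (Fin N) (FreeAlgebra ℂ (Gen N)) :=
  Matrix.of fun i j => if a ≤ 0 then FreeAlgebra.ι ℂ (Gen.t i j (-a).toNat) else 0

/-- The coefficient of `u^a` in `T̄(u) = ∑_{r ≥ 0} T̄^{(r)} u^{r}`, over the free algebra. -/
def freeTbar (N : ℕ) (a : ℤ) : Matrix (Fin N) (Fin N) (FreeAlgebra ℂ (Gen N)) :=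
  Matrix.of fun i j => if 0 ≤ a then FreeAlgebra.ι ℂ (Gen.tbar i j a.toNat) else 0

/-- The coefficient of `u^a v^b` in `R(u,v) X₁(u) Y₂(v)`. As `R(u,v)` is linear and homogeneous
in `(u,v)`, its coefficients at `u` and `v` are `R(1,0)` and `R(0,1)`. -/
def coeffRXY {N : ℕ} {K : Type*} [Ring K] [Algebra ℂ K] (q : ℂ)
    (X Y : ℤ → Matrix (Fin N) (Fin N) K) (a b : ℤ) :
    Matrix (Fin N × Fin N) (Fin N × Fin N) K :=
  trigR N q 1 0 * (X (a - 1) ⊗ₖ 1) * (1 ⊗ₖ Y b) + trigR N q 0 1 * (X a ⊗ₖ 1) * (1 ⊗ₖ Y (b - 1))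

/-- The coefficient of `u^a v^b` in `Y₂(v) X₁(u) R(u,v)`. -/
def coeffYXR {N : ℕ} {K : Type*} [Ring K] [Algebra ℂ K] (q : ℂ)
    (X Y : ℤ → Matrix (Fin N) (Fin N) K) (a b : ℤ) :
    Matrix (Fin N × Fin N) (Fin N × Fin N) K :=
  (1 ⊗ₖ Y b) * (X (a - 1) ⊗ₖ 1) * trigR N q 1 0 + (1 ⊗ₖ Y (b - 1)) * (X a ⊗ₖ 1) * trigR N q 0 1

/-- The defining relations of `U_q(ĝl_N)`. -/
inductive Rel (q : ℂ) (N : ℕ) : FreeAlgebra ℂ (Gen N) → FreeAlgebra ℂ (Gen N) → Prop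
  | t_zero (i j : Fin N) (h : i < j) : Rel q N (FreeAlgebra.ι ℂ (Gen.t i j 0)) 0
  | tbar_zero (i j : Fin N) (h : i < j) : Rel q N (FreeAlgebra.ι ℂ (Gen.tbar j i 0)) 0
  | t_tbar (i : Fin N) :
      Rel q N (FreeAlgebra.ι ℂ (Gen.t i i 0) * FreeAlgebra.ι ℂ (Gen.tbar i i 0)) 1
  | tbar_t (i : Fin N) :
      Rel q N (FreeAlgebra.ι ℂ (Gen.tbar i i 0) * FreeAlgebra.ι ℂ (Gen.t i i 0)) 1
  | rtt (a b : ℤ) (x y : Fin N × Fin N) :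
      Rel q N (coeffRXY q (freeT N) (freeT N) a b x y) (coeffYXR q (freeT N) (freeT N) a b x y)
  | rtbartbar (a b : ℤ) (x y : Fin N × Fin N) :
      Rel q N (coeffRXY q (freeTbar N) (freeTbar N) a b x y)
        (coeffYXR q (freeTbar N) (freeTbar N) a b x y)
  | rtbart (a b : ℤ) (x y : Fin N × Fin N) :
      Rel q N (coeffRXY q (freeTbar N) (freeT N) a b x y)
        (coeffYXR q (freeTbar N) (freeT N) a b x y)

/-- The quantum affine algebra `U_q(ĝl_N)` in its `R`-matrix presentation. -/
abbrev UqAff (q : ℂ) (N : ℕ) : Type := RingQuot (Rel q N)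

/-- The generator `t_{ij}^{(r)}` of `U_q(ĝl_N)`. -/
def t (q : ℂ) {N : ℕ} (i j : Fin N) (r : ℕ) : UqAff q N :=
  RingQuot.mkAlgHom ℂ (Rel q N) (FreeAlgebra.ι ℂ (Gen.t i j r))

/-- The generator `t̄_{ij}^{(r)}` of `U_q(ĝl_N)`. -/
def tbar (q : ℂ) {N : ℕ} (i j : Fin N) (r : ℕ) : UqAff q N :=
  RingQuot.mkAlgHom ℂ (Rel q N) (FreeAlgebra.ι ℂ (Gen.tbar i j r))

/-! ### Series in `u⁻¹`

`USeries q N` consists of the Laurent series in `u⁻¹` over `U_q(ĝl_N)`: the variable of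
`LaurentSeries` stands for `u⁻¹`, so that the coefficient with index `k` belongs to `u^{-k}`. -/

/-- Laurent series in `u⁻¹` with coefficients in `U_q(ĝl_N)`. -/
abbrev USeries (q : ℂ) (N : ℕ) : Type := LaurentSeries (UqAff q N)

/-- The monomial `c u`, as a Laurent series in `u⁻¹` over a `ℂ`-algebra `K`. -/
def cu (K : Type*) [Ring K] [Algebra ℂ K] (c : ℂ) : LaurentSeries K :=
  HahnSeries.single (-1) (algebraMap ℂ K c)

/-- The monomial `c u⁻¹`, as a Laurent series in `u⁻¹` over a `ℂ`-algebra `K`. -/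
def cuInv (K : Type*) [Ring K] [Algebra ℂ K] (c : ℂ) : LaurentSeries K :=
  HahnSeries.single 1 (algebraMap ℂ K c)

/-- The matrix `T(c u)`, with entries `∑_r t_{ij}^{(r)} (c u)^{-r}`. -/
def T (q : ℂ) (N : ℕ) (c : ℂ) : Matrix (Fin N) (Fin N) (USeries q N) :=
  Matrix.of fun i j => HahnSeries.ofPowerSeries ℤ (UqAff q N)
    (PowerSeries.mk fun r => (c⁻¹) ^ r • t q i j r)

/-- The matrix `T̄(c u⁻¹)`, with entries `∑_r t̄_{ij}^{(r)} (c u⁻¹)^{r}`. -/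
def Tbar (q : ℂ) (N : ℕ) (c : ℂ) : Matrix (Fin N) (Fin N) (USeries q N) :=
  Matrix.of fun i j => HahnSeries.ofPowerSeries ℤ (UqAff q N)
    (PowerSeries.mk fun r => c ^ r • tbar q i j r)

/-- The matrix `S(c u)`, where `S(u) = T(u) T̄(u⁻¹)ᵗ`. -/
def S (q : ℂ) (N : ℕ) (c : ℂ) : Matrix (Fin N) (Fin N) (USeries q N) :=
  T q N c * (Tbar q N c⁻¹).transpose

/-- The matrix `S̄(c u⁻¹)`, where `S̄(u) = T̄(u) T(u⁻¹)ᵗ`. -/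
def Sbar (q : ℂ) (N : ℕ) (c : ℂ) : Matrix (Fin N) (Fin N) (USeries q N) :=
  Tbar q N c * (T q N c⁻¹).transpose

/-! ### The `q`-antisymmetrizer -/

/-- The `q`-permutation operator `P^q` on `ℂ^N ⊗ ℂ^N`. -/
def Pq (N : ℕ) (q : ℂ) : Matrix (Fin N × Fin N) (Fin N × Fin N) ℂ :=
  (∑ i : Fin N, E ℂ i i ⊗ₖ E ℂ i i)
  + (∑ i : Fin N, ∑ j : Fin N, if j < i then q • (E ℂ i j ⊗ₖ E ℂ j i) else 0)
  + (∑ i : Fin N, ∑ j : Fin N, if i < j then q⁻¹ • (E ℂ i j ⊗ₖ E ℂ j i) else 0)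

/-- Indices `k` of the adjacent transpositions `(k, k+1)` of `Fin r`. -/
abbrev AdjIdx (r : ℕ) : Type := {k : ℕ // k + 1 < r}

/-- The left position moved by an adjacent transposition. -/
def AdjIdx.left {r : ℕ} (k : AdjIdx r) : Fin r := ⟨k.1, by have := k.2; omega⟩

/-- The right position moved by an adjacent transposition. -/
def AdjIdx.right {r : ℕ} (k : AdjIdx r) : Fin r := ⟨k.1 + 1, k.2⟩

/-- The product `s_{i_1} ⋯ s_{i_l}` of adjacent transpositions. -/
def wordPerm {r : ℕ} (w : List (AdjIdx r)) : Equiv.Perm (Fin r) :=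
  (w.map fun k => Equiv.swap k.left k.right).prod

/-- `w` is a reduced decomposition of `σ`. -/
def IsReducedWord {r : ℕ} (σ : Equiv.Perm (Fin r)) (w : List (AdjIdx r)) : Prop :=
  wordPerm w = σ ∧ ∀ w' : List (AdjIdx r), wordPerm w' = σ → w.length ≤ w'.length

theorem exists_wordPerm {r : ℕ} (σ : Equiv.Perm (Fin r)) : ∃ w, wordPerm w = σ := by
  cases r with
  | zero => exact ⟨[], Subsingleton.elim _ _⟩
  | succ n =>
    have h : σ ∈ Submonoid.closure
        (Set.range fun i : Fin n => Equiv.swap i.castSucc i.succ) := by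
      rw [Equiv.Perm.mclosure_swap_castSucc_succ]; trivial
    induction h using Submonoid.closure_induction with
    | mem x hx =>
      obtain ⟨i, rfl⟩ := hx
      refine ⟨[⟨i.1, by omega⟩], ?_⟩
      simp only [wordPerm, List.map_cons, List.map_nil, List.prod_cons, List.prod_nil, mul_one]
      rfl
    | one => exact ⟨[], rfl⟩
    | mul x y _ _ hx hy =>
      obtain ⟨v, rfl⟩ := hx
      obtain ⟨w, rfl⟩ := hy
      exact ⟨v ++ w, by simp [wordPerm]⟩

theorem exists_isReducedWord {r : ℕ} (σ : Equiv.Perm (Fin r)) : ∃ w, IsReducedWord σ w := by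
  classical
  have h : ∃ n, ∃ w : List (AdjIdx r), wordPerm w = σ ∧ w.length = n := by
    obtain ⟨w, hw⟩ := exists_wordPerm σ
    exact ⟨_, w, hw, rfl⟩
  obtain ⟨w, hw, hl⟩ := Nat.find_spec h
  exact ⟨w, hw, fun w' hw' => hl ▸ Nat.find_min' h ⟨w', hw', rfl⟩⟩

/-- The operator `P^q_σ = P^q_{s_{i_1}} ⋯ P^q_{s_{i_l}}` on `(ℂ^N)^{⊗ r}`, where
`σ = s_{i_1} ⋯ s_{i_l}` is a reduced decomposition. -/
def qPerm (N : ℕ) {r : ℕ} (q : ℂ) (σ : Equiv.Perm (Fin r)) :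
    Matrix (Fin r → Fin N) (Fin r → Fin N) ℂ :=
  ((exists_isReducedWord σ).choose.map fun k => twoSite (Pq N q) k.left k.right).prod

/-- The `q`-antisymmetrizer `A^q_r = ∑_σ sgn σ · P^q_σ`. -/
def qAntisym (N r : ℕ) (q : ℂ) : Matrix (Fin r → Fin N) (Fin r → Fin N) ℂ :=
  ∑ σ : Equiv.Perm (Fin r), ((Equiv.Perm.sign σ : ℤ) : ℂ) • qPerm N q σ

/-! ### The Sklyanin determinant and the series `c(u)`

The tensor factors `1, …, N` are numbered by `k = 0, …, N-1`, so that the spectral parameter of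
the factor `k` is `u_k = q^{-2k} u`. -/

/-- `R^t_{kl} = R^t_{kl}(u_k⁻¹, u_l)` with `u_k = q^{-2k} u`, acting on `(ℂ^N)^{⊗ N}`. -/
def Rt (q : ℂ) (N : ℕ) (k l : Fin N) :
    Matrix (Fin N → Fin N) (Fin N → Fin N) (USeries q N) :=
  twoSite (transpose₁ (trigR N q
    (cuInv (UqAff q N) (q ^ (2 * ((k : ℕ) : ℤ)))) (cu (UqAff q N) (q ^ (-2 * ((l : ℕ) : ℤ)))))) k l

/-- The ordered product
`S₁(u) R^t₁₂ ⋯ R^t₁_N S₂(q⁻²u) R^t₂₃ ⋯ R^t₂_N S₃(q⁻⁴u) ⋯ R^t_{N-1,N} S_N(q^{-2N+2}u)`. -/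
def sklyaninProduct (q : ℂ) (N : ℕ) :
    Matrix (Fin N → Fin N) (Fin N → Fin N) (USeries q N) :=
  ((List.finRange N).map fun k : Fin N =>
    oneSite (S q N (q ^ (-2 * ((k : ℕ) : ℤ)))) k *
      (((List.finRange N).filter fun l => k < l).map fun l => Rt q N k l).prod).prod

/-- `D` is the Sklyanin determinant `sdet S(u)`: the product of `A^q_N` with the ordered product
above equals `A^q_N` times the series `D`. -/
def IsSklyaninDet (q : ℂ) (N : ℕ) (D : USeries q N) : Prop :=
  (qAntisym N N q).map (algebraMap ℂ (USeries q N)) * sklyaninProduct q N =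
    D • (qAntisym N N q).map (algebraMap ℂ (USeries q N))

/-- The Sklyanin determinant `sdet S(u)`. -/
def sdet (q : ℂ) (N : ℕ) : USeries q N :=
  Classical.epsilon (IsSklyaninDet q N)

/-- `γ_N(u) = ∏_{1 ≤ i < j ≤ N} (q^{2i-2} u⁻¹ - q^{-2j+2} u)`, in the field of Laurent series in
`u⁻¹` over `ℂ`. -/
def gamma (q : ℂ) (N : ℕ) : LaurentSeries ℂ :=
  ∏ i : Fin N, ∏ j : Fin N,
    if i < j then cuInv ℂ (q ^ (2 * ((i : ℕ) : ℤ))) - cu ℂ (q ^ (-2 * ((j : ℕ) : ℤ))) else 1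

/-- The series `c(u) = γ_N(u)⁻¹ sdet S(u)`. -/
def c (q : ℂ) (N : ℕ) : USeries q N :=
  ((gamma q N)⁻¹).map (algebraMap ℂ (UqAff q N)) * sdet q N

end

/-! ### The map `π_N` on permutations -/

section PiMap

variable {α : Type*} [LinearOrder α]

/-- The map on ordered pairs, where `w₁ = ω_N`, `w₂ = ω_{N-1}`, `w₃ = ω_{N-2}` are the three
largest elements. -/
def pairMap (w₁ w₂ w₃ : α) (x : α × α) : α × α :=
  if x.2 = w₁ then
    if x.1 = w₂ then (w₂, w₃) else (w₂, x.1)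
  else if x.1 = w₁ then
    if x.2 = w₂ then (w₂, w₃) else (x.2, w₂)
  else (x.2, x.1)

/-- One step of the construction of `π_N`, on a permutation `(a, m₁, …, m_{N-2}, b)` written as a
list: `ω` are its entries in decreasing order and `m'` is the image of `(m₁, …, m_{N-2})`, whose
last entry is dropped. -/
def piStep (ω : List α) (a b : α) (m' : List α) : List α :=
  match ω with
  | w₁ :: w₂ :: w₃ :: _ =>
    (pairMap w₁ w₂ w₃ (a, b)).1 :: (m'.dropLast ++ [(pairMap w₁ w₂ w₃ (a, b)).2, w₁])
  | _ => []

/-- The map `π_N`, on permutations of an arbitrary set `ω_1 < ⋯ < ω_N` written in one-line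
notation. -/
def piList : List α → List α
  | [] => []
  | [a] => [a]
  | [a, b] => [min a b, max a b]
  | a :: b :: d :: l =>
    piStep ((a :: b :: d :: l).insertionSort (· ≥ ·)) a ((d :: l).getLast (by simp))
      (piList (b :: (d :: l).dropLast))
termination_by l => l.length
decreasing_by simp

theorem piStep_perm {ω m m' : List α} {a b M : α} (hω : ω.Pairwise (· ≥ ·))
    (hp : ω.Perm (a :: (m ++ [b]))) (hnd : (a :: (m ++ [b])).Nodup)
    (hm : (m'.dropLast ++ [M]).Perm m) (hM : ∀ x ∈ m, x ≤ M) :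
    (piStep ω a b m').Perm (a :: (m ++ [b])) ∧
      ∃ pre W, piStep ω a b m' = pre ++ [W] ∧ ∀ x ∈ a :: (m ++ [b]), x ≤ W := by
  have hlen := hp.length_eq
  have hmpos : 0 < m.length := by
    rw [← hm.length_eq]; simp
  have hnω : ω.Nodup := hp.nodup_iff.2 hnd
  match ω, hlen, hω, hp, hnω with
  | [], hlen, _, _, _ => simp at hlen
  | [_], hlen, _, _, _ => simp at hlen
  | [_, _], hlen, _, _, _ =>
    simp only [List.length_cons, List.length_append, List.length_nil] at hlen
    omega
  | w₁ :: w₂ :: w₃ :: ws, _, hω, hp, hnω =>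
    have hmem : ∀ x, x ∈ w₁ :: w₂ :: w₃ :: ws ↔ x ∈ a :: (m ++ [b]) := fun x => hp.mem_iff
    have hMm : M ∈ m := hm.mem_iff.1 (by simp)
    refine ⟨?_, (pairMap w₁ w₂ w₃ (a, b)).1 :: (m'.dropLast ++ [(pairMap w₁ w₂ w₃ (a, b)).2]),
      w₁, by simp [piStep], fun x hx => ?_⟩
    · have key : [(pairMap w₁ w₂ w₃ (a, b)).1, (pairMap w₁ w₂ w₃ (a, b)).2, w₁].Perm
          [a, b, M] := by
        have h1 := (hmem M).2 (by simp [hMm])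
        have h2 := (hmem a).2 (by simp)
        have h3 := (hmem b).2 (by simp)
        have e1 := (hmem w₁).1 (by simp)
        have e2 := (hmem w₂).1 (by simp)
        have e3 := (hmem w₃).1 (by simp)
        simp only [List.pairwise_cons, List.nodup_cons, List.mem_cons, List.mem_append,
          List.not_mem_nil, or_false] at hω hnω hnd h1 h2 h3 e1 e2 e3
        have hMa : M ≠ a := by rintro rfl; exact hnd.1 (Or.inl hMm)
        have hMb : M ≠ b := by
          rintro rfl
          have := (List.nodup_append.1 hnd.2).2.2 M hMm M (by simp)
          exact this rfl
        have hws : ∀ x ∈ ws, x ≤ w₃ := fun x hx => hω.2.2.1 x hx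
        have h12 : w₂ ≤ w₁ := hω.1 _ (Or.inl rfl)
        have h23 : w₃ ≤ w₂ := hω.2.1 _ (Or.inl rfl)
        have n12 : w₁ ≠ w₂ := fun h => hnω.1 (Or.inl h)
        have n13 : w₁ ≠ w₃ := fun h => hnω.1 (Or.inr (Or.inl h))
        have n23 : w₂ ≠ w₃ := fun h => hnω.2.1 (Or.inl h)
        have f1 : w₁ = a ∨ w₁ = b ∨ w₁ ≤ M := by
          rcases e1 with h | h | h
          exacts [Or.inl h, Or.inr (Or.inr (hM _ h)), Or.inr (Or.inl h)]
        have f2 : w₂ = a ∨ w₂ = b ∨ w₂ ≤ M := by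
          rcases e2 with h | h | h
          exacts [Or.inl h, Or.inr (Or.inr (hM _ h)), Or.inr (Or.inl h)]
        have f3 : w₃ = a ∨ w₃ = b ∨ w₃ ≤ M := by
          rcases e3 with h | h | h
          exacts [Or.inl h, Or.inr (Or.inr (hM _ h)), Or.inr (Or.inl h)]
        have g : M = w₁ ∨ M = w₂ ∨ M ≤ w₃ := by
          rcases h1 with h | h | h | h
          exacts [Or.inl h, Or.inr (Or.inl h), Or.inr (Or.inr h.le), Or.inr (Or.inr (hws _ h))]
        have hab : a ≠ b := fun h => hnd.1 (Or.inr h)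
        clear hω hnω hnd h1 h2 h3 e1 e2 e3 hmem hp hm hM hws hlen hmpos
        have hMv : M = if b = w₁ then (if a = w₂ then w₃ else w₂)
            else if a = w₁ then (if b = w₂ then w₃ else w₂) else w₁ := by
          grind
        rw [List.perm_iff_count]
        intro x
        simp only [hMv, pairMap, List.count_cons, List.count_nil]
        split_ifs <;> grind
      have e : piStep (w₁ :: w₂ :: w₃ :: ws) a b m' = (pairMap w₁ w₂ w₃ (a, b)).1 ::
        (m'.dropLast ++ [(pairMap w₁ w₂ w₃ (a, b)).2, w₁]) := rfl
      rw [e, List.perm_iff_count]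
      intro x
      have k1 := List.perm_iff_count.1 key x
      have k2 := List.perm_iff_count.1 hm x
      simp only [List.count_cons, List.count_append, List.count_nil] at k1 k2 ⊢
      omega
    · have hx' := (hmem x).2 hx
      simp only [List.pairwise_cons] at hω
      rcases List.mem_cons.1 hx' with rfl | h
      · exact le_rfl
      · exact hω.1 x h

theorem piList_perm : ∀ (n : ℕ) (l : List α), l.length = n → l.Nodup →
    (piList l).Perm l ∧ (l ≠ [] → ∃ pre W, piList l = pre ++ [W] ∧ ∀ x ∈ l, x ≤ W) := by
  intro n
  induction n using Nat.strong_induction_on with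
  | _ n ih =>
    intro l hl hnd
    match l, hl, hnd with
    | [], _, _ => simp [piList]
    | [a], _, _ => exact ⟨by simp [piList], fun _ => ⟨[], a, by simp [piList], by simp⟩⟩
    | [a, b], _, _ =>
      refine ⟨?_, fun _ => ⟨[min a b], max a b, by simp [piList], by simp⟩⟩
      rw [piList]
      rcases le_total a b with h | h
      · simp [h]
      · simpa [h] using List.Perm.swap a b []
    | a :: b :: d :: l, hl, hnd =>
      have e : a :: b :: d :: l =
          a :: ((b :: (d :: l).dropLast) ++ [(d :: l).getLast (by simp)]) := by
        rw [List.cons_append, List.dropLast_append_getLast]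
      have hnd' := hnd
      rw [e] at hnd'
      have hmd : (b :: (d :: l).dropLast).Nodup :=
        (List.nodup_append.1 (List.nodup_cons.1 hnd').2).1
      obtain ⟨h1, h2⟩ := ih _ (by simp [← hl]) (b :: (d :: l).dropLast) rfl hmd
      obtain ⟨pre, W, hW, hmax⟩ := h2 (by simp)
      have hs := piStep_perm (ω := (a :: b :: d :: l).insertionSort (· ≥ ·))
        (m' := piList (b :: (d :: l).dropLast)) (M := W)
        (List.pairwise_insertionSort _ _)
        ((List.perm_insertionSort _ _).trans (by rw [← e])) hnd'
        (by rw [hW] at h1 ⊢; simpa using h1) hmax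
      rw [← e] at hs
      rw [piList]
      exact ⟨hs.1, fun _ => hs.2⟩

theorem piList_ofFn_perm {N : ℕ} (p : Equiv.Perm (Fin N)) :
    (piList (List.ofFn p)).Perm (List.ofFn p) :=
  (piList_perm _ _ rfl (List.nodup_ofFn.2 p.injective)).1

theorem length_piList_ofFn {N : ℕ} (p : Equiv.Perm (Fin N)) :
    (piList (List.ofFn p)).length = N := by
  rw [(piList_ofFn_perm p).length_eq, List.length_ofFn]

/-- The map `π_N : 𝔖_N → 𝔖_N`, `p ↦ p'`, where `p` is identified with the sequence
`(p_1, …, p_N)` of its values. -/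
noncomputable def piMap {N : ℕ} (p : Equiv.Perm (Fin N)) : Equiv.Perm (Fin N) :=
  Equiv.ofBijective
    (fun i => (piList (List.ofFn p)).get (i.cast (length_piList_ofFn p).symm))
    (Finite.injective_iff_bijective.1 fun i j h => by
      have hn : (piList (List.ofFn p)).Nodup :=
        (piList_ofFn_perm p).nodup_iff.2 (List.nodup_ofFn.2 p.injective)
      simpa using List.nodup_iff_injective_get.1 hn h)

end PiMap

/-- The length `l(p)` of a permutation: its number of inversions. -/
def length {N : ℕ} (p : Equiv.Perm (Fin N)) : ℕ :=
  (Finset.univ.filter fun x : Fin N × Fin N => x.1 < x.2 ∧ p x.2 < p x.1).card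

end TwistedQYangian

/-! All operators act from the right on row vectors, so that $A^q_N$ enters only through its rows.
These are $q$-antisymmetric: every adjacent $P^q$ acts on them by $-1$. Such a vector vanishes on
sequences with a repetition, and $(-q)^{\mathrm{inv}(b)}f(b)$ does not change when the entries of
$b$ are permuted (`Asym.weight_eq`). On $N$ tensor factors it is therefore determined by its entry
at the identity sequence (`Asym.eq_weight`).

Existence and uniqueness. Since $R(u,q^{-2}u)=u(1-q^{-2})(1-P^q)$, the products $T_1(u_1)\cdots
T_N(u_N)$ and $\overline T_1(u_1^{-1})^t\cdots\overline T_N(u_N^{-1})^t$ preserve antisymmetry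
(`asym_prodSites`), and $R^t_{kl}$ acts on antisymmetric vectors by the scalar $u_k^{-1}-u_l$
(`vecMul_rtMat_of_asym`). The mixed relation sorts the Sklyanin product into (all $T$)(all
$R^t$)(all $\overline T^t$) (`RTTData.skl_eq`). Hence it preserves antisymmetry and multiplies every
row of $A^q_N$ by one common series. That series is unique because $A^q_N$ has the entry $1$ at the
identity sequence.

Expansion. The formula is proved for antisymmetric vectors supported on the arrangements of any set
$I$, by removing the first and the last tensor factor together. Let $e,k$ be the row indices in
these two factors. Three facts carry the step. (1) $S_1R^t_{12}\cdots R^t_{1r}$ acts on an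
antisymmetric vector like $\overline S^t$ in the first factor, up to a scalar
(`RTTData.vecMul_S_head`); this rests on the linear relation between $S$ and $\overline S^t$ in
`RTTData.smul_Sb`. (2) If $k$ differs from the other column indices, then every $R^t$ reaching the
last factor is a scalar (`RTTData.vecMul_sklInit_of_ne`). (3) $S(u)$ can be cancelled on the right,
so the product without its last $S$ is still antisymmetric in the other factors
(`RTTData.asym_vecMul_sklInit`), and their column indices may be reordered. The first column index
$c$ is chosen so that the remaining ones avoid $k$: it is $k$ unless $k=\max I$, and then it is the
second largest element of $I$. What is left is a Sklyanin product for the set $I\setminus\{e,k\}$.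
Matching its column indices with those of the induction hypothesis forces one further index, and
these two indices are `pairMap` of $(e,k)$; thus $\pi_N$ arises. The antisymmetric vector
contributes $(-q)^{-l(p)}$, the reorderings contribute $(-q)^{l(p')}$, and the scalars collect to
$\gamma_N(u)$. -/

namespace TwistedQYangian

open Matrix Function

/-! ### Row vectors and operators acting in given tensor factors -/

section Sites

variable {N r : ℕ} {A : Type*} [Ring A]

theorem matrix_ext_vecMul {ι κ : Type*} [Fintype ι] [DecidableEq ι] {M M' : Matrix ι κ A}
    (h : ∀ f : ι → A, f ᵥ* M = f ᵥ* M') : M = M' := by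
  ext a b
  have := congrFun (h (Pi.single a 1)) b
  simpa using this

theorem vecMul_oneSite (X : Matrix (Fin N) (Fin N) A) (k : Fin r) (f : (Fin r → Fin N) → A)
    (b : Fin r → Fin N) :
    (f ᵥ* oneSite X k) b = ∑ c, f (update b k c) * X c (b k) := by
  classical
  simp only [vecMul, dotProduct, oneSite, of_apply, mul_ite, mul_zero]
  rw [← Finset.sum_filter]
  symm
  refine Finset.sum_bij (fun c _ => update b k c) ?_ ?_ ?_ ?_
  · intro c _
    simp only [Finset.mem_filter, Finset.mem_univ, true_and]
    intro l hl
    simp [hl]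
  · intro c _ c' _ h
    simpa using congrFun h k
  · intro a ha
    simp only [Finset.mem_filter, Finset.mem_univ, true_and] at ha
    refine ⟨a k, Finset.mem_univ _, ?_⟩
    ext l
    by_cases hl : l = k
    · subst hl; simp
    · simp [hl, ha l hl]
  · intro c _
    simp

theorem vecMul_twoSite (M : Matrix (Fin N × Fin N) (Fin N × Fin N) A) {k l : Fin r} (hkl : k ≠ l)
    (f : (Fin r → Fin N) → A) (b : Fin r → Fin N) :
    (f ᵥ* twoSite M k l) b =
      ∑ c : Fin N × Fin N, f (update (update b k c.1) l c.2) * M c (b k, b l) := by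
  classical
  simp only [vecMul, dotProduct, twoSite, of_apply, mul_ite, mul_zero]
  rw [← Finset.sum_filter]
  symm
  refine Finset.sum_bij (fun c _ => update (update b k c.1) l c.2) ?_ ?_ ?_ ?_
  · intro c _
    simp only [Finset.mem_filter, Finset.mem_univ, true_and]
    intro m hm hm'
    simp [hm, hm']
  · intro c _ c' _ h
    have h1 := congrFun h k
    have h2 := congrFun h l
    simp [hkl] at h1 h2
    exact Prod.ext h1 h2
  · intro a ha
    simp only [Finset.mem_filter, Finset.mem_univ, true_and] at ha
    refine ⟨(a k, a l), Finset.mem_univ _, ?_⟩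
    ext m
    by_cases hm : m = l
    · subst hm; simp
    · by_cases hm' : m = k
      · subst hm'; simp [hm]
      · simp [hm, hm', ha m hm' hm]
  · intro c _
    simp [hkl]

theorem twoSite_mul (M M' : Matrix (Fin N × Fin N) (Fin N × Fin N) A) {k l : Fin r}
    (hkl : k ≠ l) : twoSite (M * M') k l = twoSite M k l * twoSite M' k l := by
  refine matrix_ext_vecMul fun f => ?_
  ext b
  rw [← vecMul_vecMul, vecMul_twoSite _ hkl, vecMul_twoSite _ hkl]
  simp only [vecMul_twoSite _ hkl, Matrix.mul_apply, Finset.mul_sum, Finset.sum_mul]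
  rw [Finset.sum_comm]
  refine Finset.sum_congr rfl fun c _ => Finset.sum_congr rfl fun d _ => ?_
  have : update (update (update (update b k c.1) l c.2) k d.1) l d.2 =
      update (update b k d.1) l d.2 := by
    ext m
    by_cases hm : m = l
    · subst hm; simp
    · by_cases hm' : m = k
      · subst hm'; simp [hm]
      · simp [hm, hm']
  rw [this]
  simp [hkl, mul_assoc]

theorem twoSite_one {k l : Fin r} (hkl : k ≠ l) :
    twoSite (1 : Matrix (Fin N × Fin N) (Fin N × Fin N) A) k l = 1 := by
  refine matrix_ext_vecMul fun f => ?_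
  ext b
  rw [vecMul_twoSite _ hkl, vecMul_one, Finset.sum_eq_single (b k, b l)]
  · simp
  · intro c _ hc
    simp [hc]
  · simp

theorem oneSite_mul (X Y : Matrix (Fin N) (Fin N) A) (k : Fin r) :
    oneSite (X * Y) k = oneSite X k * oneSite Y k := by
  refine matrix_ext_vecMul fun f => ?_
  ext b
  rw [← vecMul_vecMul, vecMul_oneSite, vecMul_oneSite]
  simp only [vecMul_oneSite, Matrix.mul_apply, Finset.mul_sum, Finset.sum_mul]
  rw [Finset.sum_comm]
  simp [mul_assoc]

theorem twoSite_kronecker_one (X : Matrix (Fin N) (Fin N) A) {k l : Fin r} (hkl : k ≠ l) :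
    twoSite (X ⊗ₖ (1 : Matrix (Fin N) (Fin N) A)) k l = oneSite X k := by
  refine matrix_ext_vecMul fun f => ?_
  ext b
  rw [vecMul_twoSite _ hkl, vecMul_oneSite, Fintype.sum_prod_type]
  refine Finset.sum_congr rfl fun c _ => ?_
  rw [Finset.sum_eq_single (b l)]
  · have : update (update b k c) l (b l) = update b k c := by
      ext m
      by_cases hm : m = l
      · subst hm; simp [hkl.symm]
      · simp [hm]
    simp [this, kroneckerMap_apply]
  · intro d _ hd
    simp [kroneckerMap_apply, hd]
  · simp

theorem twoSite_one_kronecker (X : Matrix (Fin N) (Fin N) A) {k l : Fin r} (hkl : k ≠ l) :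
    twoSite ((1 : Matrix (Fin N) (Fin N) A) ⊗ₖ X) k l = oneSite X l := by
  refine matrix_ext_vecMul fun f => ?_
  ext b
  rw [vecMul_twoSite _ hkl, vecMul_oneSite, Fintype.sum_prod_type, Finset.sum_comm]
  refine Finset.sum_congr rfl fun c _ => ?_
  rw [Finset.sum_eq_single (b k)]
  · simp [kroneckerMap_apply]
  · intro d _ hd
    simp [kroneckerMap_apply, hd]
  · simp

theorem oneSite_commute_twoSite {X : Matrix (Fin N) (Fin N) A}
    {M : Matrix (Fin N × Fin N) (Fin N × Fin N) A} {k i j : Fin r} (hij : i ≠ j)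
    (hki : k ≠ i) (hkj : k ≠ j) (h : ∀ a b c d, Commute (X a b) (M c d)) :
    Commute (oneSite X k) (twoSite M i j) := by
  refine matrix_ext_vecMul fun f => ?_
  ext b
  rw [← vecMul_vecMul, ← vecMul_vecMul, vecMul_twoSite _ hij, vecMul_oneSite]
  simp only [vecMul_oneSite, vecMul_twoSite _ hij, Finset.sum_mul]
  rw [Finset.sum_comm]
  refine Finset.sum_congr rfl fun c _ => Finset.sum_congr rfl fun d _ => ?_
  have : update (update (update b i d.1) j d.2) k c = update (update (update b k c) i d.1) j d.2 := by
    rw [update_comm hkj.symm, update_comm hki.symm]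
  rw [this]
  simp [hki, hkj, hki.symm, hkj.symm, mul_assoc, (h _ _ _ _).eq]

theorem twoSite_commute_twoSite {M M' : Matrix (Fin N × Fin N) (Fin N × Fin N) A}
    {k l i j : Fin r} (hkl : k ≠ l) (hij : i ≠ j) (hki : k ≠ i) (hkj : k ≠ j) (hli : l ≠ i)
    (hlj : l ≠ j) (h : ∀ a b c d, Commute (M a b) (M' c d)) :
    Commute (twoSite M k l) (twoSite M' i j) := by
  refine matrix_ext_vecMul fun f => ?_
  ext b
  rw [← vecMul_vecMul, ← vecMul_vecMul, vecMul_twoSite _ hij, vecMul_twoSite _ hkl]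
  simp only [vecMul_twoSite _ hkl, vecMul_twoSite _ hij, Finset.sum_mul]
  rw [Finset.sum_comm]
  refine Finset.sum_congr rfl fun c _ => Finset.sum_congr rfl fun d _ => ?_
  have : update (update (update (update b i d.1) j d.2) k c.1) l c.2 =
      update (update (update (update b k c.1) l c.2) i d.1) j d.2 := by
    rw [update_comm hkj.symm, update_comm hki.symm, update_comm hlj.symm, update_comm hli.symm]
  rw [this]
  simp [hki, hkj, hli, hlj, hki.symm, hkj.symm, hli.symm, hlj.symm, mul_assoc, (h _ _ _ _).eq]

/-- `1 ⊗ M` on `ℂ^N ⊗ (ℂ^N)^{⊗ r}`. -/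
def liftCons (M : Matrix (Fin r → Fin N) (Fin r → Fin N) A) :
    Matrix (Fin (r + 1) → Fin N) (Fin (r + 1) → Fin N) A :=
  Matrix.of fun a b => if a 0 = b 0 then M (Fin.tail a) (Fin.tail b) else 0

/-- `M ⊗ 1` on `(ℂ^N)^{⊗ r} ⊗ ℂ^N`. -/
def liftSnoc (M : Matrix (Fin r → Fin N) (Fin r → Fin N) A) :
    Matrix (Fin (r + 1) → Fin N) (Fin (r + 1) → Fin N) A :=
  Matrix.of fun a b => if a (Fin.last r) = b (Fin.last r) then M (Fin.init a) (Fin.init b) else 0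

theorem sum_cons {B : Type*} [AddCommMonoid B] (g : (Fin (r + 1) → Fin N) → B) :
    ∑ a, g a = ∑ c, ∑ a, g (Fin.cons c a) := by
  rw [← Fintype.sum_prod_type']
  exact (Fintype.sum_equiv (Fin.consEquiv fun _ => Fin N) _ _ fun _ => rfl).symm

theorem sum_snoc {B : Type*} [AddCommMonoid B] (g : (Fin (r + 1) → Fin N) → B) :
    ∑ a, g a = ∑ c, ∑ a, g (Fin.snoc a c) := by
  rw [← Fintype.sum_prod_type']
  exact (Fintype.sum_equiv (Fin.snocEquiv fun _ => Fin N) _ _ fun _ => rfl).symm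

theorem vecMul_liftCons (M : Matrix (Fin r → Fin N) (Fin r → Fin N) A)
    (f : (Fin (r + 1) → Fin N) → A) (c : Fin N) (b : Fin r → Fin N) :
    (f ᵥ* liftCons M) (Fin.cons c b) = ((fun a => f (Fin.cons c a)) ᵥ* M) b := by
  simp only [vecMul, dotProduct, liftCons, of_apply, mul_ite, mul_zero]
  rw [sum_cons, Finset.sum_eq_single c]
  · simp
  · intro d _ hd
    simp [hd]
  · simp

theorem vecMul_liftSnoc (M : Matrix (Fin r → Fin N) (Fin r → Fin N) A)
    (f : (Fin (r + 1) → Fin N) → A) (c : Fin N) (b : Fin r → Fin N) :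
    (f ᵥ* liftSnoc M) (Fin.snoc b c) = ((fun a => f (Fin.snoc a c)) ᵥ* M) b := by
  simp only [vecMul, dotProduct, liftSnoc, of_apply, mul_ite, mul_zero]
  rw [sum_snoc, Finset.sum_eq_single c]
  · simp
  · intro d _ hd
    simp [hd]
  · simp

theorem liftCons_one : liftCons (1 : Matrix (Fin r → Fin N) (Fin r → Fin N) A) = 1 := by
  refine matrix_ext_vecMul fun f => ?_
  ext b
  rw [← Fin.cons_self_tail b, vecMul_liftCons, vecMul_one, vecMul_one]

theorem liftCons_mul (M M' : Matrix (Fin r → Fin N) (Fin r → Fin N) A) :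
    liftCons (M * M') = liftCons M * liftCons M' := by
  refine matrix_ext_vecMul fun f => ?_
  ext b
  rw [← Fin.cons_self_tail b, ← vecMul_vecMul, vecMul_liftCons, vecMul_liftCons]
  simp only [vecMul_liftCons]
  rw [← vecMul_vecMul]

theorem liftSnoc_one : liftSnoc (1 : Matrix (Fin r → Fin N) (Fin r → Fin N) A) = 1 := by
  refine matrix_ext_vecMul fun f => ?_
  ext b
  rw [← Fin.snoc_init_self b, vecMul_liftSnoc, vecMul_one, vecMul_one]

theorem liftSnoc_mul (M M' : Matrix (Fin r → Fin N) (Fin r → Fin N) A) :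
    liftSnoc (M * M') = liftSnoc M * liftSnoc M' := by
  refine matrix_ext_vecMul fun f => ?_
  ext b
  rw [← Fin.snoc_init_self b, ← vecMul_vecMul, vecMul_liftSnoc, vecMul_liftSnoc]
  simp only [vecMul_liftSnoc]
  rw [← vecMul_vecMul]

theorem liftCons_prod (L : List (Matrix (Fin r → Fin N) (Fin r → Fin N) A)) :
    liftCons L.prod = (L.map liftCons).prod := by
  induction L with
  | nil => simp [liftCons_one]
  | cons M L ih => simp [liftCons_mul, ih]

theorem liftSnoc_prod (L : List (Matrix (Fin r → Fin N) (Fin r → Fin N) A)) :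
    liftSnoc L.prod = (L.map liftSnoc).prod := by
  induction L with
  | nil => simp [liftSnoc_one]
  | cons M L ih => simp [liftSnoc_mul, ih]

theorem liftCons_oneSite (X : Matrix (Fin N) (Fin N) A) (k : Fin r) :
    liftCons (oneSite X k) = oneSite X k.succ := by
  ext a b
  simp only [liftCons, oneSite, of_apply, Fin.forall_fin_succ, Fin.tail]
  have : (0 : Fin (r + 1)) ≠ k.succ := (Fin.succ_ne_zero k).symm
  simp only [ne_eq, this, not_false_eq_true, forall_const, Fin.succ_inj, ite_and]
  congr!

theorem liftCons_twoSite (M : Matrix (Fin N × Fin N) (Fin N × Fin N) A) (k l : Fin r) :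
    liftCons (twoSite M k l) = twoSite M k.succ l.succ := by
  ext a b
  simp only [liftCons, twoSite, of_apply, Fin.forall_fin_succ, Fin.tail]
  have h1 : (0 : Fin (r + 1)) ≠ k.succ := (Fin.succ_ne_zero k).symm
  have h2 : (0 : Fin (r + 1)) ≠ l.succ := (Fin.succ_ne_zero l).symm
  simp only [ne_eq, h1, h2, not_false_eq_true, forall_const, Fin.succ_inj, ite_and]
  congr!

theorem liftSnoc_oneSite (X : Matrix (Fin N) (Fin N) A) (k : Fin r) :
    liftSnoc (oneSite X k) = oneSite X k.castSucc := by
  ext a b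
  simp only [liftSnoc, oneSite, of_apply, Fin.forall_fin_succ', Fin.init]
  have : Fin.last r ≠ k.castSucc := (Fin.castSucc_lt_last k).ne'
  by_cases h : a (Fin.last r) = b (Fin.last r) <;> simp [this, h]
  congr!

theorem liftSnoc_twoSite (M : Matrix (Fin N × Fin N) (Fin N × Fin N) A) (k l : Fin r) :
    liftSnoc (twoSite M k l) = twoSite M k.castSucc l.castSucc := by
  ext a b
  simp only [liftSnoc, twoSite, of_apply, Fin.forall_fin_succ', Fin.init]
  have h1 : Fin.last r ≠ k.castSucc := (Fin.castSucc_lt_last k).ne'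
  have h2 : Fin.last r ≠ l.castSucc := (Fin.castSucc_lt_last l).ne'
  by_cases h : a (Fin.last r) = b (Fin.last r) <;> simp [h1, h2, h]
  congr!

theorem vecMul_oneSite_zero (X : Matrix (Fin N) (Fin N) A) (f : (Fin (r + 1) → Fin N) → A)
    (c : Fin N) (b : Fin r → Fin N) :
    (f ᵥ* oneSite X 0) (Fin.cons c b) = ∑ e, f (Fin.cons e b) * X e c := by
  rw [vecMul_oneSite]
  simp [Fin.update_cons_zero]

theorem vecMul_oneSite_last (X : Matrix (Fin N) (Fin N) A) (f : (Fin (r + 1) → Fin N) → A)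
    (c : Fin N) (b : Fin r → Fin N) :
    (f ᵥ* oneSite X (Fin.last r)) (Fin.snoc b c) = ∑ e, f (Fin.snoc b e) * X e c := by
  rw [vecMul_oneSite]
  simp [Fin.update_snoc_last]

theorem liftCons_commute_oneSite {Y : Matrix (Fin N) (Fin N) A}
    {M : Matrix (Fin r → Fin N) (Fin r → Fin N) A} (h : ∀ a b c d, Commute (Y a b) (M c d)) :
    Commute (oneSite Y 0) (liftCons M) := by
  refine matrix_ext_vecMul fun f => ?_
  ext b
  rw [← Fin.cons_self_tail b, ← vecMul_vecMul, ← vecMul_vecMul, vecMul_liftCons,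
    vecMul_oneSite_zero]
  simp only [vecMul_liftCons, vecMul_oneSite_zero]
  simp only [vecMul, dotProduct, Finset.sum_mul]
  rw [Finset.sum_comm]
  refine Finset.sum_congr rfl fun c _ => Finset.sum_congr rfl fun d _ => ?_
  rw [mul_assoc, mul_assoc, (h _ _ _ _).eq]

end Sites

/-! ### Inversions -/

section Inversions

variable {α : Type*} [LinearOrder α] {r : ℕ}

/-- The number of inversions of a finite sequence. -/
def invNum (b : Fin r → α) : ℕ :=
  ∑ i, ∑ j, if i < j ∧ b j < b i then 1 else 0

theorem length_eq_invNum {N : ℕ} (p : Equiv.Perm (Fin N)) : length p = invNum p := by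
  rw [length, invNum, Finset.card_filter, Fintype.sum_prod_type]

theorem AdjIdx.left_ne_right (k : AdjIdx r) : k.left ≠ k.right := by
  simp [AdjIdx.left, AdjIdx.right]

theorem AdjIdx.left_lt_right (k : AdjIdx r) : k.left < k.right := by
  simp [AdjIdx.left, AdjIdx.right, Fin.lt_def]

theorem AdjIdx.swap_lt_swap (k : AdjIdx r) {i j : Fin r} (h1 : ¬(i = k.left ∧ j = k.right))
    (h2 : ¬(i = k.right ∧ j = k.left)) :
    Equiv.swap k.left k.right i < Equiv.swap k.left k.right j ↔ i < j := by
  simp only [Equiv.swap_apply_def]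
  have hl : (k.left : ℕ) = k.1 := rfl
  have hr : (k.right : ℕ) = k.1 + 1 := rfl
  simp only [Fin.ext_iff, hl, hr] at h1 h2 ⊢
  split_ifs <;> simp only [Fin.lt_def, hl, hr] <;> omega

/-- After reindexing by the swap `s`, the inversions of `b ∘ s` are the pairs with `s i < s j` and
`b j < b i`. An adjacent swap keeps the order of every pair except the swapped one, which supplies
the additional inversion. -/
theorem invNum_comp_swap (b : Fin r → α) (k : AdjIdx r) (h : b k.left < b k.right) :
    invNum (b ∘ Equiv.swap k.left k.right) = invNum b + 1 := by
  set s := Equiv.swap k.left k.right with hs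
  have e1 : invNum (b ∘ s) = ∑ i, ∑ j, if s i < s j ∧ b j < b i then 1 else 0 := by
    rw [invNum, ← Equiv.sum_comp s]
    refine Finset.sum_congr rfl fun i _ => ?_
    rw [← Equiv.sum_comp s]
    simp [hs]
  have e2 : (∑ i, ∑ j, if i = k.right ∧ j = k.left then 1 else 0) = 1 := by
    simp [ite_and]
  have e3 : ∀ i j, (if s i < s j ∧ b j < b i then 1 else 0) =
      (if i < j ∧ b j < b i then 1 else 0) + if i = k.right ∧ j = k.left then 1 else 0 := by
    intro i j
    by_cases c1 : i = k.left ∧ j = k.right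
    · obtain ⟨rfl, rfl⟩ := c1
      simp [h.not_gt, k.left_ne_right]
    by_cases c2 : i = k.right ∧ j = k.left
    · obtain ⟨rfl, rfl⟩ := c2
      simp [hs, h, k.left_lt_right, k.left_lt_right.not_gt]
    simp only [hs, k.swap_lt_swap c1 c2, c2, if_false, add_zero]
  rw [e1]
  simp only [e3, Finset.sum_add_distrib, e2, invNum]

theorem invNum_cons (e : α) (a : Fin r → α) :
    invNum (Fin.cons e a : Fin (r + 1) → α) = invNum a + ∑ j, if a j < e then 1 else 0 := by
  simp only [invNum, Fin.sum_univ_succ, Fin.cons_zero, Fin.cons_succ, false_and,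
    if_false, zero_add, Fin.succ_pos, true_and, Fin.not_lt_zero, Fin.succ_lt_succ_iff]
  rw [add_comm]

theorem invNum_snoc (a : Fin r → α) (e : α) :
    invNum (Fin.snoc a e : Fin (r + 1) → α) = invNum a + ∑ j, if e < a j then 1 else 0 := by
  have h0 : ∀ i : Fin r, ¬ Fin.last r < i.castSucc := fun i => (Fin.castSucc_lt_last i).not_gt
  simp only [invNum, Fin.sum_univ_castSucc, Fin.snoc_castSucc, Fin.snoc_last, lt_self_iff_false,
    h0, false_and, if_false, Finset.sum_const_zero, add_zero, Finset.sum_add_distrib]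
  simp [Fin.castSucc_lt_last]

end Inversions

/-! ### The operators `P^q` and `R^t` -/

section Operators

variable {N r : ℕ} {K A : Type*} [Field K] [Ring A] [Algebra K A]

/-- The nonzero entries of `P^q`. -/
def pq (q : K) (i j : Fin N) : K := if j < i then q else if i < j then q⁻¹ else 1

theorem pq_self (q : K) (i : Fin N) : pq q i i = 1 := by simp [pq]

theorem pq_mul_pq {q : K} (hq : q ≠ 0) (i j : Fin N) : pq q i j * pq q j i = 1 := by
  rcases lt_trichotomy i j with h | h | h
  · simp [pq, h, h.not_gt, hq]
  · simp [pq, h]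
  · simp [pq, h, h.not_gt, hq]

/-- The operator `P^q` over an arbitrary field. -/
def permMat (N : ℕ) (q : K) : Matrix (Fin N × Fin N) (Fin N × Fin N) K :=
  Matrix.of fun a b => if a.1 = b.2 ∧ a.2 = b.1 then pq q a.1 a.2 else 0

/-- The coefficients of `R^t(x, y)` on the vectors `e_b ⊗ e_b`. -/
def rho (q x y : K) (c b : Fin N) : K :=
  if c < b then (q⁻¹ - q) * x else if b < c then (q⁻¹ - q) * y else q⁻¹ * x - q * y

/-- The operator `R^t(x, y)` over an arbitrary field. -/
def rtMat (N : ℕ) (q x y : K) : Matrix (Fin N × Fin N) (Fin N × Fin N) K :=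
  Matrix.of fun a b =>
    if b.1 = b.2 then if a.1 = a.2 then rho q x y a.1 b.1 else 0 else if a = b then x - y else 0

/-- Extension of scalars for matrices. -/
abbrev base (A : Type*) [Ring A] [Algebra K A] {ι κ : Type*} (M : Matrix ι κ K) : Matrix ι κ A :=
  M.map (algebraMap K A)

theorem base_commute {ι κ : Type*} (M : Matrix ι κ K) (a : A) (i : ι) (j : κ) :
    Commute a (base A M i j) := (Algebra.commutes _ _).symm

theorem base_mul {ι κ o : Type*} [Fintype κ] (M : Matrix ι κ K) (M' : Matrix κ o K) :
    base A (M * M') = base A M * base A M' := Matrix.map_mul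

theorem base_one {ι : Type*} [DecidableEq ι] : base A (1 : Matrix ι ι K) = 1 :=
  Matrix.map_one _ (map_zero _) (map_one _)

theorem permMat_mul_self {q : K} (hq : q ≠ 0) : permMat N q * permMat N q = 1 := by
  ext ⟨a, b⟩ ⟨c, d⟩
  rw [Matrix.mul_apply, Finset.sum_eq_single (b, a)]
  · by_cases h : a = c ∧ b = d
    · obtain ⟨rfl, rfl⟩ := h
      simp [permMat, pq_mul_pq hq]
    · have h' : ¬(b = d ∧ a = c) := fun h' => h ⟨h'.2, h'.1⟩
      simp [permMat, h, h']
  · rintro ⟨x, y⟩ _ hxy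
    have : ¬(a = y ∧ b = x) := by
      rintro ⟨rfl, rfl⟩; exact hxy rfl
    simp [permMat, this]
  · simp

theorem vecMul_permMat (q : K) {k l : Fin r} (hkl : k ≠ l) (f : (Fin r → Fin N) → A)
    (b : Fin r → Fin N) :
    (f ᵥ* twoSite (base A (permMat N q)) k l) b =
      pq q (b l) (b k) • f (b ∘ Equiv.swap k l) := by
  rw [vecMul_twoSite _ hkl, Finset.sum_eq_single (b l, b k)]
  · have : update (update b k (b l)) l (b k) = b ∘ Equiv.swap k l := by
      ext m
      by_cases hm : m = l
      · subst hm; simp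
      · by_cases hm' : m = k
        · subst hm'; simp [hm]
        · simp [hm, hm', Equiv.swap_apply_of_ne_of_ne]
    simp [this, permMat, Algebra.smul_def, Algebra.commutes]
  · rintro ⟨x, y⟩ _ hxy
    have : ¬(x = b l ∧ y = b k) := by
      rintro ⟨rfl, rfl⟩; exact hxy rfl
    simp [permMat, this]
  · simp

theorem vecMul_rtMat (q x y : K) {k l : Fin r} (hkl : k ≠ l) (f : (Fin r → Fin N) → A)
    (b : Fin r → Fin N) :
    (f ᵥ* twoSite (base A (rtMat N q x y)) k l) b =
      if b k = b l then ∑ c, rho q x y c (b k) • f (update (update b k c) l c)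
      else (x - y) • f b := by
  rw [vecMul_twoSite _ hkl]
  split_ifs with h
  · rw [Fintype.sum_prod_type]
    refine Finset.sum_congr rfl fun c _ => ?_
    rw [Finset.sum_eq_single c]
    · simp [rtMat, h, Algebra.smul_def, Algebra.commutes]
    · intro d _ hd
      simp [rtMat, h, hd.symm]
    · simp
  · rw [Finset.sum_eq_single (b k, b l)]
    · simp only [rtMat, map_apply, of_apply, h, if_false, if_true, update_eq_self, Algebra.smul_def]
      exact (Algebra.commutes _ _).symm
    · intro d _ hd
      simp [rtMat, h, hd]
    · simp

/-! ### `q`-antisymmetric row vectors -/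

/-- A row vector is `q`-antisymmetric in the tensor factors `k` and `l` if `P^q_{kl}` acts on it
by `-1`. -/
def AsymAt (q : K) (k l : Fin r) (f : (Fin r → Fin N) → A) : Prop :=
  ∀ b, f b = -(pq q (b l) (b k) • f (b ∘ Equiv.swap k l))

/-- A row vector is `q`-antisymmetric if it is so in any two adjacent tensor factors. -/
def Asym (q : K) (f : (Fin r → Fin N) → A) : Prop :=
  ∀ k : AdjIdx r, AsymAt q k.left k.right f

theorem asymAt_iff {q : K} {k l : Fin r} (hkl : k ≠ l) {f : (Fin r → Fin N) → A} :
    AsymAt q k l f ↔ f ᵥ* twoSite (base A (permMat N q)) k l = -f := by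
  rw [funext_iff]
  simp only [vecMul_permMat q hkl, AsymAt, Pi.neg_apply]
  exact forall_congr' fun b => ⟨fun h => by rw [h, neg_neg], fun h => by rw [h, neg_neg]⟩

variable {q : K}

/-- The weight turns antisymmetry into invariance: swapping two adjacent increasing entries adds one
inversion, and $P^q$ has the coefficient $q$ there, so the factor $-q$ is absorbed exactly. -/
theorem Asym.weight_comp_swap {f : (Fin r → Fin N) → A} (hf : Asym q f)
    (k : AdjIdx r) (b : Fin r → Fin N) :
    (-q) ^ invNum (b ∘ Equiv.swap k.left k.right) • f (b ∘ Equiv.swap k.left k.right) =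
      (-q) ^ invNum b • f b := by
  have key : ∀ b : Fin r → Fin N, b k.left < b k.right →
      (-q) ^ invNum (b ∘ Equiv.swap k.left k.right) • f (b ∘ Equiv.swap k.left k.right) =
      (-q) ^ invNum b • f b := by
    intro b h
    rw [hf k b, invNum_comp_swap b k h, pow_succ, mul_smul]
    simp [pq, h]
  rcases lt_trichotomy (b k.left) (b k.right) with h | h | h
  · exact key b h
  · have : b ∘ Equiv.swap k.left k.right = b := by
      ext m
      simp only [Function.comp_apply, Equiv.swap_apply_def]
      split_ifs with h1 h2
      · rw [h1, h]
      · rw [h2, h]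
      · rfl
    rw [this]
  · have := key (b ∘ Equiv.swap k.left k.right) (by simpa using h)
    have e : (b ∘ Equiv.swap k.left k.right) ∘ Equiv.swap k.left k.right = b := by
      ext m; simp
    rw [e] at this
    exact this.symm

theorem Asym.weight_comp_perm {f : (Fin r → Fin N) → A} (hf : Asym q f)
    (σ : Equiv.Perm (Fin r)) (b : Fin r → Fin N) :
    (-q) ^ invNum (b ∘ σ) • f (b ∘ σ) = (-q) ^ invNum b • f b := by
  obtain ⟨w, rfl⟩ := exists_wordPerm σ
  induction w generalizing b with
  | nil => simp [wordPerm]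
  | cons k w ih =>
    have : b ∘ wordPerm (k :: w) = (b ∘ Equiv.swap k.left k.right) ∘ wordPerm w := by
      ext m; simp [wordPerm]
    rw [this, ih, hf.weight_comp_swap]

theorem exists_comp_perm {b b' : Fin r → Fin N} (hb : Injective b) (hb' : Injective b')
    (h : Set.range b' = Set.range b) : ∃ σ : Equiv.Perm (Fin r), b' = b ∘ σ := by
  refine ⟨(Equiv.ofInjective b' hb').trans
    ((Equiv.setCongr h).trans (Equiv.ofInjective b hb).symm), ?_⟩
  ext m
  simp [Equiv.apply_ofInjective_symm hb]

theorem Asym.weight_eq {f : (Fin r → Fin N) → A} (hf : Asym q f)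
    {b b' : Fin r → Fin N} (hb : Injective b) (hb' : Injective b')
    (h : Set.range b' = Set.range b) : (-q) ^ invNum b • f b = (-q) ^ invNum b' • f b' := by
  obtain ⟨σ, rfl⟩ := exists_comp_perm hb hb' h
  exact (hf.weight_comp_perm σ b).symm

theorem exists_perm_pair {i j k l : Fin r} (hij : i ≠ j) (hkl : k ≠ l) :
    ∃ σ : Equiv.Perm (Fin r), σ k = i ∧ σ l = j := by
  refine ⟨Equiv.swap k i * Equiv.swap l (Equiv.swap k i j), ?_, ?_⟩
  · have h : k ≠ Equiv.swap k i j := by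
      intro h
      have := congrArg (Equiv.swap k i) h
      simp at this
      exact hij this
    simp [Equiv.swap_apply_of_ne_of_ne hkl h]
  · simp

/-- At equal indices $P^q$ has the coefficient $1$, so that `f b = -f b`. -/
theorem AsymAt.eq_zero [NeZero (2 : K)] {f : (Fin r → Fin N) → A} {k l : Fin r}
    (hf : AsymAt q k l f) {b : Fin r → Fin N} (h : b k = b l) : f b = 0 := by
  have e : b ∘ Equiv.swap k l = b := by
    ext m
    simp only [Function.comp_apply, Equiv.swap_apply_def]
    split_ifs with h1 h2
    · rw [h1, h]
    · rw [h2, h]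
    · rfl
  have := hf b
  rw [e, h, pq_self, one_smul] at this
  have h2 : (2 : K) • f b = 0 := by
    rw [two_smul]; nth_rewrite 1 [this]; simp
  have h3 := congrArg (fun z => (2 : K)⁻¹ • z) h2
  simpa [smul_smul, NeZero.ne (2 : K)] using h3

theorem Asym.eq_zero [NeZero (2 : K)] (hq : q ≠ 0) {f : (Fin r → Fin N) → A} (hf : Asym q f)
    {b : Fin r → Fin N} {i j : Fin r} (hij : i ≠ j) (h : b i = b j) : f b = 0 := by
  have hr : 1 < r := by
    rcases r with _ | _ | r
    · exact i.elim0
    · exact absurd (Fin.ext (by omega)) hij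
    · omega
  -- A permutation carries the two equal entries to the first two places, where antisymmetry
  -- applies; the weighted entries before and after agree.
  obtain ⟨σ, h1, h2⟩ := exists_perm_pair hij (AdjIdx.left_ne_right (⟨0, hr⟩ : AdjIdx r))
  have h0 : f (b ∘ σ) = 0 := (hf ⟨0, hr⟩).eq_zero (by simp [h1, h2, h])
  have := hf.weight_comp_perm σ b
  rw [h0, smul_zero] at this
  have h3 := congrArg (fun z => ((-q) ^ invNum b)⁻¹ • z) this
  simpa [smul_smul, hq] using h3.symm

theorem Asym.eq_zero_of_not_injective [NeZero (2 : K)] (hq : q ≠ 0) {f : (Fin r → Fin N) → A}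
    (hf : Asym q f) {b : Fin r → Fin N} (h : ¬ Injective b) : f b = 0 := by
  simp only [Injective, not_forall] at h
  obtain ⟨i, j, h, hij⟩ := h
  exact hf.eq_zero hq hij h

theorem Asym.ext [NeZero (2 : K)] (hq : q ≠ 0) {f g : (Fin r → Fin N) → A} (hf : Asym q f)
    (hg : Asym q g) {b : Fin r → Fin N} (σ : Equiv.Perm (Fin r)) (h : f (b ∘ σ) = g (b ∘ σ)) :
    f b = g b := by
  have h1 := hf.weight_comp_perm σ b
  rw [h, hg.weight_comp_perm σ b] at h1
  have h3 := congrArg (fun z => ((-q) ^ invNum b)⁻¹ • z) h1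
  simpa [smul_smul, hq] using h3.symm

theorem Asym.cons {f : (Fin (r + 1) → Fin N) → A} (hf : Asym q f) (c : Fin N) :
    Asym q fun a => f (Fin.cons c a) := by
  intro k b
  have := hf ⟨k.1 + 1, by have := k.2; omega⟩ (Fin.cons c b)
  have e1 : AdjIdx.left (⟨k.1 + 1, by have := k.2; omega⟩ : AdjIdx (r + 1)) = k.left.succ := rfl
  have e2 : AdjIdx.right (⟨k.1 + 1, by have := k.2; omega⟩ : AdjIdx (r + 1)) = k.right.succ := rfl
  rw [e1, e2] at this
  have e3 : (Fin.cons c b : Fin (r + 1) → Fin N) ∘ Equiv.swap k.left.succ k.right.succ =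
      Fin.cons c (b ∘ Equiv.swap k.left k.right) := by
    ext m
    refine Fin.cases ?_ (fun m => ?_) m
    · simp [Equiv.swap_apply_of_ne_of_ne, (Fin.succ_ne_zero _).symm]
    · simp only [Function.comp_apply, Equiv.swap_apply_def, Fin.succ_inj, Fin.cons_succ]
      split_ifs <;> simp
  rw [e3] at this
  simpa using this

theorem Asym.snoc {f : (Fin (r + 1) → Fin N) → A} (hf : Asym q f) (c : Fin N) :
    Asym q fun a => f (Fin.snoc a c) := by
  intro k b
  have := hf ⟨k.1, by have := k.2; omega⟩ (Fin.snoc b c)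
  have e1 : AdjIdx.left (⟨k.1, by have := k.2; omega⟩ : AdjIdx (r + 1)) = k.left.castSucc := rfl
  have e2 : AdjIdx.right (⟨k.1, by have := k.2; omega⟩ : AdjIdx (r + 1)) = k.right.castSucc := rfl
  rw [e1, e2] at this
  have e3 : (Fin.snoc b c : Fin (r + 1) → Fin N) ∘ Equiv.swap k.left.castSucc k.right.castSucc =
      Fin.snoc (b ∘ Equiv.swap k.left k.right) c := by
    ext m
    refine Fin.lastCases ?_ (fun m => ?_) m
    · simp [Equiv.swap_apply_of_ne_of_ne, (Fin.castSucc_lt_last _).ne']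
    · simp only [Function.comp_apply, Equiv.swap_apply_def, Fin.castSucc_inj, Fin.snoc_castSucc]
      split_ifs <;> simp
  rw [e3] at this
  simpa using this

/-- On unequal indices $R^t(x,y)$ is the scalar $x-y$. The rest of it only mixes entries whose
indices in the two factors are equal, and there `f` vanishes. -/
theorem vecMul_rtMat_of_asym [NeZero (2 : K)] (hq : q ≠ 0) (x y : K) {k l : Fin r} (hkl : k ≠ l)
    {f : (Fin r → Fin N) → A} (hf : Asym q f) :
    f ᵥ* twoSite (base A (rtMat N q x y)) k l = (x - y) • f := by
  ext b
  rw [vecMul_rtMat q x y hkl]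
  split_ifs with h
  · rw [Pi.smul_apply, hf.eq_zero hq hkl h, smul_zero]
    refine Finset.sum_eq_zero fun c _ => ?_
    rw [hf.eq_zero hq hkl (by simp [hkl]), smul_zero]
  · rfl

/-- Antisymmetry means `f = ½ f (1 - P)`, so `f B = ½ f C (1 - P)`, and `(1 - P) P = -(1 - P)`
because `P² = 1`. -/
theorem asymAt_mul {k l : Fin r} (hkl : k ≠ l) (hq : q ≠ 0) [NeZero (2 : K)]
    {B C : Matrix (Fin r → Fin N) (Fin r → Fin N) A}
    (h : (1 - twoSite (base A (permMat N q)) k l) * B = C * (1 - twoSite (base A (permMat N q)) k l))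
    {f : (Fin r → Fin N) → A} (hf : AsymAt q k l f) : AsymAt q k l (f ᵥ* B) := by
  rw [asymAt_iff hkl] at hf ⊢
  set P := twoSite (base A (permMat N q)) k l with hP
  have hPP : P * P = 1 := by
    rw [hP, ← twoSite_mul _ _ hkl, ← base_mul, permMat_mul_self hq, base_one, twoSite_one hkl]
  have h1 : (2 : K) • (f ᵥ* B) = f ᵥ* (C * (1 - P)) := by
    rw [← h, ← vecMul_vecMul, vecMul_sub, vecMul_one, hf, two_smul, sub_neg_eq_add, add_vecMul]
  have h2 : ((2 : K) • (f ᵥ* B)) ᵥ* P = -((2 : K) • (f ᵥ* B)) := by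
    rw [h1, vecMul_vecMul, mul_assoc, sub_mul, one_mul, hPP, ← vecMul_neg, ← mul_neg, neg_sub]
  have h3 : f ᵥ* B = (2 : K)⁻¹ • ((2 : K) • (f ᵥ* B)) := by
    rw [smul_smul, inv_mul_cancel₀ (NeZero.ne _), one_smul]
  rw [h3, smul_vecMul, h2, smul_neg]

theorem asymAt_mul_of_commute {k l : Fin r} (hkl : k ≠ l)
    {B : Matrix (Fin r → Fin N) (Fin r → Fin N) A}
    (h : Commute B (twoSite (base A (permMat N q)) k l))
    {f : (Fin r → Fin N) → A} (hf : AsymAt q k l f) : AsymAt q k l (f ᵥ* B) := by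
  rw [asymAt_iff hkl] at hf ⊢
  rw [vecMul_vecMul, h.eq, ← vecMul_vecMul, hf, neg_vecMul]

end Operators

/-! ### The Yang–Baxter equation for `R^t` and `P^q` -/

section YangBaxter

variable {N r : ℕ} {K A : Type*} [Field K] [Ring A] [Algebra K A] {q : K}

/-- The coefficient of `V c c d` in `act_asym` at the indices `(b, b, d)`, checked for each relative
order of the three indices. The case `b = d` is `rho_relation_self`. -/
theorem rho_relation (hq : q ≠ 0) (x y : K) {b c d : Fin N} (hbd : b ≠ d) (hcd : c ≠ d) :
    (x - q⁻¹ ^ 2 * y) * rho q x y c b =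
      -(pq q d b * (rho q x (q⁻¹ ^ 2 * y) d b * rho q x y c d -
        rho q x (q⁻¹ ^ 2 * y) c b * ((x - y) * pq q c d))) := by
  rcases lt_trichotomy b d with h1 | h1 | h1 <;> [skip; exact absurd h1 hbd; skip] <;>
  rcases lt_trichotomy c d with h2 | h2 | h2 <;> [skip; exact absurd h2 hcd; skip; skip;
    exact absurd h2 hcd; skip] <;>
  rcases lt_trichotomy c b with h3 | h3 | h3 <;>
  first
  | (exfalso; omega)
  | (simp only [rho, pq, h1, h2, h3, h1.not_gt, h2.not_gt, h3.not_gt, if_true, if_false,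
      lt_irrefl]; field_simp; ring)

theorem rho_relation_self (hq : q ≠ 0) (x y : K) {b c : Fin N} (hcb : c ≠ b) :
    rho q x (q⁻¹ ^ 2 * y) b b * rho q x y c b -
      rho q x (q⁻¹ ^ 2 * y) c b * ((x - y) * pq q c b) = 0 := by
  rcases lt_trichotomy c b with h | h | h
  · simp only [rho, pq, h, h.not_gt, if_true, if_false, lt_irrefl]; field_simp; ring
  · exact absurd h hcb
  · simp only [rho, pq, h, h.not_gt, if_true, if_false, lt_irrefl]; field_simp; ring

/-- The action of `R^t` in the first two of three tensor factors. -/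
def act₁₂ (q x y : K) (V : Fin N → Fin N → Fin N → A) (a b c : Fin N) : A :=
  if a = b then ∑ e, rho q x y e a • V e e c else (x - y) • V a b c

/-- The action of `R^t` in the first and the third of three tensor factors. -/
def act₁₃ (q x y : K) (V : Fin N → Fin N → Fin N → A) (a b c : Fin N) : A :=
  if a = c then ∑ e, rho q x y e a • V e b e else (x - y) • V a b c

/-- Antisymmetry rewrites `V c d c` as a multiple of `V c c d`, so a single family of unknowns
remains, and `act_asym` becomes a comparison of scalar coefficients. -/
theorem act_diag (x y : K)
    {V : Fin N → Fin N → Fin N → A} (hV : ∀ a b c, V a b c = -(pq q c b • V a c b))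
    (h0 : ∀ a b, V a b b = 0) (b d : Fin N) :
    act₁₃ q x (q⁻¹ ^ 2 * y) (act₁₂ q x y V) b d b =
      ∑ c, (rho q x (q⁻¹ ^ 2 * y) d b * rho q x y c d -
        rho q x (q⁻¹ ^ 2 * y) c b * ((x - y) * pq q c d)) • V c c d := by
  have e1 : ∀ c, rho q x (q⁻¹ ^ 2 * y) c b • act₁₂ q x y V c d c =
      (if c = d then rho q x (q⁻¹ ^ 2 * y) d b • ∑ e, rho q x y e d • V e e d else 0) -
        (rho q x (q⁻¹ ^ 2 * y) c b * ((x - y) * pq q c d)) • V c c d := by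
    intro c
    by_cases h : c = d
    · subst h
      simp [act₁₂, h0]
    · rw [act₁₂, if_neg h, if_neg h, hV c d c, zero_sub, smul_neg, smul_neg, smul_smul, smul_smul,
        mul_assoc]
  rw [act₁₃, if_pos rfl]
  simp only [e1, Finset.sum_sub_distrib, sub_smul, Finset.sum_ite_eq', Finset.mem_univ, if_true,
    Finset.smul_sum, smul_smul]

/-- Three tensor factors suffice: this is the Yang–Baxter equation at the ratio $q^{-2}$ of the last
two parameters, where $R$ degenerates to a multiple of $1-P^q$. Only indices with `a = b` or `a = c`
need a computation; otherwise both operators are scalars. -/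
theorem act_asym (hq : q ≠ 0) (x y : K)
    {V : Fin N → Fin N → Fin N → A} (hV : ∀ a b c, V a b c = -(pq q c b • V a c b))
    (h0 : ∀ a b, V a b b = 0) (a b c : Fin N) :
    act₁₃ q x (q⁻¹ ^ 2 * y) (act₁₂ q x y V) a b c =
      -(pq q c b • act₁₃ q x (q⁻¹ ^ 2 * y) (act₁₂ q x y V) a c b) := by
  have key : ∀ b d : Fin N, b ≠ d → act₁₃ q x (q⁻¹ ^ 2 * y) (act₁₂ q x y V) b b d =
      -(pq q d b • act₁₃ q x (q⁻¹ ^ 2 * y) (act₁₂ q x y V) b d b) := by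
    intro b d hbd
    rw [act_diag x y hV h0, act₁₃, if_neg hbd, act₁₂, if_pos rfl, Finset.smul_sum, Finset.smul_sum,
      ← Finset.sum_neg_distrib]
    refine Finset.sum_congr rfl fun e _ => ?_
    by_cases h : e = d
    · subst h; simp [h0]
    · rw [smul_smul, smul_smul, ← neg_smul, rho_relation hq x y hbd h]
  by_cases hab : a = b
  · subst hab
    by_cases hac : a = c
    · subst hac
      have : act₁₃ q x (q⁻¹ ^ 2 * y) (act₁₂ q x y V) a a a = 0 := by
        rw [act_diag x y hV h0]
        refine Finset.sum_eq_zero fun e _ => ?_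
        by_cases h : e = a
        · subst h; simp [h0]
        · rw [rho_relation_self hq x y h, zero_smul]
      rw [this]; simp
    · exact key a c hac
  · by_cases hac : a = c
    · subst hac
      rw [key a b hab, smul_neg, neg_neg, smul_smul, pq_mul_pq hq, one_smul]
    · simp only [act₁₃, act₁₂, if_neg hab, if_neg hac]
      rw [hV a b c, smul_neg, smul_neg, smul_comm (x - y) (pq q c b),
        smul_comm (x - q⁻¹ ^ 2 * y) (pq q c b)]

theorem asymAt_rtMat_mul [NeZero (2 : K)] (hq : q ≠ 0) (x y : K) {o i j : Fin r}
    (hoi : o ≠ i) (hoj : o ≠ j) (hij : i ≠ j) {f : (Fin r → Fin N) → A} (hf : AsymAt q i j f) :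
    AsymAt q i j (f ᵥ* (twoSite (base A (rtMat N q x y)) o i *
      twoSite (base A (rtMat N q x (q⁻¹ ^ 2 * y))) o j)) := by
  intro b
  -- `U c d e` runs over the sequences that agree with `b` outside the places `o, i, j`; the two
  -- operators and the swap stay among them, which reduces the claim to `act_asym`.
  set U : Fin N → Fin N → Fin N → (Fin r → Fin N) :=
    fun c d e => update (update (update b o c) i d) j e with hU
  have uo : ∀ c d e, U c d e o = c := fun c d e => by simp [hU, hoi, hoj]
  have ui : ∀ c d e, U c d e i = d := fun c d e => by simp [hU, hij]
  have uj : ∀ c d e, U c d e j = e := fun c d e => by simp [hU]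
  have uk : ∀ c d e m, m ≠ o → m ≠ i → m ≠ j → U c d e m = b m :=
    fun c d e m h1 h2 h3 => by simp [hU, h1, h2, h3]
  have hext : ∀ (g : Fin r → Fin N) c d e, g o = c → g i = d → g j = e →
      (∀ m, m ≠ o → m ≠ i → m ≠ j → g m = b m) → g = U c d e := by
    intro g c d e h1 h2 h3 h4
    ext m
    by_cases m1 : m = o
    · rw [m1, h1, uo]
    by_cases m2 : m = i
    · rw [m2, h2, ui]
    by_cases m3 : m = j
    · rw [m3, h3, uj]
    rw [h4 m m1 m2 m3, uk _ _ _ m m1 m2 m3]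
  have hsw : ∀ c d e, U c d e ∘ Equiv.swap i j = U c e d := by
    intro c d e
    refine hext _ _ _ _ ?_ ?_ ?_ fun m h1 h2 h3 => ?_
    · simp [Equiv.swap_apply_of_ne_of_ne hoi hoj, uo]
    · simp [uj]
    · simp [ui]
    · simp [Equiv.swap_apply_of_ne_of_ne h2 h3, uk _ _ _ m h1 h2 h3]
  have h12 : ∀ (g : (Fin r → Fin N) → A) y c d e,
      (g ᵥ* twoSite (base A (rtMat N q x y)) o i) (U c d e) =
        act₁₂ q x y (fun c d e => g (U c d e)) c d e := by
    intro g y c d e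
    rw [vecMul_rtMat q x y hoi, uo, ui, act₁₂]
    refine if_congr Iff.rfl (Finset.sum_congr rfl fun t _ => ?_) rfl
    congr 2
    refine hext _ _ _ _ (by simp [hoi]) (by simp) (by simp [hij.symm, hoj.symm, uj])
      fun m h1 h2 h3 => by simp [h1, h2, uk _ _ _ m h1 h2 h3]
  have h13 : ∀ (g : (Fin r → Fin N) → A) y c d e,
      (g ᵥ* twoSite (base A (rtMat N q x y)) o j) (U c d e) =
        act₁₃ q x y (fun c d e => g (U c d e)) c d e := by
    intro g y c d e
    rw [vecMul_rtMat q x y hoj, uo, uj, act₁₃]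
    refine if_congr Iff.rfl (Finset.sum_congr rfl fun t _ => ?_) rfl
    congr 2
    refine hext _ _ _ _ (by simp [hoj]) (by simp [hij, hoi.symm, ui]) (by simp)
      fun m h1 h2 h3 => by simp [h1, h3, uk _ _ _ m h1 h2 h3]
  have hb : b = U (b o) (b i) (b j) := hext _ _ _ _ rfl rfl rfl fun _ _ _ _ => rfl
  have hg : ∀ c d e, (f ᵥ* (twoSite (base A (rtMat N q x y)) o i *
      twoSite (base A (rtMat N q x (q⁻¹ ^ 2 * y))) o j)) (U c d e) =
      act₁₃ q x (q⁻¹ ^ 2 * y) (act₁₂ q x y fun c d e => f (U c d e)) c d e := by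
    intro c d e
    rw [← vecMul_vecMul, h13]
    simp only [h12]
  have hsb : b ∘ Equiv.swap i j = U (b o) (b j) (b i) := by
    conv_lhs => rw [hb]
    exact hsw _ _ _
  rw [hsb]
  conv_lhs => rw [hb]
  rw [hg, hg]
  refine act_asym hq x y (fun c d e => ?_) (fun c d => hf.eq_zero (by rw [ui, uj])) _ _ _
  have := hf (U c d e)
  rwa [hsw, ui, uj] at this

theorem finRange_split (k : AdjIdx r) : ∃ L L' : List (Fin r),
    List.finRange r = L ++ k.left :: k.right :: L' ∧
      (∀ l ∈ L, l ≠ k.left ∧ l ≠ k.right) ∧ ∀ l ∈ L', l ≠ k.left ∧ l ≠ k.right := by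
  have hk := k.2
  have h : List.finRange r = (List.finRange r).take k.1 ++ k.left :: k.right ::
      (List.finRange r).drop (k.1 + 2) := by
    conv_lhs => rw [← List.take_append_drop k.1 (List.finRange r)]
    rw [List.drop_eq_getElem_cons (by simp; omega), List.drop_eq_getElem_cons (by simp; omega)]
    simp [AdjIdx.left, AdjIdx.right]
  refine ⟨_, _, h, ?_⟩
  have hn := List.nodup_finRange r
  rw [h] at hn
  simp only [List.nodup_append, List.nodup_cons, List.mem_cons] at hn
  constructor
  · intro l hl
    exact ⟨hn.2.2 l hl _ (Or.inl rfl), hn.2.2 l hl _ (Or.inr (Or.inl rfl))⟩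
  · intro l hl
    exact ⟨fun e => hn.2.1.1 (Or.inr (e ▸ hl)), fun e => hn.2.1.2.1 (e ▸ hl)⟩

theorem asymAt_list_prod {m : ℕ} {i j : Fin m} (hij : i ≠ j)
    (L : List (Matrix (Fin m → Fin N) (Fin m → Fin N) A))
    (hL : ∀ B ∈ L, Commute B (twoSite (base A (permMat N q)) i j))
    {f : (Fin m → Fin N) → A} (hf : AsymAt q i j f) : AsymAt q i j (f ᵥ* L.prod) := by
  induction L generalizing f with
  | nil => simpa using hf
  | cons B L ih =>
    rw [List.prod_cons, ← vecMul_vecMul]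
    exact ih (fun C hC => hL C (by simp [hC])) (asymAt_mul_of_commute hij (hL B (by simp)) hf)

theorem asymAt_finRange_prod {m : ℕ} {i j : Fin m} (hij : i ≠ j) (k : AdjIdx r)
    (B : Fin r → Matrix (Fin m → Fin N) (Fin m → Fin N) A)
    (hc : ∀ l, l ≠ k.left → l ≠ k.right → Commute (B l) (twoSite (base A (permMat N q)) i j))
    (hp : ∀ f : (Fin m → Fin N) → A, AsymAt q i j f → AsymAt q i j (f ᵥ* (B k.left * B k.right)))
    {f : (Fin m → Fin N) → A} (hf : AsymAt q i j f) :
    AsymAt q i j (f ᵥ* ((List.finRange r).map B).prod) := by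
  obtain ⟨L, L', h, hL, hL'⟩ := finRange_split k
  rw [h]
  simp only [List.map_append, List.map_cons, List.prod_append, List.prod_cons]
  rw [← mul_assoc (B k.left), ← vecMul_vecMul, ← vecMul_vecMul]
  refine asymAt_list_prod hij _ ?_ (hp _ (asymAt_list_prod hij _ ?_ hf))
  · intro C hC
    obtain ⟨l, hl, rfl⟩ := List.mem_map.1 hC
    exact hc l (hL' l hl).1 (hL' l hl).2
  · intro C hC
    obtain ⟨l, hl, rfl⟩ := List.mem_map.1 hC
    exact hc l (hL l hl).1 (hL l hl).2

end YangBaxter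

/-! ### Solutions of the `RTT` relations at the points `u_k = q^{-2k} u` -/

/-- Matrices `X_k = T(u_k)` and `Y_k = T̄(u_k⁻¹)ᵗ` subject to the relations of the quantum affine
algebra, with the spectral parameters `x_k = u_k⁻¹` and `y_k = u_k`. -/
structure RTTData (N : ℕ) {K : Type*} [Field K] (q : K) (A : Type*) [Ring A] [Algebra K A] where
  x : ℕ → K
  y : ℕ → K
  X : ℕ → Matrix (Fin N) (Fin N) A
  Y : ℕ → Matrix (Fin N) (Fin N) A
  y_succ : ∀ k, y (k + 1) = q⁻¹ ^ 2 * y k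
  ne_zero : ∀ k, q⁻¹ * x k - q * y k ≠ 0
  rXX : ∀ k, (1 - base A (permMat N q)) * (X k ⊗ₖ 1) * (1 ⊗ₖ X (k + 1)) =
    (1 ⊗ₖ X (k + 1)) * (X k ⊗ₖ 1) * (1 - base A (permMat N q))
  rYY : ∀ k, (1 - base A (permMat N q)) * (Y k ⊗ₖ 1) * (1 ⊗ₖ Y (k + 1)) =
    (1 ⊗ₖ Y (k + 1)) * (Y k ⊗ₖ 1) * (1 - base A (permMat N q))
  rYX : ∀ k l, (Y k ⊗ₖ 1) * base A (rtMat N q (x k) (y l)) * (1 ⊗ₖ X l) =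
    (1 ⊗ₖ X l) * base A (rtMat N q (x k) (y l)) * (Y k ⊗ₖ 1)
  cancelX : ∀ k (g : Fin N → A), g ᵥ* X k = 0 → g = 0
  cancelY : ∀ k (g : Fin N → A), g ᵥ* Y k = 0 → g = 0

/-! ### The relation between $S(u)$ and $\overline S(u^{-1})^t$ at one spectral parameter. -/

namespace RTTData

variable {N : ℕ} {K A : Type*} [Field K] [Ring A] [Algebra K A] {q : K} (d : RTTData N q A)

/-- The matrix `S(u_k)`. -/
def S (k : ℕ) : Matrix (Fin N) (Fin N) A := d.X k * d.Y k

/-- The matrix `S̄(u_k⁻¹)ᵗ`. -/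
def Sb (k : ℕ) : Matrix (Fin N) (Fin N) A := Matrix.of fun i j => ∑ m, d.Y k m j * d.X k i m

theorem cancelS (k : ℕ) (g : Fin N → A) (h : g ᵥ* d.S k = 0) : g = 0 := by
  rw [S, ← vecMul_vecMul] at h
  exact d.cancelX k g (d.cancelY k _ h)

theorem rYX_apply (k l : ℕ) (i j a b : Fin N) :
    (∑ m, ∑ n, d.Y k a m * base A (rtMat N q (d.x k) (d.y l)) (m, j) (i, n) * d.X l n b) =
      ∑ n, ∑ m, d.X l j n * base A (rtMat N q (d.x k) (d.y l)) (a, n) (m, b) * d.Y k m i := by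
  have h := congrFun (congrFun (d.rYX k l) (a, j)) (i, b)
  simp only [Matrix.mul_apply, Fintype.sum_prod_type, kroneckerMap_apply, Matrix.one_apply,
    mul_ite, ite_mul, one_mul, mul_one, zero_mul, mul_zero, Finset.sum_ite_eq, Finset.mem_univ,
    if_true, Finset.sum_ite_eq'] at h
  rw [Finset.sum_comm, Finset.sum_comm (γ := Fin N) (f := fun n m => d.X l j n * _ * _)]
  simpa [Finset.sum_mul] using h

/-- In the mixed relation at `k = l` put `a = b = t` and sum over `t`. On the right only the
diagonal entries of $R^t$ on the vectors $e_t\otimes e_t$ survive and produce `S`; on the left the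
sum contracts `Y` with `X` to entries of `Sb`. -/
theorem smul_Sb (k : ℕ) (i j : Fin N) :
    (if i = j then 0 else (d.x k - d.y k) • d.Sb k j i) + rho q (d.x k) (d.y k) j i • d.Sb k i j =
      (q⁻¹ * d.x k - q * d.y k) • d.S k j i := by
  have h : ∑ t, ∑ m, ∑ n, d.Y k t m * base A (rtMat N q (d.x k) (d.y k)) (m, j) (i, n) * d.X k n t
      = ∑ t, ∑ n, ∑ m, d.X k j n * base A (rtMat N q (d.x k) (d.y k)) (t, n) (m, t) * d.Y k m i :=
    Finset.sum_congr rfl fun t _ => d.rYX_apply k k i j t t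
  have hl : ∀ t, ∑ m, ∑ n,
      d.Y k t m * base A (rtMat N q (d.x k) (d.y k)) (m, j) (i, n) * d.X k n t =
      (if i = j then 0 else (d.x k - d.y k) • (d.Y k t i * d.X k j t)) +
        rho q (d.x k) (d.y k) j i • (d.Y k t j * d.X k i t) := by
    intro t
    have e : ∀ m n, d.Y k t m * base A (rtMat N q (d.x k) (d.y k)) (m, j) (i, n) * d.X k n t =
        (if n = i then if m = j then rho q (d.x k) (d.y k) j i • (d.Y k t j * d.X k i t) else 0
          else 0) + (if m = i then if n = j then if i = j then 0 else
            (d.x k - d.y k) • (d.Y k t i * d.X k j t) else 0 else 0) := by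
      intro m n
      simp only [rtMat, map_apply, of_apply, Prod.mk.injEq]
      by_cases h1 : n = i
      · subst h1
        by_cases h2 : m = j
        · subst h2
          by_cases h3 : m = n
          · simp [h3, Algebra.smul_def, Algebra.commutes, mul_assoc]
          · simp [h3, Algebra.smul_def, Algebra.commutes, mul_assoc]
        · by_cases h3 : n = j
          · simp [h2, h3]
          · simp [h2, h3]
      · have h1' : i ≠ n := fun h => h1 h.symm
        by_cases h2 : m = i
        · subst h2
          by_cases h3 : n = j
          · subst h3
            simp only [h1, h1', if_false, if_true, Algebra.smul_def, zero_add, and_self]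
            rw [mul_assoc, Algebra.left_comm]
          · simp [h1, h1', h3, Ne.symm h3]
        · simp [h1, h1', h2]
    simp only [e, Finset.sum_add_distrib, Finset.sum_ite_eq', Finset.mem_univ, if_true]
    rw [add_comm]
    congr 1
    rw [Finset.sum_comm]
    simp
  have hr : ∀ t, ∑ n, ∑ m,
      d.X k j n * base A (rtMat N q (d.x k) (d.y k)) (t, n) (m, t) * d.Y k m i =
      (q⁻¹ * d.x k - q * d.y k) • (d.X k j t * d.Y k t i) := by
    intro t
    have e : ∀ n m, d.X k j n * base A (rtMat N q (d.x k) (d.y k)) (t, n) (m, t) * d.Y k m i =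
        if n = t then if m = t then (q⁻¹ * d.x k - q * d.y k) • (d.X k j t * d.Y k t i) else 0
          else 0 := by
      intro n m
      simp only [rtMat, map_apply, of_apply, Prod.mk.injEq]
      by_cases h1 : m = t
      · subst h1
        by_cases h2 : n = m
        · subst h2
          simp only [if_true, rho, lt_irrefl, if_false, Algebra.smul_def]
          rw [mul_assoc, Algebra.left_comm]
        · simp [h2, Ne.symm h2]
      · have : ¬(t = m ∧ n = t) := fun h => h1 h.1.symm
        simp [h1, this]
    simp only [e]
    rw [Finset.sum_comm]
    simp
  simp only [hl, hr, Finset.sum_add_distrib, ← Finset.smul_sum] at h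
  rw [S, Matrix.mul_apply, ← h, Sb]
  congr 1
  by_cases hij : i = j <;> simp [hij, Finset.smul_sum]

theorem Sb_diag (k : ℕ) (i : Fin N) : d.Sb k i i = d.S k i i := by
  have h := d.smul_Sb k i i
  simp only [if_true, zero_add, rho, lt_irrefl, if_false] at h
  have h3 := congrArg (fun z => (q⁻¹ * d.x k - q * d.y k)⁻¹ • z) h
  simpa [smul_smul, d.ne_zero k] using h3

/-- The equations `smul_Sb` for `(b, e)` and `(e, b)` form a 2×2 system for `Sb k e b` and `Sb k b
e`. Its determinant factors as $(q^{-1}x-qy)(qx-q^{-1}y)$, and the first factor, which multiplies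
`S` in both equations, cancels. -/
theorem S_sub_S (hq : q ≠ 0) (k : ℕ) {e b : Fin N} (heb : e ≠ b) :
    (d.x k - d.y k) • d.S k e b - rho q (d.x k) (d.y k) e b • d.S k b e =
      (q * d.x k - q⁻¹ * d.y k) • d.Sb k e b := by
  have h1 := d.smul_Sb k b e
  have h2 := d.smul_Sb k e b
  rw [if_neg heb.symm] at h1
  rw [if_neg heb] at h2
  have hr : rho q (d.x k) (d.y k) e b * rho q (d.x k) (d.y k) b e =
      (q⁻¹ - q) * d.x k * ((q⁻¹ - q) * d.y k) := by
    rcases lt_or_gt_of_ne heb with h | h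
    · simp [rho, h, h.not_gt]
    · simp only [rho, h, h.not_gt, if_true, if_false]; ring
  have h3 : (q⁻¹ * d.x k - q * d.y k) •
      ((d.x k - d.y k) • d.S k e b - rho q (d.x k) (d.y k) e b • d.S k b e) =
      (q⁻¹ * d.x k - q * d.y k) • ((q * d.x k - q⁻¹ * d.y k) • d.Sb k e b) := by
    rw [smul_sub, smul_comm _ (d.x k - d.y k), smul_comm _ (rho _ _ _ _ _), ← h1, ← h2]
    have e3 : (q⁻¹ * d.x k - q * d.y k) * (q * d.x k - q⁻¹ * d.y k) =
        (d.x k - d.y k) * (d.x k - d.y k) -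
          rho q (d.x k) (d.y k) e b * rho q (d.x k) (d.y k) b e := by
      rw [hr]; field_simp; ring
    rw [smul_smul, e3]
    module
  exact (IsUnit.mk0 _ (d.ne_zero k)).smul_left_cancel.1 h3

/-- `S_sub_S` times $q^{-1}$, rewritten through $y_{k+1}=q^{-2}y_k$: the coefficients become those
of $R^t_{12}(x_k,y_{k+1})$, the operator that follows $S_1$ in the Sklyanin product. -/
theorem smul_S_sub (hq : q ≠ 0) (k : ℕ) {e b : Fin N} (heb : e ≠ b) :
    rho q (d.x k) (d.y (k + 1)) b b • d.S k e b -
        (pq q e b * rho q (d.x k) (d.y (k + 1)) e b) • d.S k b e =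
      (d.x k - d.y (k + 1)) • d.Sb k e b := by
  have h := congrArg (fun z => q⁻¹ • z) (d.S_sub_S hq k heb)
  simp only [smul_sub, smul_smul] at h
  have e1 : rho q (d.x k) (d.y (k + 1)) b b = q⁻¹ * (d.x k - d.y k) := by
    rw [d.y_succ]; simp only [rho, lt_irrefl, if_false]; field_simp
  have e2 : pq q e b * rho q (d.x k) (d.y (k + 1)) e b = q⁻¹ * rho q (d.x k) (d.y k) e b := by
    rw [d.y_succ]
    rcases lt_or_gt_of_ne heb with h | h
    · simp [rho, pq, h, h.not_gt]
    · simp only [rho, pq, h, h.not_gt, if_true, if_false]; field_simp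
  have e3 : d.x k - d.y (k + 1) = q⁻¹ * (q * d.x k - q⁻¹ * d.y k) := by
    rw [d.y_succ]; field_simp
  rw [e1, e2, e3, h]

end RTTData

/-! ### The ordered products -/

/-- The factor `y` crosses the pairs `a i`, `x i` one index at a time; the commutation of `x i` with
the other `a j` brings each pair together. -/
theorem mul_prod_mul_prod {M ι : Type*} [Monoid M] (y : M) (a x : ι → M) (L : List ι)
    (hL : L.Nodup) (hc : ∀ i j, i ≠ j → Commute (x i) (a j))
    (h : ∀ i, y * a i * x i = x i * a i * y) :
    y * (L.map a).prod * (L.map x).prod = (L.map x).prod * (L.map a).prod * y := by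
  induction L with
  | nil => simp
  | cons i L ih =>
    have hi := List.nodup_cons.1 hL
    have c1 : Commute (x i) (L.map a).prod := by
      refine Commute.list_prod_right _ _ fun z hz => ?_
      obtain ⟨j, hj, rfl⟩ := List.mem_map.1 hz
      exact hc i j fun e => hi.1 (e ▸ hj)
    have c2 : Commute (a i) (L.map x).prod := by
      refine Commute.list_prod_right _ _ fun z hz => ?_
      obtain ⟨j, hj, rfl⟩ := List.mem_map.1 hz
      exact (hc j i fun e => hi.1 (e ▸ hj)).symm
    have ih := ih hi.2
    simp only [List.map_cons, List.prod_cons]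
    calc y * (a i * (L.map a).prod) * (x i * (L.map x).prod)
        = y * a i * ((L.map a).prod * x i) * (L.map x).prod := by simp only [mul_assoc]
      _ = y * a i * x i * ((L.map a).prod * (L.map x).prod) := by
          rw [← c1.eq]; simp only [mul_assoc]
      _ = x i * a i * (y * (L.map a).prod * (L.map x).prod) := by
          rw [h]; simp only [mul_assoc]
      _ = x i * (a i * (L.map x).prod) * (L.map a).prod * y := by
          rw [ih]; simp only [mul_assoc]
      _ = x i * (L.map x).prod * (a i * (L.map a).prod) * y := by
          rw [c2.eq]; simp only [mul_assoc]

/-- All entries of the matrix are central. -/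
def CentralEntries {ι κ A : Type*} [Ring A] (M : Matrix ι κ A) : Prop :=
  ∀ (a : A) i j, Commute a (M i j)

theorem CentralEntries.mul {ι A : Type*} [Fintype ι] [Ring A] {M M' : Matrix ι ι A}
    (h : CentralEntries M) (h' : CentralEntries M') : CentralEntries (M * M') := by
  intro a i j
  rw [Matrix.mul_apply]
  exact Commute.sum_right _ _ _ fun k _ => (h a _ _).mul_right (h' a _ _)

theorem CentralEntries.one {ι A : Type*} [DecidableEq ι] [Ring A] :
    CentralEntries (1 : Matrix ι ι A) := by
  intro a i j
  rw [Matrix.one_apply]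
  split_ifs
  exacts [Commute.one_right _, Commute.zero_right _]

theorem CentralEntries.list_prod {ι A : Type*} [Fintype ι] [DecidableEq ι] [Ring A]
    {L : List (Matrix ι ι A)} (h : ∀ M ∈ L, CentralEntries M) : CentralEntries L.prod := by
  induction L with
  | nil => exact CentralEntries.one
  | cons M L ih =>
    rw [List.prod_cons]
    exact (h M (by simp)).mul (ih fun M' hM' => h M' (by simp [hM']))

section

variable {N r : ℕ} {A : Type*} [Ring A]

theorem CentralEntries.liftCons {M : Matrix (Fin r → Fin N) (Fin r → Fin N) A}
    (h : CentralEntries M) : CentralEntries (liftCons M) := by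
  intro a i j
  simp only [TwistedQYangian.liftCons, of_apply]
  split_ifs
  exacts [h _ _ _, Commute.zero_right _]

theorem CentralEntries.twoSite {M : Matrix (Fin N × Fin N) (Fin N × Fin N) A}
    (h : CentralEntries M) (k l : Fin r) : CentralEntries (twoSite M k l) := by
  intro a i j
  simp only [TwistedQYangian.twoSite, of_apply]
  split_ifs
  exacts [h _ _ _, Commute.zero_right _]

/-- The product `Z_1(s) Z_2(s+1) ⋯ Z_r(s+r-1)`. -/
def prodSites (Z : ℕ → Matrix (Fin N) (Fin N) A) (r s : ℕ) :
    Matrix (Fin r → Fin N) (Fin r → Fin N) A :=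
  ((List.finRange r).map fun k : Fin r => oneSite (Z (s + k)) k).prod

theorem liftCons_prodSites (Z : ℕ → Matrix (Fin N) (Fin N) A) (r s : ℕ) :
    liftCons (prodSites Z r (s + 1)) =
      ((List.finRange r).map fun k : Fin r => oneSite (Z (s + 1 + k)) k.succ).prod := by
  rw [prodSites, liftCons_prod, List.map_map]
  congr 1
  refine List.map_congr_left fun k _ => ?_
  rw [Function.comp_apply, liftCons_oneSite]

theorem prodSites_succ (Z : ℕ → Matrix (Fin N) (Fin N) A) (r s : ℕ) :
    prodSites Z (r + 1) s = oneSite (Z s) 0 * liftCons (prodSites Z r (s + 1)) := by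
  rw [liftCons_prodSites, prodSites, List.finRange_succ, List.map_cons, List.prod_cons,
    List.map_map]
  congr 2
  refine List.map_congr_left fun k _ => ?_
  simp [add_comm, add_left_comm]

end

/-! ### The Sklyanin product and its action on antisymmetric row vectors. -/

namespace RTTData

variable {N : ℕ} {K A : Type*} [Field K] [Ring A] [Algebra K A] {q : K} (d : RTTData N q A)

/-- The product `R^t_{12} ⋯ R^t_{1,r+1}`. -/
def head (r s : ℕ) : Matrix (Fin (r + 1) → Fin N) (Fin (r + 1) → Fin N) A :=
  ((List.finRange r).map fun l : Fin r =>
    twoSite (base A (rtMat N q (d.x s) (d.y (s + 1 + l)))) 0 l.succ).prod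

/-- The product `S_1 R^t_{12} ⋯ R^t_{1r} S_2 R^t_{23} ⋯ R^t_{r-1,r} S_r`. -/
def skl : (r s : ℕ) → Matrix (Fin r → Fin N) (Fin r → Fin N) A
  | 0, _ => 1
  | r + 1, s => oneSite (d.S s) 0 * d.head r s * liftCons (skl r (s + 1))

/-- The product `(R^t_{12} ⋯ R^t_{1r}) (R^t_{23} ⋯ R^t_{2r}) ⋯ R^t_{r-1,r}`. -/
def allR : (r s : ℕ) → Matrix (Fin r → Fin N) (Fin r → Fin N) A
  | 0, _ => 1
  | r + 1, s => d.head r s * liftCons (allR r (s + 1))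

/-- The product `S_1 R^t_{12} ⋯ R^t_{1r} S_2 R^t_{23} ⋯ R^t_{r-1,r}` without the last factor. -/
def sklInit : (r s : ℕ) → Matrix (Fin (r + 1) → Fin N) (Fin (r + 1) → Fin N) A
  | 0, _ => 1
  | r + 1, s => oneSite (d.S s) 0 * d.head (r + 1) s * liftCons (sklInit r (s + 1))

theorem centralEntries_head (r s : ℕ) : CentralEntries (d.head r s) := by
  refine CentralEntries.list_prod fun M hM => ?_
  obtain ⟨l, -, rfl⟩ := List.mem_map.1 hM
  exact CentralEntries.twoSite (fun a i j => base_commute _ _ _ _) _ _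

theorem centralEntries_allR (r s : ℕ) : CentralEntries (d.allR r s) := by
  induction r generalizing s with
  | zero => exact CentralEntries.one
  | succ r ih => exact (d.centralEntries_head r s).mul (ih (s + 1)).liftCons

theorem head_exchange (r s : ℕ) :
    oneSite (d.Y s) 0 * d.head r s * liftCons (prodSites d.X r (s + 1)) =
      liftCons (prodSites d.X r (s + 1)) * d.head r s * oneSite (d.Y s) 0 := by
  rw [liftCons_prodSites, head]
  refine mul_prod_mul_prod _ _ _ _ (List.nodup_finRange r) (fun i j hij => ?_) fun i => ?_
  · exact oneSite_commute_twoSite (Fin.succ_ne_zero j).symm (Fin.succ_ne_zero i)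
      (by simpa using hij) fun a b c e => base_commute _ _ _ _
  · have h0 : (0 : Fin (r + 1)) ≠ i.succ := (Fin.succ_ne_zero i).symm
    rw [← twoSite_kronecker_one (d.Y s) h0, ← twoSite_one_kronecker (d.X _) h0,
      ← twoSite_mul _ _ h0, ← twoSite_mul _ _ h0, ← twoSite_mul _ _ h0, ← twoSite_mul _ _ h0,
      d.rYX]

/-- Each `Y` moves to the right: past the `X` of the later sites together with the $R^t$ issuing
from its own site by `head_exchange`, and then past the remaining $R^t$, which do not act in its
site. -/
theorem skl_eq (r s : ℕ) :
    d.skl r s = prodSites d.X r s * d.allR r s * prodSites d.Y r s := by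
  induction r generalizing s with
  | zero => simp [skl, allR, prodSites]
  | succ r ih =>
    have hc : Commute (oneSite (d.Y s) 0) (liftCons (d.allR r (s + 1))) :=
      liftCons_commute_oneSite fun a b c e => d.centralEntries_allR r (s + 1) _ _ _
    rw [skl, ih, allR, prodSites_succ, prodSites_succ, liftCons_mul, liftCons_mul, S, oneSite_mul]
    calc _ = oneSite (d.X s) 0 *
          (oneSite (d.Y s) 0 * d.head r s * liftCons (prodSites d.X r (s + 1))) *
          liftCons (d.allR r (s + 1)) * liftCons (prodSites d.Y r (s + 1)) := by
          simp only [mul_assoc]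
      _ = oneSite (d.X s) 0 * liftCons (prodSites d.X r (s + 1)) * d.head r s *
          (oneSite (d.Y s) 0 * liftCons (d.allR r (s + 1))) *
          liftCons (prodSites d.Y r (s + 1)) := by
          rw [head_exchange]; simp only [mul_assoc]
      _ = _ := by rw [hc.eq]; simp only [mul_assoc]

theorem asym_smul {r : ℕ} {f : (Fin r → Fin N) → A} (hf : Asym q f) (γ : K) :
    Asym q (γ • f) := by
  intro k b
  rw [Pi.smul_apply, Pi.smul_apply, hf k b, smul_neg, smul_comm]

theorem skl_succ (r s : ℕ) :
    d.skl (r + 1) s = d.sklInit r s * oneSite (d.S (s + r)) (Fin.last r) := by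
  induction r generalizing s with
  | zero => simp [skl, sklInit, head, liftCons_one]
  | succ r ih =>
    rw [skl, ih, sklInit, liftCons_mul, liftCons_oneSite, Fin.succ_last, mul_assoc, mul_assoc,
      mul_assoc, add_right_comm s 1 r]
    rfl

variable [NeZero (2 : K)]

/-- Only the two factors at the adjacent sites `k`, `k + 1` fail to commute with $P^q$ there, and
`hZ` moves $1-P^q$ through them, as `asymAt_mul` requires. -/
theorem asym_prodSites (hq : q ≠ 0) {Z : ℕ → Matrix (Fin N) (Fin N) A}
    (hZ : ∀ k, (1 - base A (permMat N q)) * (Z k ⊗ₖ 1) * (1 ⊗ₖ Z (k + 1)) =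
      (1 ⊗ₖ Z (k + 1)) * (Z k ⊗ₖ 1) * (1 - base A (permMat N q)))
    {r : ℕ} (s : ℕ) {f : (Fin r → Fin N) → A} (hf : Asym q f) :
    Asym q (f ᵥ* prodSites Z r s) := by
  intro k
  have hk := k.left_ne_right
  refine asymAt_finRange_prod hk k _ (fun l h1 h2 => ?_) (fun g hg => ?_) (hf k)
  · exact oneSite_commute_twoSite hk h1 h2 fun a b c e => base_commute _ _ _ _
  · have e : oneSite (Z (s + k.left)) k.left * oneSite (Z (s + k.right)) k.right =
        twoSite ((Z (s + k.1) ⊗ₖ 1) * (1 ⊗ₖ Z (s + k.1 + 1))) k.left k.right := by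
      rw [twoSite_mul _ _ hk, twoSite_kronecker_one _ hk, twoSite_one_kronecker _ hk]
      rfl
    rw [e]
    refine asymAt_mul hk hq (C := twoSite ((1 ⊗ₖ Z (s + k.1 + 1)) * (Z (s + k.1) ⊗ₖ 1))
      k.left k.right) ?_ hg
    have e1 : (1 : Matrix (Fin r → Fin N) (Fin r → Fin N) A) -
        twoSite (base A (permMat N q)) k.left k.right =
        twoSite (1 - base A (permMat N q)) k.left k.right := by
      rw [← twoSite_one hk]
      ext a b
      simp only [twoSite, of_apply, Matrix.sub_apply]
      split_ifs <;> simp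
    rw [e1, ← twoSite_mul _ _ hk, ← twoSite_mul _ _ hk, ← mul_assoc, hZ]

theorem vecMul_head_of_asym (hq : q ≠ 0) (r s : ℕ) {f : (Fin (r + 1) → Fin N) → A}
    (hf : Asym q f) : f ᵥ* d.head r s = (∏ l : Fin r, (d.x s - d.y (s + 1 + l))) • f := by
  rw [head, ← List.prod_ofFn, List.ofFn_eq_map]
  induction List.finRange r with
  | nil => simp
  | cons l L ih =>
    simp only [List.map_cons, List.prod_cons]
    rw [← vecMul_vecMul, vecMul_rtMat_of_asym hq _ _ (Fin.succ_ne_zero l).symm hf, smul_vecMul, ih,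
      smul_smul]

theorem exists_vecMul_allR (hq : q ≠ 0) (r s : ℕ) : ∃ γ : K, ∀ f : (Fin r → Fin N) → A,
    Asym q f → f ᵥ* d.allR r s = γ • f := by
  induction r generalizing s with
  | zero => exact ⟨1, fun f _ => by simp [allR]⟩
  | succ r ih =>
    obtain ⟨γ, hγ⟩ := ih (s + 1)
    refine ⟨(∏ l : Fin r, (d.x s - d.y (s + 1 + l))) * γ, fun f hf => ?_⟩
    rw [allR, ← vecMul_vecMul, d.vecMul_head_of_asym hq r s hf, smul_vecMul, mul_smul]
    congr 1
    ext b
    rw [← Fin.cons_self_tail b, vecMul_liftCons, hγ _ (hf.cons _)]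
    rfl

theorem asym_vecMul_skl (hq : q ≠ 0) (r s : ℕ) {f : (Fin r → Fin N) → A} (hf : Asym q f) :
    Asym q (f ᵥ* d.skl r s) := by
  obtain ⟨γ, hγ⟩ := d.exists_vecMul_allR hq r s
  rw [skl_eq, ← vecMul_vecMul, ← vecMul_vecMul, hγ _ (asym_prodSites hq d.rXX s hf)]
  exact asym_prodSites hq d.rYY s (asym_smul (asym_prodSites hq d.rXX s hf) γ)

/-- `R^t_{12} ⋯ R^t_{1,r+1}` preserves antisymmetry in the tensor factors `2, …, r + 1`. -/
theorem asym_vecMul_head (hq : q ≠ 0) (r s : ℕ) {f : (Fin (r + 1) → Fin N) → A}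
    (hf : ∀ c, Asym q fun a => f (Fin.cons c a)) (c : Fin N) :
    Asym q fun a => (f ᵥ* d.head r s) (Fin.cons c a) := by
  intro k
  have hsw : ∀ (c : Fin N) (b : Fin r → Fin N),
      (Fin.cons c b : Fin (r + 1) → Fin N) ∘ Equiv.swap k.left.succ k.right.succ =
      Fin.cons c (b ∘ Equiv.swap k.left k.right) := by
    intro c b
    ext m
    refine Fin.cases ?_ (fun m => ?_) m
    · simp [Equiv.swap_apply_of_ne_of_ne, (Fin.succ_ne_zero _).symm]
    · simp only [Function.comp_apply, Equiv.swap_apply_def, Fin.succ_inj, Fin.cons_succ]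
      split_ifs <;> simp
  have hk : k.left.succ ≠ k.right.succ := by simpa using k.left_ne_right
  have h1 : AsymAt q k.left.succ k.right.succ f := by
    intro b
    rw [← Fin.cons_self_tail b, hsw]
    simpa using hf (b 0) k (Fin.tail b)
  have h2 : AsymAt q k.left.succ k.right.succ (f ᵥ* d.head r s) := by
    refine asymAt_finRange_prod hk k _ (fun l h1 h2 => ?_) (fun g hg => ?_) h1
    · exact twoSite_commute_twoSite (Fin.succ_ne_zero _).symm hk (Fin.succ_ne_zero _).symm
        (Fin.succ_ne_zero _).symm (by simpa using h1) (by simpa using h2)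
        fun a b c e => base_commute _ _ _ _
    · have e : d.y (s + 1 + k.right) = q⁻¹ ^ 2 * d.y (s + 1 + k.left) := d.y_succ (s + 1 + k.1)
      rw [e]
      exact asymAt_rtMat_mul hq _ _ (Fin.succ_ne_zero _).symm (Fin.succ_ne_zero _).symm hk hg
  intro b
  have := h2 (Fin.cons c b)
  rw [hsw] at this
  simpa using this

/-- The full product preserves antisymmetry, and its last factor acts only in the last site. An
antisymmetry relation among the first `r` sites therefore holds after multiplication by `S (s + r)`,
and `cancelS` removes that matrix. -/
theorem asym_vecMul_sklInit (hq : q ≠ 0) (r s : ℕ) {f : (Fin (r + 1) → Fin N) → A}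
    (hf : Asym q f) (c : Fin N) : Asym q fun b => (f ᵥ* d.sklInit r s) (Fin.snoc b c) := by
  intro k b
  have h : ∀ e, ∑ c, (f ᵥ* d.sklInit r s) (Fin.snoc b c) * d.S (s + r) c e =
      -(pq q (b k.right) (b k.left) • ∑ c, (f ᵥ* d.sklInit r s)
        (Fin.snoc (b ∘ Equiv.swap k.left k.right) c) * d.S (s + r) c e) := by
    intro e
    have := (d.asym_vecMul_skl hq (r + 1) s hf).snoc e k b
    simpa only [skl_succ, ← vecMul_vecMul, vecMul_oneSite_last] using this
  have h0 := d.cancelS (s + r) (fun c => (f ᵥ* d.sklInit r s) (Fin.snoc b c) +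
    pq q (b k.right) (b k.left) • (f ᵥ* d.sklInit r s)
        (Fin.snoc (b ∘ Equiv.swap k.left k.right) c)) (by
      ext e
      simp only [vecMul, dotProduct, Pi.zero_apply, add_mul, Finset.sum_add_distrib,
        smul_mul_assoc, ← Finset.smul_sum]
      have := h e
      simp only [vecMul, dotProduct] at this
      rw [this, neg_add_cancel])
  exact eq_neg_of_add_eq_zero_left (congrFun h0 c)

end RTTData

/-! ### Evaluation of the ordered products -/

/-- The row vector `f` is supported on sequences of elements of `I`. -/
def SuppIn {N r : ℕ} {K : Type*} [Zero K] (I : Finset (Fin N)) (f : (Fin r → Fin N) → K) : Prop :=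
  ∀ b, f b ≠ 0 → ∀ i, b i ∈ I

/-- A nonzero entry sits at an injective sequence in `I` of length `I.card`, that is, at an
arrangement of all of `I`. -/
theorem SuppIn.exists_eq {N r : ℕ} {K : Type*} [Field K] [NeZero (2 : K)] {q : K} (hq : q ≠ 0)
    {I : Finset (Fin N)} {f : (Fin r → Fin N) → K} (hs : SuppIn I f) (hf : Asym q f)
    (hI : I.card = r) {b : Fin r → Fin N} (hb : f b ≠ 0) {c : Fin N} (hc : c ∈ I) :
    ∃ i, b i = c := by
  have hinj : Injective b := by
    by_contra h
    exact hb (hf.eq_zero_of_not_injective hq h)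
  have h1 : Finset.univ.image b ⊆ I := by
    intro z hz
    obtain ⟨i, -, rfl⟩ := Finset.mem_image.1 hz
    exact hs b hb i
  have h2 : Finset.univ.image b = I :=
    Finset.eq_of_subset_of_card_le h1 (by rw [Finset.card_image_of_injective _ hinj, hI]; simp)
  rw [← h2] at hc
  obtain ⟨i, -, rfl⟩ := Finset.mem_image.1 hc
  exact ⟨i, rfl⟩

/-! ### Removing the first and the last tensor factor. -/

namespace RTTData

variable {N : ℕ} {K A : Type*} [Field K] [Ring A] [Algebra K A] {q : K} (d : RTTData N q A)

theorem vecMul_list_rtMat {r : ℕ} (x : K) (y : Fin r → K) (L : List (Fin r))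
    (g : (Fin (r + 1) → Fin N) → A) {b : Fin (r + 1) → Fin N} (h : ∀ l ∈ L, b 0 ≠ b l.succ) :
    (g ᵥ* (L.map fun l => twoSite (base A (rtMat N q x (y l))) 0 l.succ).prod) b =
      (L.map fun l => x - y l).prod • g b := by
  induction L generalizing g with
  | nil => simp
  | cons l L ih =>
    simp only [List.map_cons, List.prod_cons]
    rw [← vecMul_vecMul, ih _ (fun m hm => h m (by simp [hm])),
      vecMul_rtMat _ _ _ (Fin.succ_ne_zero l).symm, if_neg (h l (by simp)), smul_smul, mul_comm]

theorem vecMul_head_of_ne (r s : ℕ) (g : (Fin (r + 1) → Fin N) → A) {c : Fin N}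
    {a : Fin r → Fin N} (h : ∀ l, c ≠ a l) :
    (g ᵥ* d.head r s) (Fin.cons c a) =
      (∏ l : Fin r, (d.x s - d.y (s + 1 + l))) • g (Fin.cons c a) := by
  rw [head, vecMul_list_rtMat _ (fun l : Fin r => d.y (s + 1 + l)) _ _ (by simpa using h),
    ← List.prod_ofFn, List.ofFn_eq_map]

/-- Only $R^t_{12}$ meets equal indices; as `c` does not occur in `a`, the other $R^t_{1l}$ are
scalars. -/
theorem vecMul_head_cons_self (r s : ℕ) (g : (Fin (r + 2) → Fin N) → A) {c : Fin N}
    {a : Fin r → Fin N} (h : ∀ l, c ≠ a l) :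
    (g ᵥ* d.head (r + 1) s) (Fin.cons c (Fin.cons c a)) =
      (∏ l : Fin r, (d.x s - d.y (s + 1 + l.succ))) •
        ∑ e, rho q (d.x s) (d.y (s + 1)) e c • g (Fin.cons e (Fin.cons e a)) := by
  have e : d.head (r + 1) s = twoSite (base A (rtMat N q (d.x s) (d.y (s + 1)))) 0 1 *
      (((List.finRange r).map Fin.succ).map fun l : Fin (r + 1) =>
        twoSite (base A (rtMat N q (d.x s) (d.y (s + 1 + l)))) 0 l.succ).prod := by
    rw [head, List.finRange_succ, List.map_cons, List.prod_cons]
    rfl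
  rw [e, ← vecMul_vecMul, vecMul_list_rtMat _ (fun l : Fin (r + 1) => d.y (s + 1 + l)) _ _
    (by
      intro l hl
      obtain ⟨m, -, rfl⟩ := List.mem_map.1 hl
      simpa using h m), vecMul_rtMat _ _ _ (by simp)]
  rw [← List.prod_ofFn, List.ofFn_eq_map, List.map_map]
  congr 1
  refine (if_pos rfl).trans ?_
  refine Finset.sum_congr rfl fun t _ => ?_
  congr 2
  rw [Fin.update_cons_zero, show (1 : Fin (r + 2)) = Fin.succ 0 from rfl, ← Fin.cons_update,
    Fin.update_cons_zero]

theorem head_succ (r s : ℕ) : d.head (r + 1) s = liftSnoc (d.head r s) *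
    twoSite (base A (rtMat N q (d.x s) (d.y (s + 1 + r)))) 0 (Fin.last (r + 1)) := by
  rw [head, List.finRange_succ_last, List.map_append, List.prod_append, head, liftSnoc_prod,
    List.map_map, List.map_map]
  congr 1
  · congr 1
    refine List.map_congr_left fun l _ => ?_
    simp only [Function.comp_apply, liftSnoc_twoSite]
    rfl
  · simp

theorem vecMul_S_head_snoc (r s : ℕ) (g : (Fin (r + 2) → Fin N) → A) {c k : Fin N} (hck : c ≠ k)
    (a : Fin r → Fin N) :
    (g ᵥ* (oneSite (d.S s) 0 * d.head (r + 1) s)) (Fin.cons c (Fin.snoc a k)) =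
      (d.x s - d.y (s + 1 + r)) •
        ((fun a => g (Fin.snoc a k)) ᵥ* (oneSite (d.S s) 0 * d.head r s)) (Fin.cons c a) := by
  rw [head_succ, ← mul_assoc, ← vecMul_vecMul, vecMul_rtMat _ _ _ (Fin.last_pos).ne,
    Fin.cons_snoc_eq_snoc_cons, Fin.snoc_last, if_neg (by
      rw [← Fin.castSucc_zero, Fin.snoc_castSucc]; simpa using hck)]
  congr 1
  have e : oneSite (d.S s) 0 = liftSnoc (oneSite (d.S s) (0 : Fin (r + 1))) := by
    rw [liftSnoc_oneSite]; rfl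
  rw [e, ← liftSnoc_mul, vecMul_liftSnoc]

/-- When the last index `k` differs from all the others, every $R^t$ that reaches the last site acts
by a scalar. The site is then inert, and the Sklyanin product of the other sites remains. -/
theorem vecMul_sklInit_of_ne (r s : ℕ) (g : (Fin (r + 1) → Fin N) → A) {k : Fin N}
    {b : Fin r → Fin N} (h : ∀ l, b l ≠ k) :
    (g ᵥ* d.sklInit r s) (Fin.snoc b k) =
      (∏ i : Fin r, (d.x (s + i) - d.y (s + r))) •
        ((fun a => g (Fin.snoc a k)) ᵥ* d.skl r s) b := by
  induction r generalizing s with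
  | zero => simp [sklInit, skl]
  | succ r ih =>
    rw [← Fin.cons_self_tail b, ← Fin.cons_snoc_eq_snoc_cons, sklInit, ← vecMul_vecMul,
      vecMul_liftCons, ih (b := Fin.tail b) _ _ (fun l => h l.succ), skl,
      ← vecMul_vecMul _ _ (liftCons (d.skl r (s + 1))), vecMul_liftCons]
    simp only [d.vecMul_S_head_snoc r s g (h 0)]
    have e : (fun a : Fin r → Fin N => (d.x s - d.y (s + 1 + r)) •
        ((fun a => g (Fin.snoc a k)) ᵥ* (oneSite (d.S s) 0 * d.head r s)) (Fin.cons (b 0) a)) =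
        (d.x s - d.y (s + 1 + r)) • fun a : Fin r → Fin N =>
        ((fun a => g (Fin.snoc a k)) ᵥ* (oneSite (d.S s) 0 * d.head r s)) (Fin.cons (b 0) a) := rfl
    rw [e, smul_vecMul, Pi.smul_apply, smul_smul, Fin.prod_univ_succ]
    congr 1
    rw [mul_comm]
    simp [add_comm, add_left_comm]

/-- A scalar row vector, with coefficients in the algebra `A`. -/
abbrev toAlg (A : Type*) [Ring A] [Algebra K A] {ι : Type*} (f : ι → K) : ι → A :=
  fun b => algebraMap K A (f b)

theorem asym_toAlg {r : ℕ} {f : (Fin r → Fin N) → K} (hf : Asym q f) : Asym q (toAlg A f) := by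
  intro k b
  simp only [toAlg]
  rw [hf k b, map_neg, smul_eq_mul, map_mul, Algebra.smul_def]

theorem asym_sum_cons {r : ℕ} {f : (Fin (r + 1) → Fin N) → K} (hf : Asym q f)
    (Z : Fin N → A) : Asym q fun a => ∑ e, f (Fin.cons e a) • Z e := by
  intro k b
  simp only
  rw [Finset.smul_sum, ← Finset.sum_neg_distrib]
  refine Finset.sum_congr rfl fun e _ => ?_
  rw [show f (Fin.cons e b) = _ from hf.cons e k b, neg_smul, smul_eq_mul, mul_smul]

variable [NeZero (2 : K)]

/-- For `t ≠ c` the support condition leaves only `e = c`, and antisymmetry exchanges `c` and `t`.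
All terms then carry entries `f (cons e (cons c a))`, and for each `e ≠ c` the two entries of `S`
that occur combine to `Sb` by `smul_S_sub`. -/
theorem sum_rho_smul (hq : q ≠ 0) {r : ℕ} (s : ℕ) {f : (Fin (r + 2) → Fin N) → K}
    {I : Finset (Fin N)} (hf : Asym q f) (hs : SuppIn I f) (hI : I.card = r + 2) {c : Fin N}
    (hc : c ∈ I) {a : Fin r → Fin N} (ha : ∀ l, c ≠ a l) :
    ∑ t, rho q (d.x s) (d.y (s + 1)) t c •
        ∑ e, f (Fin.cons e (Fin.cons t a)) • d.S s e t =
      (d.x s - d.y (s + 1)) • ∑ e, f (Fin.cons e (Fin.cons c a)) • d.Sb s e c := by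
  have h0 : f (Fin.cons c (Fin.cons c a)) = 0 :=
    hf.eq_zero hq (i := 0) (j := Fin.succ 0) (Fin.succ_ne_zero 0).symm (by simp)
  have hsw : ∀ t, f (Fin.cons c (Fin.cons t a)) = -(pq q t c * f (Fin.cons t (Fin.cons c a))) := by
    intro t
    have := hf ⟨0, by omega⟩ (Fin.cons c (Fin.cons t a))
    have e1 : AdjIdx.left (⟨0, by omega⟩ : AdjIdx (r + 2)) = 0 := rfl
    have e2 : AdjIdx.right (⟨0, by omega⟩ : AdjIdx (r + 2)) = Fin.succ 0 := rfl
    rw [e1, e2] at this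
    have e3 : (Fin.cons c (Fin.cons t a) : Fin (r + 2) → Fin N) ∘ Equiv.swap 0 (Fin.succ 0) =
        Fin.cons t (Fin.cons c a) := by
      ext m
      refine Fin.cases ?_ (fun m => ?_) m
      · simp
      · refine Fin.cases ?_ (fun m => ?_) m
        · simp
        · rw [Function.comp_apply, Equiv.swap_apply_of_ne_of_ne (Fin.succ_ne_zero _)
            (fun h => Fin.succ_ne_zero m (Fin.succ_injective _ h))]
          simp
    rw [e3] at this
    simpa using this
  have h1 : ∀ t, rho q (d.x s) (d.y (s + 1)) t c •
        ∑ e, f (Fin.cons e (Fin.cons t a)) • d.S s e t =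
      (if t = c then rho q (d.x s) (d.y (s + 1)) c c •
        ∑ e, f (Fin.cons e (Fin.cons c a)) • d.S s e c else 0) -
      f (Fin.cons t (Fin.cons c a)) • (pq q t c * rho q (d.x s) (d.y (s + 1)) t c) • d.S s c t := by
    intro t
    by_cases htc : t = c
    · subst htc
      simp [h0]
    · rw [if_neg htc, zero_sub, Finset.sum_eq_single c, hsw]
      · rw [smul_smul, smul_smul, ← neg_smul]; congr 1; ring
      · intro e _ hec
        by_contra hne
        have hne' : f (Fin.cons e (Fin.cons t a)) ≠ 0 := fun h => hne (by rw [h, zero_smul])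
        obtain ⟨i, hi⟩ := hs.exists_eq hq hf hI hne' hc
        revert hi
        refine Fin.cases ?_ (fun i => ?_) i
        · simpa using hec
        · refine Fin.cases ?_ (fun i => ?_) i
          · simpa using htc
          · simpa using (ha i).symm
      · simp
  rw [Finset.sum_congr rfl fun t _ => h1 t, Finset.sum_sub_distrib, Finset.sum_ite_eq',
    if_pos (Finset.mem_univ _), Finset.smul_sum, Finset.smul_sum, ← Finset.sum_sub_distrib]
  refine Finset.sum_congr rfl fun e _ => ?_
  by_cases hec : e = c
  · subst hec; simp [h0]
  · rw [smul_comm, ← smul_sub, d.smul_S_sub hq s hec, smul_comm]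

/-- The first tensor factor of the Sklyanin product, acting on an antisymmetric row vector. -/
theorem vecMul_S_head (hq : q ≠ 0) {r : ℕ} (s : ℕ) {f : (Fin (r + 1) → Fin N) → K}
    {I : Finset (Fin N)} (hf : Asym q f) (hs : SuppIn I f) (hI : I.card = r + 1) {c : Fin N}
    (hc : c ∈ I) (a : Fin r → Fin N) :
    (toAlg A f ᵥ* (oneSite (d.S s) 0 * d.head r s)) (Fin.cons c a) =
      (∏ l : Fin r, (d.x s - d.y (s + 1 + l))) • ∑ e, f (Fin.cons e a) • d.Sb s e c := by
  have hg : ∀ c (a : Fin r → Fin N), (toAlg A f ᵥ* oneSite (d.S s) 0) (Fin.cons c a) =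
      ∑ e, f (Fin.cons e a) • d.S s e c := by
    intro c a
    rw [vecMul_oneSite_zero]
    simp [toAlg, Algebra.smul_def]
  -- Both sides are antisymmetric in `a`, so they vanish unless `a` is injective, and then one
  -- ordering of `a` suffices.
  have hL : Asym q fun a => (toAlg A f ᵥ* (oneSite (d.S s) 0 * d.head r s)) (Fin.cons c a) := by
    rw [← vecMul_vecMul]
    refine d.asym_vecMul_head hq r s (fun c => ?_) c
    simp only [hg]
    exact asym_sum_cons hf _
  have hR : Asym q fun a => (∏ l : Fin r, (d.x s - d.y (s + 1 + l))) •
      ∑ e, f (Fin.cons e a) • d.Sb s e c := asym_smul (asym_sum_cons hf _) _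
  by_cases hinj : Injective a
  swap
  · rw [hL.eq_zero_of_not_injective hq hinj, hR.eq_zero_of_not_injective hq hinj]
  -- If `c` does not occur in `a`, the operators $R^t$ are scalars and the support condition forces
  -- `e = c`, where `Sb` and `S` agree.
  by_cases hca : ∀ l, c ≠ a l
  · rw [← vecMul_vecMul, d.vecMul_head_of_ne r s _ hca, hg]
    congr 1
    refine Finset.sum_congr rfl fun e _ => ?_
    by_cases h : f (Fin.cons e a) = 0
    · simp [h]
    · obtain ⟨i, hi⟩ := hs.exists_eq hq hf hI h hc
      have : e = c := by
        revert hi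
        refine Fin.cases ?_ (fun i => ?_) i
        · simp
        · intro hi
          exact absurd hi.symm (hca i)
      rw [this, d.Sb_diag]
  · push Not at hca
    obtain ⟨i, hi⟩ := hca
    rcases r with _ | r
    · exact i.elim0
    -- The swap brings `c` to the front of `a`, so that only $R^t_{12}$ meets equal indices.
    refine hL.ext hq hR (Equiv.swap 0 i) ?_
    obtain ⟨a', ha'⟩ : ∃ a' : Fin r → Fin N, a ∘ Equiv.swap 0 i = Fin.cons c a' :=
      ⟨Fin.tail (a ∘ Equiv.swap 0 i), by
        rw [← Fin.cons_self_tail (a ∘ Equiv.swap 0 i)]; simp [hi]⟩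
    have hinj' : Injective (Fin.cons c a' : Fin (r + 1) → Fin N) := by
      rw [← ha']; exact hinj.comp (Equiv.injective _)
    have hne : ∀ l, c ≠ a' l := by
      intro l h
      have := @hinj' 0 l.succ (by simpa using h)
      exact Fin.succ_ne_zero l this.symm
    rw [ha', ← vecMul_vecMul, d.vecMul_head_cons_self r s _ hne]
    simp only [hg]
    rw [d.sum_rho_smul hq s hf hs hI hc hne, smul_smul, Fin.prod_univ_succ, mul_comm]
    simp

/-- Both reductions at once: the first site yields `Sb`, the last site keeps its index `k`, and a
Sklyanin product on the `r` inner sites is left. Only the entries of `b` must avoid `k`; the first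
index `c` may equal it. -/
theorem vecMul_sklInit_eval (hq : q ≠ 0) {r : ℕ} (s : ℕ) {f : (Fin (r + 2) → Fin N) → K}
    {I : Finset (Fin N)} (hf : Asym q f) (hs : SuppIn I f) (hI : I.card = r + 2) {c k : Fin N}
    (hc : c ∈ I) {b : Fin r → Fin N} (hb : ∀ l, b l ≠ k) :
    (toAlg A f ᵥ* d.sklInit (r + 1) s) (Fin.snoc (Fin.cons c b) k) =
      ((∏ l : Fin (r + 1), (d.x s - d.y (s + 1 + l))) *
        ∏ i : Fin r, (d.x (s + 1 + i) - d.y (s + 1 + r))) •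
      ∑ e, d.Sb s e c *
        (toAlg A (fun a => f (Fin.cons e (Fin.snoc a k))) ᵥ* d.skl r (s + 1)) b := by
  rw [← Fin.cons_snoc_eq_snoc_cons, sklInit, ← vecMul_vecMul, vecMul_liftCons,
    d.vecMul_sklInit_of_ne _ _ _ hb]
  simp only [d.vecMul_S_head hq s hf hs hI hc]
  rw [mul_comm, mul_smul]
  congr 1
  have e : (fun a : Fin r → Fin N => (∏ l : Fin (r + 1), (d.x s - d.y (s + 1 + l))) •
      ∑ e, f (Fin.cons e (Fin.snoc a k)) • d.Sb s e c) =
      (∏ l : Fin (r + 1), (d.x s - d.y (s + 1 + l))) • fun a : Fin r → Fin N =>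
      ∑ e, f (Fin.cons e (Fin.snoc a k)) • d.Sb s e c := rfl
  rw [e, smul_vecMul, Pi.smul_apply]
  congr 1
  simp only [vecMul, dotProduct, toAlg, Finset.sum_mul, Finset.mul_sum]
  rw [Finset.sum_comm]
  refine Finset.sum_congr rfl fun t _ => Finset.sum_congr rfl fun a _ => ?_
  rw [Algebra.smul_def, ← mul_assoc, Algebra.commutes]

end RTTData

/-! ### The map `π` on sequences -/

section PiFun

variable {N r : ℕ}

/-- The map `π` on sequences; it is meaningful for sequences of distinct elements. -/
def piFun (p : Fin r → Fin N) : Fin r → Fin N :=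
  fun i => (piList (List.ofFn p)).getD i (p i)

theorem piMap_eq_piFun (p : Equiv.Perm (Fin N)) : (piMap p : Fin N → Fin N) = piFun p := by
  ext i
  simp [piMap, piFun, length_piList_ofFn]

theorem ofFn_piFun {p : Fin r → Fin N} (hp : Injective p) :
    List.ofFn (piFun p) = piList (List.ofFn p) := by
  have h := (piList_perm _ _ rfl (List.nodup_ofFn.2 hp)).1.length_eq
  rw [List.length_ofFn] at h
  refine List.ext_getElem (by simp [h]) fun i h1 h2 => ?_
  simp [piFun, h2]

theorem piFun_injective {p : Fin r → Fin N} (hp : Injective p) : Injective (piFun p) := by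
  rw [← List.nodup_ofFn, ofFn_piFun hp,
    (piList_perm _ _ rfl (List.nodup_ofFn.2 hp)).1.nodup_iff]
  exact List.nodup_ofFn.2 hp

theorem range_piFun {p : Fin r → Fin N} (hp : Injective p) :
    Set.range (piFun p) = Set.range p := by
  ext z
  rw [← List.mem_ofFn' (piFun p), ofFn_piFun hp,
    (piList_perm _ _ rfl (List.nodup_ofFn.2 hp)).1.mem_iff, List.mem_ofFn']

theorem le_piFun_last {p : Fin (r + 1) → Fin N} (hp : Injective p) (i : Fin (r + 1)) :
    p i ≤ piFun p (Fin.last r) := by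
  obtain ⟨pre, W, h1, h2⟩ := (piList_perm _ _ rfl (List.nodup_ofFn.2 hp)).2 (by simp)
  rw [← ofFn_piFun hp, List.ofFn_succ'] at h1
  simp only [List.concat_eq_append] at h1
  have h3 := List.append_inj_right' h1 rfl
  simp only [List.cons.injEq, and_true] at h3
  rw [h3]
  exact h2 _ (List.mem_ofFn.2 ⟨i, rfl⟩)

theorem piFun_last {p : Fin (r + 1) → Fin N} (hp : Injective p) {I : Finset (Fin N)}
    (hI : Set.range p = I) {w : Fin N} (hw : w ∈ I) (hmax : ∀ z ∈ I, z ≤ w) :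
    piFun p (Fin.last r) = w := by
  have h1 : piFun p (Fin.last r) ∈ Set.range p := by
    rw [← range_piFun hp]; exact ⟨_, rfl⟩
  rw [hI] at h1
  obtain ⟨i, hi⟩ : w ∈ Set.range p := by rw [hI]; exact hw
  exact le_antisymm (hmax _ h1) (hi ▸ le_piFun_last hp i)

theorem init_piFun_injective {p : Fin (r + 1) → Fin N} (hp : Injective p) :
    Injective (Fin.init (piFun p)) :=
  (piFun_injective hp).comp (Fin.castSucc_injective r)

theorem range_init {p : Fin (r + 1) → Fin N} (hp : Injective p) :
    Set.range (Fin.init p) = Set.range p \ {p (Fin.last r)} := by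
  ext z
  constructor
  · rintro ⟨i, rfl⟩
    refine ⟨⟨_, rfl⟩, fun h => ?_⟩
    exact (Fin.castSucc_lt_last i).ne (hp h)
  · rintro ⟨⟨i, rfl⟩, hi⟩
    revert hi
    refine Fin.lastCases (fun hi => absurd rfl hi) (fun i _ => ?_) i
    exact ⟨i, rfl⟩

theorem range_tail {p : Fin (r + 1) → Fin N} (hp : Injective p) :
    Set.range (Fin.tail p) = Set.range p \ {p 0} := by
  ext z
  constructor
  · rintro ⟨i, rfl⟩
    refine ⟨⟨_, rfl⟩, fun h => ?_⟩
    exact Fin.succ_ne_zero i (hp h)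
  · rintro ⟨⟨i, rfl⟩, hi⟩
    revert hi
    refine Fin.cases (fun hi => absurd rfl hi) (fun i _ => ?_) i
    exact ⟨i, rfl⟩

theorem range_init_piFun {p : Fin (r + 1) → Fin N} (hp : Injective p) {I : Finset (Fin N)}
    (hI : Set.range p = I) {w : Fin N} (hw : w ∈ I) (hmax : ∀ z ∈ I, z ≤ w) :
    Set.range (Fin.init (piFun p)) = (I.erase w : Finset (Fin N)) := by
  rw [range_init (piFun_injective hp), range_piFun hp, piFun_last hp hI hw hmax, hI,
    Finset.coe_erase]

theorem ofFn_cons_snoc {α : Type*} (e k : α) (a : Fin r → α) :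
    List.ofFn (Fin.cons e (Fin.snoc a k : Fin (r + 1) → α) : Fin (r + 2) → α) =
      e :: (List.ofFn a ++ [k]) := by
  rw [List.ofFn_succ]
  simp only [Fin.cons_zero, Fin.cons_succ]
  rw [List.ofFn_succ']
  simp

theorem sort_ofFn {p : Fin r → Fin N} (hp : Injective p) {I : Finset (Fin N)}
    (hI : Set.range p = I) : (List.ofFn p).insertionSort (· ≥ ·) = I.sort (· ≥ ·) := by
  refine List.Perm.eq_of_pairwise' (r := (· ≥ ·)) (List.pairwise_insertionSort _ _)
    (Finset.pairwise_sort _ _) ?_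
  refine (List.perm_insertionSort _ _).trans ?_
  rw [List.perm_ext_iff_of_nodup (List.nodup_ofFn.2 hp) (Finset.sort_nodup _ _)]
  intro z
  rw [List.mem_ofFn', hI, Finset.mem_sort]
  rfl

/-- The recursion for $\pi$ with the final maximum dropped. The inner sequence enters in the same
truncated form, so this is the shape in which the induction closes. -/
theorem init_piFun_cons_snoc {e k : Fin N} {a : Fin (r + 1) → Fin N}
    (hp : Injective (Fin.cons e (Fin.snoc a k : Fin (r + 2) → Fin N) : Fin (r + 3) → Fin N))
    (ha : Injective a) {I : Finset (Fin N)}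
    (hI : Set.range (Fin.cons e (Fin.snoc a k : Fin (r + 2) → Fin N) : Fin (r + 3) → Fin N) = I)
    {w₁ w₂ w₃ : Fin N} {t : List (Fin N)} (hw : I.sort (· ≥ ·) = w₁ :: w₂ :: w₃ :: t) :
    Fin.init (piFun (Fin.cons e (Fin.snoc a k : Fin (r + 2) → Fin N) : Fin (r + 3) → Fin N)) =
      Fin.cons (pairMap w₁ w₂ w₃ (e, k)).1
        (Fin.snoc (Fin.init (piFun a)) (pairMap w₁ w₂ w₃ (e, k)).2 : Fin (r + 1) → Fin N) := by
  have hs := sort_ofFn hp hI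
  have key : piList (List.ofFn
      (Fin.cons e (Fin.snoc a k : Fin (r + 2) → Fin N) : Fin (r + 3) → Fin N)) =
      (pairMap w₁ w₂ w₃ (e, k)).1 ::
        ((piList (List.ofFn a)).dropLast ++ [(pairMap w₁ w₂ w₃ (e, k)).2, w₁]) := by
    rw [hw] at hs
    rw [ofFn_cons_snoc] at hs ⊢
    obtain ⟨x, l, hx⟩ : ∃ x l, List.ofFn a = x :: l := ⟨_, _, List.ofFn_succ⟩
    rw [hx] at hs ⊢
    obtain ⟨y, m, hy⟩ : ∃ y m, l ++ [k] = y :: m := by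
      cases l with
      | nil => exact ⟨_, _, rfl⟩
      | cons y m => exact ⟨_, _, rfl⟩
    have hd : (y :: m).dropLast = l := by rw [← hy]; simp
    have hl : (y :: m).getLast (by simp) = k := by simp [← hy]
    rw [List.cons_append, hy] at hs ⊢
    rw [piList, hs, hd, hl]
    rfl
  have h2 : piFun (Fin.cons e (Fin.snoc a k : Fin (r + 2) → Fin N) : Fin (r + 3) → Fin N) =
      Fin.snoc (Fin.cons (pairMap w₁ w₂ w₃ (e, k)).1
        (Fin.snoc (Fin.init (piFun a)) (pairMap w₁ w₂ w₃ (e, k)).2 : Fin (r + 1) → Fin N) :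
        Fin (r + 2) → Fin N) w₁ := by
    apply List.ofFn_injective
    rw [ofFn_piFun hp, key, ← Fin.cons_snoc_eq_snoc_cons, ofFn_cons_snoc, ← ofFn_piFun ha,
      List.ofFn_succ', List.ofFn_succ']
    simp [Fin.init]
  rw [h2, Fin.init_snoc]

/-- The value does not involve `e`. It can thus serve as first column index before the sum over `e`
is expanded. -/
theorem pairMap_fst {α : Type*} [LinearOrder α] (w₁ w₂ w₃ e k : α) :
    (pairMap w₁ w₂ w₃ (e, k)).1 = if k = w₁ then w₂ else k := by
  simp only [pairMap]
  split_ifs <;> simp_all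

/-- The exponents of `q` caused by the outer entries of a sequence depend only on the set of its
inner entries. -/
theorem exists_invNum_cons_snoc {β : Fin r → Fin N} (hβ : Injective β) (c d : Fin N) :
    ∃ m, ∀ β' : Fin r → Fin N, Injective β' → Set.range β' = Set.range β →
      invNum (Fin.cons c (Fin.snoc β' d : Fin (r + 1) → Fin N) : Fin (r + 2) → Fin N) =
        invNum β' + m := by
  refine ⟨(∑ j, if d < β j then 1 else 0) +
    ∑ j, if (Fin.snoc β d : Fin (r + 1) → Fin N) j < c then 1 else 0, fun β' h1 h2 => ?_⟩
  obtain ⟨σ, rfl⟩ := exists_comp_perm hβ h1 h2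
  rw [invNum_cons, invNum_snoc, Fin.sum_univ_castSucc, Fin.sum_univ_castSucc, add_assoc]
  simp only [Fin.snoc_castSucc, Fin.snoc_last, Function.comp_apply]
  rw [Equiv.sum_comp σ fun j => if d < β j then 1 else 0,
    Equiv.sum_comp σ fun j => if β j < c then 1 else 0]

theorem invNum_cons_sub {β β' : Fin r → Fin N} (hβ : Injective β) (hβ' : Injective β')
    (h : Set.range β' = Set.range β) (c : Fin N) :
    ∃ m, invNum (Fin.cons c β : Fin (r + 1) → Fin N) = invNum β + m ∧
      invNum (Fin.cons c β' : Fin (r + 1) → Fin N) = invNum β' + m := by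
  obtain ⟨σ, rfl⟩ := exists_comp_perm hβ hβ' h
  refine ⟨_, invNum_cons _ _, ?_⟩
  rw [invNum_cons]
  simp only [Function.comp_apply]
  rw [Equiv.sum_comp σ fun j => if β j < c then 1 else 0]

end PiFun

/-! ### The expansion, by induction from `r` to `r + 2` tensor factors. -/

namespace RTTData

variable {N : ℕ} {K A : Type*} [Field K] [Ring A] [Algebra K A] {q : K} (d : RTTData N q A)

/-- The product of `x_i - y_j` over `s ≤ i < j < s + r`. -/
def gam (r s : ℕ) : K :=
  ∏ i : Fin r, ∏ j : Fin r, if i < j then d.x (s + i) - d.y (s + j) else 1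

/-- The pairs containing the first site are split off, then the remaining ones containing the last
site; these are the scalars of `vecMul_sklInit_eval`. -/
theorem gam_add_two (r s : ℕ) : d.gam (r + 2) s =
    ((∏ l : Fin (r + 1), (d.x s - d.y (s + 1 + l))) *
      ∏ i : Fin r, (d.x (s + 1 + i) - d.y (s + 1 + r))) * d.gam r (s + 1) := by
  have h1 : d.gam (r + 2) s = (∏ l : Fin (r + 1), (d.x s - d.y (s + 1 + l))) *
      d.gam (r + 1) (s + 1) := by
    rw [gam, Fin.prod_univ_succ, Fin.prod_univ_succ]
    simp only [lt_self_iff_false, if_false, one_mul, Fin.succ_pos, if_true, gam]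
    congr 1
    · simp [add_comm, add_left_comm]
    · refine Finset.prod_congr rfl fun i _ => ?_
      rw [Fin.prod_univ_succ]
      simp [add_comm, add_left_comm]
  have h2 : d.gam (r + 1) (s + 1) = (∏ i : Fin r, (d.x (s + 1 + i) - d.y (s + 1 + r))) *
      d.gam r (s + 1) := by
    rw [gam, Fin.prod_univ_castSucc]
    have e : (∏ j : Fin (r + 1), if Fin.last r < j then
        d.x (s + 1 + Fin.last r) - d.y (s + 1 + j) else 1) = 1 :=
      Finset.prod_eq_one fun j _ => if_neg (Fin.le_last j).not_gt
    rw [e, mul_one, gam, ← Finset.prod_mul_distrib]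
    refine Finset.prod_congr rfl fun i _ => ?_
    rw [Fin.prod_univ_castSucc, mul_comm]
    simp [Fin.castSucc_lt_last]
  rw [h1, h2, mul_assoc]

/-- The product of the entries of `S̄ᵗ` and `S` at the positions given by two sequences. -/
def entryProd (r s : ℕ) (p p' : Fin r → Fin N) : A :=
  ((List.finRange r).map fun i : Fin r => if (i : ℕ) < r / 2 then d.Sb (s + i) (p i) (p' i)
    else d.S (s + i) (p i) (p' i)).prod

theorem entryProd_one (s : ℕ) (p p' : Fin 1 → Fin N) :
    d.entryProd 1 s p p' = d.S s (p 0) (p' 0) := by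
  simp [entryProd, List.finRange_succ]

/-- Since `(r + 2) / 2 = r / 2 + 1`, removing the two outer factors removes one `Sb` on the left and
one `S` on the right, and leaves the inner pattern intact. For odd length the middle factor is an
`S`. -/
theorem entryProd_add_two (r s : ℕ) (a a' : Fin r → Fin N) (e e' k k' : Fin N) :
    d.entryProd (r + 2) s (Fin.cons e (Fin.snoc a k : Fin (r + 1) → Fin N))
      (Fin.snoc (Fin.cons e' a' : Fin (r + 1) → Fin N) k') =
      d.Sb s e e' * d.entryProd r (s + 1) a a' * d.S (s + (r + 1)) k k' := by
  rw [entryProd, List.finRange_succ, ← Fin.cons_snoc_eq_snoc_cons, List.map_cons, List.prod_cons,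
    List.map_map, List.finRange_succ_last, List.map_append, List.prod_append, List.map_map,
    ← mul_assoc]
  congr 1
  · congr 1
    · simp
    · rw [entryProd]
      congr 1
      refine List.map_congr_left fun i _ => ?_
      have e1 : s + (i.castSucc.succ : Fin (r + 2)) = s + 1 + i := by simp; omega
      have e2 : ((i.castSucc.succ : Fin (r + 2)) : ℕ) < (r + 2) / 2 ↔ (i : ℕ) < r / 2 := by
        simp
      simp only [Function.comp_apply, e1, e2, Fin.cons_succ, Fin.snoc_castSucc]
  · have e2 : ¬ (((Fin.last r).succ : Fin (r + 2)) : ℕ) < (r + 2) / 2 := by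
      simp; omega
    simp only [List.map_cons, List.map_nil, List.prod_cons, List.prod_nil, mul_one,
      Function.comp_apply, e2, if_false, Fin.cons_succ, Fin.snoc_last]
    simp

/-- The expansion of the antisymmetrized Sklyanin product. -/
def Expansion (r : ℕ) : Prop :=
  ∀ (s : ℕ) (f : (Fin (r + 1) → Fin N) → K) (I : Finset (Fin N)), Asym q f → SuppIn I f →
    I.card = r + 1 → ∀ w ∈ I, (∀ z ∈ I, z ≤ w) → ∀ (b : Fin r → Fin N), Injective b →
      Set.range b = (I.erase w : Finset (Fin N)) → ∀ k' : Fin N,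
    (-q) ^ invNum b • (toAlg A f ᵥ* d.skl (r + 1) s) (Fin.snoc b k') =
      d.gam (r + 1) s • ∑ p : Fin (r + 1) → Fin N,
        (f p * (-q) ^ invNum (Fin.init (piFun p))) •
          d.entryProd (r + 1) s p (Fin.snoc (Fin.init (piFun p)) k')

theorem expansion_zero : d.Expansion 0 := by
  intro s f I hf hs hI w hw hmax b hb hr k'
  have hb0 : ∀ b : Fin 0 → Fin N, invNum b = 0 := fun b => by simp [invNum]
  have hg : d.gam (0 + 1) s = 1 := by simp [gam]
  have he : ∀ p p' : Fin (0 + 1) → Fin N, d.entryProd (0 + 1) s p p' = d.S s (p 0) (p' 0) :=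
    d.entryProd_one s
  have e1 : ∀ (b : Fin 0 → Fin N) (c : Fin N), (Fin.snoc b c : Fin (0 + 1) → Fin N) 0 = c :=
    fun b c => Fin.snoc_last (α := fun _ => Fin N) c b
  rw [hb0, pow_zero, one_smul, skl_succ, ← vecMul_vecMul, vecMul_oneSite_last, hg, one_smul,
    sum_snoc]
  refine Finset.sum_congr rfl fun e _ => ?_
  rw [Fintype.sum_unique, he, e1, e1, hb0, pow_zero, mul_one, sklInit, vecMul_one, toAlg,
    Algebra.smul_def, Subsingleton.elim b default]
  rfl

/-- The coefficient of `S_{k,k'}` in the expansion, where `k` is the last entry of the row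
sequence. -/
def InitExpansion (r : ℕ) : Prop :=
  ∀ (s : ℕ) (f : (Fin (r + 2) → Fin N) → K) (I : Finset (Fin N)), Asym q f → SuppIn I f →
    I.card = r + 2 → ∀ w ∈ I, (∀ z ∈ I, z ≤ w) → ∀ (b : Fin (r + 1) → Fin N), Injective b →
      Set.range b = (I.erase w : Finset (Fin N)) → ∀ k : Fin N,
    (-q) ^ invNum b • (toAlg A f ᵥ* d.sklInit (r + 1) s) (Fin.snoc b k) =
      d.gam (r + 2) s • ∑ e, ∑ a : Fin r → Fin N,
        (f (Fin.cons e (Fin.snoc a k : Fin (r + 1) → Fin N)) * (-q) ^ invNum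
          (Fin.init (piFun (Fin.cons e (Fin.snoc a k : Fin (r + 1) → Fin N))))) •
        (d.Sb s e (Fin.init (piFun (Fin.cons e (Fin.snoc a k : Fin (r + 1) → Fin N))) 0) *
          d.entryProd r (s + 1) a
            (Fin.tail (Fin.init (piFun (Fin.cons e (Fin.snoc a k : Fin (r + 1) → Fin N))))))

theorem InitExpansion.expansion {r : ℕ} (h : d.InitExpansion r) : d.Expansion (r + 1) := by
  intro s f I hf hs hI w hw hmax b hb hr k'
  rw [skl_succ, ← vecMul_vecMul, vecMul_oneSite_last, Finset.smul_sum, sum_cons]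
  have e2 : ∀ e, ∑ a : Fin (r + 1) → Fin N, (f (Fin.cons e a) *
      (-q) ^ invNum (Fin.init (piFun (Fin.cons e a)))) •
      d.entryProd (r + 1 + 1) s (Fin.cons e a) (Fin.snoc (Fin.init (piFun (Fin.cons e a))) k') =
      ∑ k, (∑ a : Fin r → Fin N,
        (f (Fin.cons e (Fin.snoc a k : Fin (r + 1) → Fin N)) * (-q) ^ invNum
          (Fin.init (piFun (Fin.cons e (Fin.snoc a k : Fin (r + 1) → Fin N))))) •
        (d.Sb s e (Fin.init (piFun (Fin.cons e (Fin.snoc a k : Fin (r + 1) → Fin N))) 0) *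
          d.entryProd r (s + 1) a
            (Fin.tail (Fin.init (piFun (Fin.cons e (Fin.snoc a k : Fin (r + 1) → Fin N)))))))
        * d.S (s + (r + 1)) k k' := by
    intro e
    rw [sum_snoc]
    refine Finset.sum_congr rfl fun k _ => ?_
    rw [Finset.sum_mul]
    refine Finset.sum_congr rfl fun a _ => ?_
    rw [smul_mul_assoc, ← d.entryProd_add_two, Fin.cons_self_tail]
  rw [Finset.sum_congr rfl fun e _ => e2 e, Finset.sum_comm, Finset.smul_sum]
  refine Finset.sum_congr rfl fun k _ => ?_
  rw [← smul_mul_assoc, h s f I hf hs hI w hw hmax b hb hr k, smul_mul_assoc, Finset.sum_mul]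

variable [NeZero (2 : K)]

theorem initExpansion_zero (hq : q ≠ 0) : d.InitExpansion 0 := by
  intro s f I hf hs hI w hw hmax b hb hr k
  have hc : b 0 ∈ I := by
    have : b 0 ∈ Set.range b := ⟨0, rfl⟩
    rw [hr] at this
    exact Finset.mem_of_mem_erase this
  have e0 := d.vecMul_sklInit_eval hq s hf hs hI hc (k := k) (b := Fin.tail b) fun l => l.elim0
  have hb0 : ∀ b : Fin (0 + 1) → Fin N, invNum b = 0 := fun b => by simp [invNum]
  rw [Fin.cons_self_tail] at e0
  rw [hb0, pow_zero, one_smul, e0, gam_add_two]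
  have hg : d.gam 0 (s + 1) = 1 := by simp [gam]
  rw [hg, mul_one]
  congr 1
  refine Finset.sum_congr rfl fun e _ => ?_
  rw [Fintype.sum_unique, hb0, pow_zero, mul_one, skl, vecMul_one]
  have h1 : d.entryProd 0 (s + 1) default (Fin.tail (Fin.init (piFun (Fin.cons e
    (Fin.snoc (default : Fin 0 → Fin N) k : Fin (0 + 1) → Fin N))))) = 1 := by
    simp [entryProd]
  rw [h1, mul_one, Subsingleton.elim (Fin.tail b) default, toAlg, ← Algebra.commutes,
    ← Algebra.smul_def]
  set p : Fin 2 → Fin N := Fin.cons e (Fin.snoc (default : Fin 0 → Fin N) k : Fin (0 + 1) → Fin N)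
    with hp
  by_cases h0 : f p = 0
  · rw [h0, zero_smul, zero_smul]
  have hinj : Injective p := by
    by_contra h
    exact h0 (hf.eq_zero_of_not_injective hq h)
  have hrp : Set.range p = I := by
    ext z
    exact ⟨fun ⟨i, hi⟩ => hi ▸ hs p h0 i, fun hz => hs.exists_eq hq hf hI h0 hz⟩
  -- Two sites: `I` has only one element besides its maximum `w`, so $p'_1$ must be `b 0`.
  have h2 := range_init_piFun hinj hrp hw hmax
  rw [← hr] at h2
  have h3 : Fin.init (piFun p) 0 ∈ Set.range b := by rw [← h2]; exact ⟨0, rfl⟩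
  obtain ⟨i, hi⟩ := h3
  rw [← hi, show i = 0 from Fin.ext (by omega)]

/-- The antisymmetry of `sklInit` allows `b` to be replaced by any arrangement of the same set. A
suitable one reduces each term of the sum over `e` to the shorter Sklyanin product, for which the
expansion is known. -/
theorem initExpansion_succ (hq : q ≠ 0) {r : ℕ} (ih : d.Expansion r) :
    d.InitExpansion (r + 1) := by
  intro s f I hf hs hI w hw hmax b hb hr k
  have hIb : ∀ i, b i ∈ I := fun i => by
    have : b i ∈ Set.range b := ⟨i, rfl⟩
    rw [hr] at this
    exact Finset.mem_of_mem_erase this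
  have hlast : ∀ e (a : Fin (r + 1) → Fin N),
      (Fin.cons e (Fin.snoc a k : Fin (r + 2) → Fin N) : Fin (r + 3) → Fin N)
        (Fin.last (r + 1)).succ = k := by
    intro e a; rw [Fin.cons_succ, Fin.snoc_last]
  by_cases hk : k ∈ I
  swap
  -- For `k ∉ I` no sequence ending in `k` lies in the support, so both sides vanish.
  · have h0 : ∀ e (a : Fin (r + 1) → Fin N),
        f (Fin.cons e (Fin.snoc a k : Fin (r + 2) → Fin N)) = 0 := by
      intro e a
      by_contra h
      exact hk (hlast e a ▸ hs _ h (Fin.last (r + 1)).succ)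
    have e0 := d.vecMul_sklInit_eval hq s hf hs hI (hIb 0) (k := k) (b := Fin.tail b)
      fun l h => hk (h ▸ hIb l.succ)
    rw [Fin.cons_self_tail] at e0
    rw [e0]
    simp [h0, vecMul, dotProduct, toAlg]
  obtain ⟨w₁, w₂, w₃, t, hsort⟩ : ∃ w₁ w₂ w₃ t, I.sort (· ≥ ·) = w₁ :: w₂ :: w₃ :: t := by
    have hl : (I.sort (· ≥ ·)).length = r + 3 := by rw [Finset.length_sort, hI]
    match I.sort (· ≥ ·), hl with
    | w₁ :: w₂ :: w₃ :: t, _ => exact ⟨w₁, w₂, w₃, t, rfl⟩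
  have hmem : ∀ z, z ∈ w₁ :: w₂ :: w₃ :: t ↔ z ∈ I := fun z => by
    rw [← hsort, Finset.mem_sort]
  have hpw := Finset.pairwise_sort I (· ≥ ·)
  have hnd := Finset.sort_nodup I (· ≥ ·)
  rw [hsort] at hpw hnd
  have hw₁ : w₁ = w := by
    refine le_antisymm (hmax _ ((hmem _).1 (by simp))) ?_
    rcases List.mem_cons.1 ((hmem w).2 hw) with h | h
    · exact h.le
    · exact (List.pairwise_cons.1 hpw).1 _ h
  have hw₂ : w₂ ∈ I := (hmem _).1 (by simp)
  have hw₂w : w₂ ≠ w := by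
    rintro h
    rw [List.nodup_cons, hw₁, h] at hnd
    exact hnd.1 (by simp)
  -- The first column index. For `k ≠ w` it must be `k`, so that the others avoid `k`. For `k = w`
  -- they avoid `k` in any case, and `w₂` is taken because it never lies in `I \ {e, w}` with its
  -- maximum removed, whatever `e` is.
  obtain ⟨c, hcdef⟩ : ∃ c, c = if k = w then w₂ else k := ⟨_, rfl⟩
  have hc : c ∈ I.erase w := by
    rw [hcdef]
    split_ifs with h
    · exact Finset.mem_erase.2 ⟨hw₂w, hw₂⟩
    · exact Finset.mem_erase.2 ⟨h, hk⟩
  have hJ : ((I.erase w).erase c).card = r + 1 := by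
    rw [Finset.card_erase_of_mem hc, Finset.card_erase_of_mem hw, hI]; rfl
  obtain ⟨b', hb', hrb'⟩ : ∃ b' : Fin (r + 1) → Fin N, Injective b' ∧
      Set.range b' = ((I.erase w).erase c : Finset (Fin N)) :=
    ⟨_, (((I.erase w).erase c).orderEmbOfFin hJ).injective, Finset.range_orderEmbOfFin _ hJ⟩
  have hcb' : c ∉ Set.range b' := by rw [hrb']; simp
  have hbk : Injective (Fin.cons c b' : Fin (r + 2) → Fin N) :=
    Fin.cons_injective_iff.2 ⟨hcb', hb'⟩
  have hrbk : Set.range (Fin.cons c b' : Fin (r + 2) → Fin N) = Set.range b := by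
    rw [Fin.range_cons, hrb', hr, ← Finset.coe_insert, Finset.insert_erase hc]
  have hkb' : ∀ l, b' l ≠ k := by
    intro l h
    have hm : k ∈ Set.range b' := ⟨l, h⟩
    rw [hrb', Finset.mem_coe, Finset.mem_erase, Finset.mem_erase] at hm
    apply hm.1
    rw [hcdef, if_neg hm.2.1]
  -- `b` is reordered to `cons c b'`, and the two outer factors are evaluated.
  rw [(d.asym_vecMul_sklInit hq (r + 1 + 1) s (asym_toAlg hf) k).weight_eq hb hbk hrbk,
    d.vecMul_sklInit_eval hq s hf hs hI (Finset.mem_of_mem_erase hc) hkb',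
    show d.gam (r + 1 + 2) s = _ from d.gam_add_two (r + 1) s, mul_smul _ (d.gam (r + 1) (s + 1)),
    smul_comm ((-q) ^ _)]
  congr 1
  rw [Finset.smul_sum, Finset.smul_sum]
  refine Finset.sum_congr rfl fun e _ => ?_
  by_cases h0 : ∀ a : Fin (r + 1) → Fin N,
    f (Fin.cons e (Fin.snoc a k : Fin (r + 2) → Fin N)) = 0
  · simp [h0, vecMul, dotProduct, toAlg]
  push Not at h0
  obtain ⟨a₀, ha₀⟩ := h0
  have hpI : ∀ a : Fin (r + 1) → Fin N, f (Fin.cons e (Fin.snoc a k : Fin (r + 2) → Fin N)) ≠ 0 →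
      Injective (Fin.cons e (Fin.snoc a k : Fin (r + 2) → Fin N) : Fin (r + 3) → Fin N) ∧
      Set.range (Fin.cons e (Fin.snoc a k : Fin (r + 2) → Fin N) : Fin (r + 3) → Fin N) = I := by
    intro a ha
    refine ⟨?_, ?_⟩
    · by_contra h
      exact ha (hf.eq_zero_of_not_injective hq h)
    · ext z
      exact ⟨fun ⟨i, hi⟩ => hi ▸ hs _ ha i, fun hz => hs.exists_eq hq hf hI ha hz⟩
  have haI : ∀ a : Fin (r + 1) → Fin N, f (Fin.cons e (Fin.snoc a k : Fin (r + 2) → Fin N)) ≠ 0 →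
      Injective a ∧ Set.range a = ((I : Set (Fin N)) \ {e}) \ {k} := by
    intro a ha
    obtain ⟨h1, h2⟩ := hpI a ha
    have h3 := range_tail h1
    rw [Fin.tail_cons, Fin.cons_zero, h2] at h3
    have h4 := (Fin.cons_injective_iff.1 h1).2
    have h5 := range_init h4
    rw [Fin.init_snoc, Fin.snoc_last, h3] at h5
    refine ⟨?_, h5⟩
    have := h4.comp (Fin.castSucc_injective _)
    intro i j hij
    exact this (by simpa using hij)
  obtain ⟨hia₀, hra₀⟩ := haI a₀ ha₀
  obtain ⟨hip₀, hrp₀⟩ := hpI a₀ ha₀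
  obtain ⟨I', hI'⟩ : ∃ I' : Finset (Fin N), I' = Finset.univ.image a₀ := ⟨_, rfl⟩
  have hI'c : I'.card = r + 1 := by
    rw [hI', Finset.card_image_of_injective _ hia₀]; simp
  have hraI' : ∀ a : Fin (r + 1) → Fin N,
      f (Fin.cons e (Fin.snoc a k : Fin (r + 2) → Fin N)) ≠ 0 → Set.range a = I' := by
    intro a ha
    rw [(haI a ha).2, ← hra₀, hI']; simp
  have hne : I'.Nonempty := Finset.card_pos.1 (by omega)
  have hfe : Asym q fun a : Fin (r + 1) → Fin N =>
      f (Fin.cons e (Fin.snoc a k : Fin (r + 2) → Fin N)) := (hf.cons e).snoc k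
  have hse : SuppIn I' fun a : Fin (r + 1) → Fin N =>
      f (Fin.cons e (Fin.snoc a k : Fin (r + 2) → Fin N)) := by
    intro a ha i
    have : a i ∈ Set.range a := ⟨i, rfl⟩
    rw [hraI' a ha] at this
    exact this
  obtain ⟨c', k₁, hck⟩ : ∃ c' k₁, pairMap w₁ w₂ w₃ (e, k) = (c', k₁) := ⟨_, _, rfl⟩
  have hcc : c' = c := by
    have := pairMap_fst w₁ w₂ w₃ e k
    rw [hck, hw₁] at this
    rw [hcdef]; exact this
  subst hcc
  have hinit : ∀ a : Fin (r + 1) → Fin N,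
      f (Fin.cons e (Fin.snoc a k : Fin (r + 2) → Fin N)) ≠ 0 →
      Fin.init (piFun (Fin.cons e (Fin.snoc a k : Fin (r + 2) → Fin N) : Fin (r + 3) → Fin N)) =
      Fin.cons c' (Fin.snoc (Fin.init (piFun a)) k₁ : Fin (r + 1) → Fin N) := by
    intro a ha
    have := init_piFun_cons_snoc (hpI a ha).1 (haI a ha).1 (hpI a ha).2 hsort
    rwa [hck] at this
  obtain ⟨β, hβ⟩ : ∃ β, β = Fin.init (piFun a₀) := ⟨_, rfl⟩
  have hβi : Injective β := hβ ▸ init_piFun_injective hia₀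
  have hβr : ∀ a : Fin (r + 1) → Fin N,
      f (Fin.cons e (Fin.snoc a k : Fin (r + 2) → Fin N)) ≠ 0 →
      Set.range (Fin.init (piFun a)) = (I'.erase (I'.max' hne) : Finset (Fin N)) := fun a ha =>
    range_init_piFun (haI a ha).1 (hraI' a ha) (Finset.max'_mem _ _)
      fun z hz => Finset.le_max' _ _ hz
  have hcsi : Injective (Fin.cons c' (Fin.snoc β k₁ : Fin (r + 1) → Fin N) :
      Fin (r + 2) → Fin N) := by
    rw [hβ, ← hinit a₀ ha₀]; exact init_piFun_injective hip₀
  have hcsr : Set.range (Fin.cons c' (Fin.snoc β k₁ : Fin (r + 1) → Fin N) :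
      Fin (r + 2) → Fin N) = (I.erase w : Finset (Fin N)) := by
    rw [hβ, ← hinit a₀ ha₀]; exact range_init_piFun hip₀ hrp₀ hw hmax
  have hsi := (Fin.cons_injective_iff.1 hcsi).2
  -- `β` arranges the inner set `I'` without its maximum, and `k₁` is the one element missing from
  -- `I \ {w, c'}`. The second value of `pairMap` is therefore forced.
  have hsr : Set.range (Fin.snoc β k₁ : Fin (r + 1) → Fin N) = Set.range b' := by
    have := range_tail hcsi
    rw [Fin.tail_cons, Fin.cons_zero, hcsr] at this
    rw [this, hrb', Finset.coe_erase _ (I.erase w)]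
  -- The induction hypothesis leaves its last column index free; it is needed at `k₁`, which need
  -- not be the maximum of `I'`.
  have IH := ih (s + 1) _ I' hfe hse hI'c _ (Finset.max'_mem _ hne)
    (fun z hz => Finset.le_max' _ _ hz) β hβi (hβ ▸ hβr a₀ ha₀) k₁
  have hwt := (d.asym_vecMul_skl hq (r + 1) (s + 1) (asym_toAlg (A := A) hfe)).weight_eq hb' hsi hsr
  obtain ⟨m, hm1, hm2⟩ := invNum_cons_sub hb' hsi hsr c'
  obtain ⟨m', hm'⟩ := exists_invNum_cons_snoc hβi c' k₁
  -- Passing from `b'` to `snoc β k₁` changes the power of `-q` by their numbers of inversions. The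
  -- inversions of the outer entries `c'`, `k₁` with the inner ones depend only on the set of the
  -- latter, hence the common exponent `m'`.
  have key : (-q) ^ invNum (Fin.cons c' b' : Fin (r + 2) → Fin N) •
      (toAlg A (fun a : Fin (r + 1) → Fin N =>
        f (Fin.cons e (Fin.snoc a k : Fin (r + 2) → Fin N))) ᵥ* d.skl (r + 1) (s + 1)) b' =
      (-q) ^ m' • (-q) ^ invNum β • (toAlg A (fun a : Fin (r + 1) → Fin N =>
        f (Fin.cons e (Fin.snoc a k : Fin (r + 2) → Fin N))) ᵥ* d.skl (r + 1) (s + 1))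
          (Fin.snoc β k₁) := by
    rw [hm1, add_comm, pow_add, mul_smul, hwt, smul_smul, smul_smul, ← pow_add, ← pow_add]
    congr 2
    have := hm' β hβi rfl
    omega
  rw [← mul_smul_comm, key, IH, smul_comm, mul_smul_comm]
  congr 1
  rw [Finset.smul_sum, Finset.mul_sum]
  refine Finset.sum_congr rfl fun a _ => ?_
  by_cases ha : f (Fin.cons e (Fin.snoc a k : Fin (r + 2) → Fin N)) = 0
  · simp [ha]
  rw [hinit a ha, hm' _ (init_piFun_injective (haI a ha).1) (by rw [hβr a ha, hβ, hβr a₀ ha₀]),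
    Fin.cons_zero, Fin.tail_cons, smul_smul, mul_smul_comm]
  congr 1
  rw [pow_add]; ring

/-- `Expansion r` concerns `r + 1` tensor factors. Each step adds two of them, so one and two
factors are both base cases. -/
theorem expansion (hq : q ≠ 0) (r : ℕ) : d.Expansion r := by
  induction r using Nat.strong_induction_on with
  | _ r ih =>
    match r with
    | 0 => exact d.expansion_zero
    | 1 => exact (d.initExpansion_zero hq).expansion
    | r + 2 => exact (d.initExpansion_succ hq (ih r (by omega))).expansion

end RTTData

/-! ### The `q`-antisymmetrizer -/

theorem Pq_eq_permMat (N : ℕ) (q : ℂ) : Pq N q = permMat N q := by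
  ext ⟨i, j⟩ ⟨k, l⟩
  simp only [Pq, permMat, pq, E, Matrix.add_apply, Matrix.sum_apply, of_apply, single_kronecker_single,
    mul_one]
  have h1 : ∀ m : Fin N, (Matrix.single (m, m) (m, m) (1 : ℂ) : Matrix (Fin N × Fin N) _ ℂ)
      (i, j) (k, l) = if m = i then if i = j ∧ i = k ∧ i = l then 1 else 0 else 0 := by
    intro m
    simp only [single_apply, Prod.mk.injEq]
    split_ifs <;> grind
  have h2 : ∀ (m n : Fin N) (z : ℂ), ((if n < m then
      z • (Matrix.single (m, n) (n, m) (1 : ℂ) : Matrix (Fin N × Fin N) (Fin N × Fin N) ℂ) else 0) :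
      Matrix (Fin N × Fin N) (Fin N × Fin N) ℂ) (i, j) (k, l) =
      if n = j then if m = i then if j < i ∧ i = l ∧ j = k then z else 0 else 0 else 0 := by
    intro m n z
    split_ifs <;> simp_all [single_apply] <;> grind
  have h3 : ∀ (m n : Fin N) (z : ℂ), ((if m < n then
      z • (Matrix.single (m, n) (n, m) (1 : ℂ) : Matrix (Fin N × Fin N) (Fin N × Fin N) ℂ) else 0) :
      Matrix (Fin N × Fin N) (Fin N × Fin N) ℂ) (i, j) (k, l) =
      if n = j then if m = i then if i < j ∧ i = l ∧ j = k then z else 0 else 0 else 0 := by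
    intro m n z
    split_ifs <;> simp_all [single_apply] <;> grind
  simp only [h1, h2, h3, Finset.sum_ite_eq', Finset.mem_univ, if_true]
  split_ifs <;> grind

section Antisymmetrizer

variable {N r : ℕ} {q : ℂ}

/-- In this form $P^q$ is the ordinary permutation operator conjugated by the diagonal matrix of
powers $q^{\mathrm{inv}(b)}$. -/
theorem pq_eq_zpow (b : Fin r → Fin N) (k : AdjIdx r) :
    pq q (b k.right) (b k.left) =
      q ^ ((invNum (b ∘ Equiv.swap k.left k.right) : ℤ) - invNum b) := by
  rcases lt_trichotomy (b k.left) (b k.right) with h | h | h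
  · rw [invNum_comp_swap b k h]
    simp [pq, h]
  · have : b ∘ Equiv.swap k.left k.right = b := by
      ext m
      simp only [Function.comp_apply, Equiv.swap_apply_def]
      split_ifs with h1 h2
      · rw [h1, h]
      · rw [h2, h]
      · rfl
    rw [this, h]
    simp [pq]
  · have := invNum_comp_swap (b ∘ Equiv.swap k.left k.right) k (by simpa using h)
    have e : (b ∘ Equiv.swap k.left k.right) ∘ Equiv.swap k.left k.right = b := by
      ext m; simp
    rw [e] at this
    rw [this]
    simp [pq, h, h.not_gt]

theorem vecMul_Pq (f : (Fin r → Fin N) → ℂ) (k : AdjIdx r) (b : Fin r → Fin N) :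
    (f ᵥ* twoSite (Pq N q) k.left k.right) b =
      q ^ ((invNum (b ∘ Equiv.swap k.left k.right) : ℤ) - invNum b) *
        f (b ∘ Equiv.swap k.left k.right) := by
  have : Pq N q = base ℂ (permMat N q) := by
    rw [Pq_eq_permMat, base, Algebra.algebraMap_self, RingHom.coe_id, Matrix.map_id]
  rw [this, vecMul_permMat _ k.left_ne_right, pq_eq_zpow, smul_eq_mul]

/-- The exponents telescope along a word, so the action depends only on the permutation that the
word represents. -/
theorem vecMul_qPerm (hq : q ≠ 0) (f : (Fin r → Fin N) → ℂ) (σ : Equiv.Perm (Fin r))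
    (b : Fin r → Fin N) :
    (f ᵥ* qPerm N q σ) b =
      q ^ ((invNum (b ∘ (σ⁻¹ : Equiv.Perm (Fin r))) : ℤ) - invNum b) * f (b ∘ (σ⁻¹ : Equiv.Perm (Fin r))) := by
  have key : ∀ (w : List (AdjIdx r)) (f : (Fin r → Fin N) → ℂ),
      (f ᵥ* (w.map fun k => twoSite (Pq N q) k.left k.right).prod) b =
      q ^ ((invNum (b ∘ ((wordPerm w)⁻¹ : Equiv.Perm (Fin r))) : ℤ) - invNum b) *
        f (b ∘ ((wordPerm w)⁻¹ : Equiv.Perm (Fin r))) := by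
    intro w
    induction w with
    | nil => intro f; simp [wordPerm]
    | cons k w ih =>
      intro f
      have e : b ∘ ((wordPerm (k :: w))⁻¹ : Equiv.Perm (Fin r)) =
          (b ∘ ((wordPerm w)⁻¹ : Equiv.Perm (Fin r))) ∘ Equiv.swap k.left k.right := by
        ext m
        simp [wordPerm, _root_.mul_inv_rev]
      rw [List.map_cons, List.prod_cons, ← vecMul_vecMul, ih, vecMul_Pq, e, ← mul_assoc,
        ← zpow_add₀ hq]
      congr 2
      ring
  have h := (exists_isReducedWord σ).choose_spec.1
  rw [qPerm, key, h]

theorem vecMul_qAntisym (hq : q ≠ 0) (f : (Fin r → Fin N) → ℂ) (b : Fin r → Fin N) :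
    (f ᵥ* qAntisym N r q) b = ∑ σ : Equiv.Perm (Fin r), ((Equiv.Perm.sign σ : ℤ) : ℂ) *
      (q ^ ((invNum (b ∘ (σ⁻¹ : Equiv.Perm (Fin r))) : ℤ) - invNum b) * f (b ∘ (σ⁻¹ : Equiv.Perm (Fin r)))) := by
  rw [qAntisym]
  simp only [← vecMul_qPerm hq]
  simp only [vecMul, dotProduct, Matrix.sum_apply, Matrix.smul_apply, smul_eq_mul, Finset.mul_sum]
  rw [Finset.sum_comm]
  refine Finset.sum_congr rfl fun σ _ => Finset.sum_congr rfl fun a _ => ?_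
  ring

/-- The substitution $\sigma\mapsto\sigma s$ in the sum reverses the sign and shifts the exponent of
$q$ by the coefficient of $P^q$. -/
theorem asym_vecMul_qAntisym (hq : q ≠ 0) (f : (Fin r → Fin N) → ℂ) :
    Asym q (f ᵥ* qAntisym N r q) := by
  intro k b
  rw [pq_eq_zpow, vecMul_qAntisym hq, vecMul_qAntisym hq, smul_eq_mul, Finset.mul_sum,
    ← Finset.sum_neg_distrib, ← Equiv.sum_comp (Equiv.mulRight (Equiv.swap k.left k.right))]
  refine Finset.sum_congr rfl fun σ _ => ?_
  have e : (b ∘ Equiv.swap k.left k.right) ∘ (σ⁻¹ : Equiv.Perm (Fin r)) =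
      b ∘ ((σ * Equiv.swap k.left k.right)⁻¹ : Equiv.Perm (Fin r)) := by
    ext m; simp [_root_.mul_inv_rev]
  rw [Equiv.coe_mulRight, e, Equiv.Perm.sign_mul, Equiv.Perm.sign_swap k.left_ne_right]
  have hz : q ^ ((invNum (b ∘ ((σ * Equiv.swap k.left k.right)⁻¹ : Equiv.Perm (Fin r))) : ℤ) -
      invNum b) = q ^ ((invNum (b ∘ Equiv.swap k.left k.right) : ℤ) - invNum b) *
      q ^ ((invNum (b ∘ ((σ * Equiv.swap k.left k.right)⁻¹ : Equiv.Perm (Fin r))) : ℤ) -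
        invNum (b ∘ Equiv.swap k.left k.right)) := by
    rw [← zpow_add₀ hq]; congr 1; ring
  rw [hz]
  push_cast
  ring

/-- Only $\sigma=1$ fixes the identity sequence. This nonzero entry makes the Sklyanin determinant
unique. -/
theorem qAntisym_id (hq : q ≠ 0) : qAntisym N N q id id = 1 := by
  have h := vecMul_qAntisym hq (Pi.single (id : Fin N → Fin N) 1) id
  rw [single_one_vecMul] at h
  rw [row_apply] at h
  rw [h, Finset.sum_eq_single 1]
  · simp
  · intro σ _ hσ
    have : (id ∘ (σ⁻¹ : Equiv.Perm (Fin N)) : Fin N → Fin N) ≠ id := by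
      intro h'
      apply hσ
      rw [← inv_eq_one]
      ext m
      simpa using congrArg Fin.val (congrFun h' m)
    rw [Pi.single_eq_of_ne this]
    simp
  · simp

end Antisymmetrizer

/-! ### The antisymmetric row vector on $N$ tensor factors. -/

section Weight

variable {N r : ℕ} {K A : Type*} [Field K] [Ring A] [Algebra K A] {q : K}

/-- The `q`-antisymmetric row vector with the entry `(-q)^{-l(b)}` at a permutation `b`. -/
noncomputable def weight (N : ℕ) (q : K) (b : Fin N → Fin N) : K :=
  open Classical in if Injective b then ((-q) ^ invNum b)⁻¹ else 0

theorem invNum_id : invNum (id : Fin N → Fin N) = 0 := by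
  rw [invNum]
  refine Finset.sum_eq_zero fun i _ => Finset.sum_eq_zero fun j _ => if_neg ?_
  rintro ⟨h1, h2⟩
  exact absurd h1 (not_lt.2 h2.le)

theorem Asym.eq_weight [NeZero (2 : K)] (hq : q ≠ 0) {f : (Fin N → Fin N) → A} (hf : Asym q f)
    (b : Fin N → Fin N) : f b = weight N q b • f id := by
  rw [weight]
  split_ifs with h
  · have hb : Bijective b := Finite.injective_iff_bijective.1 h
    have := hf.weight_eq (b := b) (b' := id) h injective_id
      (by rw [Set.range_id, hb.surjective.range_eq])
    rw [invNum_id, pow_zero, one_smul] at this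
    rw [← this, smul_smul, inv_mul_cancel₀ (pow_ne_zero _ (neg_ne_zero.2 hq)), one_smul]
  · rw [hf.eq_zero_of_not_injective hq h, zero_smul]

theorem asym_weight (hq : q ≠ 0) : Asym q (weight N q) := by
  have key : ∀ (k : AdjIdx N) (b : Fin N → Fin N), b k.left < b k.right →
      weight N q (b ∘ Equiv.swap k.left k.right) = -(q⁻¹ * weight N q b) := by
    intro k b h
    have hi : Injective (b ∘ Equiv.swap k.left k.right) ↔ Injective b :=
      Equiv.injective_comp _ _
    by_cases hb : Injective b
    · rw [weight, weight, if_pos (hi.2 hb), if_pos hb, invNum_comp_swap b k h, pow_succ, mul_inv,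
        inv_neg]
      ring
    · rw [weight, weight, if_neg (hi.not.2 hb), if_neg hb]; simp
  intro k b
  rcases lt_trichotomy (b k.left) (b k.right) with h | h | h
  · rw [key k b h]
    simp [pq, h, hq]
  · have hb : ¬ Injective b := fun hb => k.left_ne_right (hb h)
    have hb' : ¬ Injective (b ∘ Equiv.swap k.left k.right) := by
      rwa [Equiv.injective_comp]
    simp [weight, hb, hb']
  · have := key k (b ∘ Equiv.swap k.left k.right) (by simpa using h)
    have e : (b ∘ Equiv.swap k.left k.right) ∘ Equiv.swap k.left k.right = b := by
      ext m; simp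
    rw [e] at this
    rw [this]
    simp [pq, h, h.not_gt]

end Weight

/-! ### The Sklyanin determinant of abstract data and its expansion over permutations. -/

namespace RTTData

variable {N : ℕ} {K A : Type*} [Field K] [NeZero (2 : K)] [Ring A] [Algebra K A] {q : K}
  (d : RTTData N q A)

/-- The Sklyanin determinant. -/
noncomputable def det : A := (toAlg A (weight N q) ᵥ* d.skl N 0) id

theorem vecMul_weight (hq : q ≠ 0) (b : Fin N → Fin N) :
    (toAlg A (weight N q) ᵥ* d.skl N 0) b = weight N q b • d.det :=
  (d.asym_vecMul_skl hq N 0 (asym_toAlg (asym_weight hq))).eq_weight hq b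

theorem vecMul_toAlg_of_asym (hq : q ≠ 0) {f : (Fin N → Fin N) → K} (hf : Asym q f)
    (b : Fin N → Fin N) : (toAlg A f ᵥ* d.skl N 0) b = f b • d.det := by
  have e : toAlg A f = f id • toAlg A (weight N q) := by
    ext a
    rw [Pi.smul_apply, toAlg, toAlg, hf.eq_weight hq a, smul_eq_mul, map_mul, Algebra.smul_def,
      Algebra.commutes]
  rw [e, smul_vecMul, Pi.smul_apply, d.vecMul_weight hq, smul_smul, hf.eq_weight hq b, smul_eq_mul,
    mul_comm]

theorem det_eq (hq : q ≠ 0) : d.det = d.gam N 0 • ∑ p : Equiv.Perm (Fin N),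
    (-q) ^ (-(length p : ℤ) + (length (piMap p) : ℤ)) • d.entryProd N 0 p (piMap p) := by
  rcases N with _ | n
  · have h1 : d.det = 1 := by
      rw [det, skl, vecMul_one, toAlg, weight, if_pos injective_id, invNum_id]; simp
    rw [h1, Fintype.sum_unique]
    simp [gam, entryProd, length]
  -- `b = castSucc` and `k' = last` make up the identity sequence, so the left side is the defining
  -- entry of `det`.
  · have h := d.expansion hq n 0 (weight (n + 1) q) Finset.univ (asym_weight hq)
      (fun b _ i => Finset.mem_univ _) (by simp) (Fin.last n) (Finset.mem_univ _)
      (fun z _ => Fin.le_last z) Fin.castSucc (Fin.castSucc_injective n)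
      (by ext z; simp [Fin.ext_iff]; omega) (Fin.last n)
    have e1 : invNum (Fin.castSucc : Fin n → Fin (n + 1)) = 0 := by
      have := invNum_snoc (Fin.castSucc : Fin n → Fin (n + 1)) (Fin.last n)
      have e2 : (Fin.snoc (Fin.castSucc : Fin n → Fin (n + 1)) (Fin.last n) :
          Fin (n + 1) → Fin (n + 1)) = id := by
        ext m
        refine Fin.lastCases ?_ (fun m => ?_) m <;> simp
      rw [e2, invNum_id] at this
      omega
    have e2 : (Fin.snoc (Fin.castSucc : Fin n → Fin (n + 1)) (Fin.last n) :
        Fin (n + 1) → Fin (n + 1)) = id := by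
      ext m
      refine Fin.lastCases ?_ (fun m => ?_) m <;> simp
    rw [e1, e2, pow_zero, one_smul] at h
    rw [det, h]
    congr 1
    symm
    refine Fintype.sum_of_injective (fun p : Equiv.Perm (Fin (n + 1)) => (p : Fin (n + 1) → _))
      DFunLike.coe_injective _ _ ?_ ?_
    · intro p hp
      have : ¬ Injective p := by
        intro hi
        exact hp ⟨Equiv.ofBijective p (Finite.injective_iff_bijective.1 hi), rfl⟩
      rw [weight, if_neg this, zero_mul, zero_smul]
    · intro p
      -- $p'$ ends in its maximum, so dropping the last entry loses no inversions.
      have hl : piFun p (Fin.last n) = Fin.last n :=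
        piFun_last p.injective (I := Finset.univ) (by simp [p.surjective.range_eq])
          (Finset.mem_univ _) fun z _ => Fin.le_last z
      have hs : (Fin.snoc (Fin.init (piFun p)) (Fin.last n) : Fin (n + 1) → Fin (n + 1)) =
          piFun p := by
        conv_rhs => rw [← Fin.snoc_init_self (piFun p), hl]
      have hi : invNum (Fin.init (piFun p)) = invNum (piFun p) := by
        rw [← hs, invNum_snoc, Fin.init_snoc]
        simp [Fin.le_last]
      rw [hs, hi, weight, if_pos p.injective, length_eq_invNum, length_eq_invNum, piMap_eq_piFun,
        zpow_add₀ (neg_ne_zero.2 hq), _root_.zpow_neg, zpow_natCast, zpow_natCast]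

end RTTData

/-! ### Laurent series over a `ℂ`-algebra -/

section Lowest

variable {B : Type*} [Ring B]

/-- If `g` vanishes below `m` and `p` vanishes below `0`, then the coefficient of `g p` with the
index `m` is the product of the lowest coefficients. -/
theorem coeff_mul_of_lowest {g p : LaurentSeries B} {m : ℤ} (hg : ∀ k < m, g.coeff k = 0)
    (hp : ∀ k < 0, p.coeff k = 0) : (g * p).coeff m = g.coeff m * p.coeff 0 := by
  rw [HahnSeries.coeff_mul]
  by_cases h : g.coeff m = 0 ∨ p.coeff 0 = 0
  · have h0 : g.coeff m * p.coeff 0 = 0 := by rcases h with h | h <;> simp [h]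
    rw [h0]
    refine Finset.sum_eq_zero fun a ha => ?_
    simp only [Finset.mem_antidiagonal, HahnSeries.mem_support] at ha
    rcases lt_trichotomy a.1 m with h1 | h1 | h1
    · exact absurd (hg _ h1) ha.1
    · have : a.2 = 0 := by omega
      rw [h1, this, h0]
    · exact absurd (hp a.2 (by omega)) ha.2.1
  · rw [not_or] at h
    rw [Finset.sum_eq_single (m, 0)]
    · intro a ha hne
      simp only [Finset.mem_antidiagonal, HahnSeries.mem_support] at ha
      rcases lt_trichotomy a.1 m with h1 | h1 | h1
      · exact absurd (hg _ h1) ha.1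
      · exact absurd (Prod.ext h1 (by show a.2 = 0; omega)) hne
      · exact absurd (hp a.2 (by omega)) ha.2.1
    · intro hn
      exact absurd (by simp [h]) hn

/-- The lowest coefficient of `M` is lower triangular with a right-invertible diagonal. The lowest
coefficients of `g` therefore vanish, starting from the largest index; then the order is raised step
by step. This gives the cancellation of $T$ and $\overline T^t$. -/
theorem eq_zero_of_vecMul_eq_zero {N : ℕ} {M : Matrix (Fin N) (Fin N) (LaurentSeries B)}
    (hneg : ∀ i j, ∀ k < 0, (M i j).coeff k = 0) (hlow : ∀ i j, i < j → (M i j).coeff 0 = 0)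
    (hdiag : ∀ i, ∃ b, (M i i).coeff 0 * b = 1) (g : Fin N → LaurentSeries B)
    (h : g ᵥ* M = 0) : g = 0 := by
  have step : ∀ m : ℤ, (∀ i, ∀ k < m, (g i).coeff k = 0) → ∀ i, (g i).coeff m = 0 := by
    intro m hm i
    induction i using WellFoundedGT.induction with
    | _ j ih =>
      have h1 : ∑ i, (g i).coeff m * (M i j).coeff 0 = 0 := by
        have h2 := congrArg (fun f => HahnSeries.coeff f m) (congrFun h j)
        simp only [vecMul, dotProduct, HahnSeries.coeff_sum, Pi.zero_apply,
          HahnSeries.coeff_zero] at h2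
        rw [← h2]
        exact Finset.sum_congr rfl fun i _ => (coeff_mul_of_lowest (hm i) (hneg i j)).symm
      rw [Finset.sum_eq_single j] at h1
      · obtain ⟨b, hb⟩ := hdiag j
        rw [← mul_one ((g j).coeff m), ← hb, ← mul_assoc, h1, zero_mul]
      · intro i _ hij
        rcases lt_or_gt_of_ne hij with h2 | h2
        · rw [hlow i j h2, mul_zero]
        · rw [ih i h2, zero_mul]
      · simp
  obtain ⟨n, hn⟩ : ∃ n : ℤ, ∀ i, ∀ k < n, (g i).coeff k = 0 := by
    obtain ⟨n, hn⟩ := (Set.finite_range fun i => (g i).order).bddBelow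
    refine ⟨n, fun i k hk => HahnSeries.coeff_eq_zero_of_lt_order ?_⟩
    exact hk.trans_le (hn ⟨i, rfl⟩)
  have all : ∀ k : ℕ, ∀ i, ∀ l < n + k, (g i).coeff l = 0 := by
    intro k
    induction k with
    | zero => simpa using hn
    | succ k ih =>
      intro i l hl
      rcases (show l ≤ n + k by push_cast at hl; omega).lt_or_eq with h1 | h1
      · exact ih i l h1
      · rw [h1]; exact step _ ih i
  ext i m
  exact all (m - n + 1).toNat i m (by omega)

end Lowest

section Laurent

variable {B : Type*} [Ring B] [Algebra ℂ B]

/-- Extension of coefficients from `ℂ((u⁻¹))` to Laurent series over a `ℂ`-algebra. -/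
noncomputable def laurentMap (B : Type*) [Ring B] [Algebra ℂ B] :
    LaurentSeries ℂ →+* LaurentSeries B where
  toFun x := x.map (algebraMap ℂ B)
  map_one' := by
    ext n
    by_cases h : n = 0 <;> simp [HahnSeries.coeff_one, h]
  map_mul' x y := HahnSeries.map_mul (algebraMap ℂ B : ℂ →ₙ+* B)
  map_zero' := by ext n; simp
  map_add' x y := by ext n; simp

theorem coeff_laurentMap (x : LaurentSeries ℂ) (n : ℤ) :
    (laurentMap B x).coeff n = algebraMap ℂ B (x.coeff n) := rfl

theorem laurentMap_mul_comm (x : LaurentSeries ℂ) (y : LaurentSeries B) :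
    laurentMap B x * y = y * laurentMap B x := by
  ext n
  rw [HahnSeries.coeff_mul, HahnSeries.coeff_mul]
  refine Finset.sum_nbij' Prod.swap Prod.swap ?_ ?_ (fun _ _ => rfl) (fun _ _ => rfl) ?_
  · intro a ha
    simp only [Finset.mem_antidiagonal, Prod.fst_swap, Prod.snd_swap] at ha ⊢
    exact ⟨ha.2.1, ha.1, by rw [add_comm, ha.2.2]⟩
  · intro a ha
    simp only [Finset.mem_antidiagonal, Prod.fst_swap, Prod.snd_swap] at ha ⊢
    exact ⟨ha.2.1, ha.1, by rw [add_comm, ha.2.2]⟩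
  · intro a _
    rw [coeff_laurentMap]
    exact Algebra.commutes _ _

theorem laurentMap_single (n : ℤ) (z : ℂ) :
    laurentMap B (HahnSeries.single n z) = HahnSeries.single n (algebraMap ℂ B z) := by
  ext m
  rw [coeff_laurentMap, HahnSeries.coeff_single, HahnSeries.coeff_single]
  split_ifs <;> simp

theorem laurentMap_C (z : ℂ) :
    laurentMap B (HahnSeries.C z) = algebraMap ℂ (LaurentSeries B) z := by
  rw [HahnSeries.algebraMap_apply, HahnSeries.C_apply, laurentMap_single, HahnSeries.C_apply]

theorem laurentMap_cu (z : ℂ) : laurentMap B (cu ℂ z) = cu B z := laurentMap_single _ _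

theorem laurentMap_cuInv (z : ℂ) : laurentMap B (cuInv ℂ z) = cuInv B z := laurentMap_single _ _

end Laurent

/-! ### Exchange relations between coefficients -/

section Exchange

variable {N : ℕ} {B : Type*} [Ring B] [Algebra ℂ B]

/-- An entry of `R X₁ Y₂ - Y₂ X₁ R`, where `R` has the diagonal part `d` and the off-diagonal
part `o`. -/
def exch (d o : Fin N → Fin N → ℂ) (X Y : Matrix (Fin N) (Fin N) B) (i j k l : Fin N) : B :=
  d i j • (X i k * Y j l) + o i j • (X j k * Y i l) - d k l • (Y j l * X i k) -
    o l k • (Y j k * X i l)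

/-- The diagonal part of `R(1, 0)`. -/
def dU {K : Type*} [Field K] (q : K) (i j : Fin N) : K := if i = j then q⁻¹ else 1

/-- The diagonal part of `R(0, 1)`. -/
def dV {K : Type*} [Field K] (q : K) (i j : Fin N) : K := if i = j then -q else -1

/-- The off-diagonal part of `R(1, 0)`. -/
def oU {K : Type*} [Field K] (q : K) (i j : Fin N) : K := if j < i then q⁻¹ - q else 0

/-- The off-diagonal part of `R(0, 1)`. -/
def oV {K : Type*} [Field K] (q : K) (i j : Fin N) : K := if i < j then q⁻¹ - q else 0

theorem trigR_apply (q : ℂ) (u v : B) (i j k l : Fin N) :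
    trigR N q u v (i, j) (k, l) =
      (if i = k ∧ j = l then dU q i j • u + dV q i j • v else 0) +
        (if i = l ∧ j = k then oU q i j • u + oV q i j • v else 0) := by
  simp only [trigR, E, Matrix.add_apply, Matrix.sum_apply, single_kronecker_single, mul_one]
  have h0 : ∀ (m n : Fin N) (z : B), ((if m ≠ n then
      z • (Matrix.single (m, n) (m, n) (1 : B) : Matrix (Fin N × Fin N) (Fin N × Fin N) B) else 0) :
      Matrix (Fin N × Fin N) (Fin N × Fin N) B) (i, j) (k, l) =
      if n = j then if m = i then if i ≠ j ∧ i = k ∧ j = l then z else 0 else 0 else 0 := by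
    intro m n z
    split_ifs <;> (simp_all; try grind)
  have h1 : ∀ (m : Fin N) (z : B), (z • (Matrix.single (m, m) (m, m) (1 : B) :
      Matrix (Fin N × Fin N) (Fin N × Fin N) B))
      (i, j) (k, l) = if m = i then if i = j ∧ i = k ∧ i = l then z else 0 else 0 := by
    intro m z
    simp only [Matrix.smul_apply, single_apply, Prod.mk.injEq, smul_eq_mul, mul_ite, mul_one,
      mul_zero]
    split_ifs <;> grind
  have h2 : ∀ (m n : Fin N) (z : B), ((if n < m then
      z • (Matrix.single (m, n) (n, m) (1 : B) : Matrix (Fin N × Fin N) (Fin N × Fin N) B) else 0) :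
      Matrix (Fin N × Fin N) (Fin N × Fin N) B) (i, j) (k, l) =
      if n = j then if m = i then if j < i ∧ i = l ∧ j = k then z else 0 else 0 else 0 := by
    intro m n z
    split_ifs <;> simp_all [single_apply] <;> grind
  have h3 : ∀ (m n : Fin N) (z : B), ((if m < n then
      z • (Matrix.single (m, n) (n, m) (1 : B) : Matrix (Fin N × Fin N) (Fin N × Fin N) B) else 0) :
      Matrix (Fin N × Fin N) (Fin N × Fin N) B) (i, j) (k, l) =
      if n = j then if m = i then if i < j ∧ i = l ∧ j = k then z else 0 else 0 else 0 := by
    intro m n z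
    split_ifs <;> simp_all [single_apply] <;> grind
  simp only [h0, h1, h2, h3, Finset.sum_ite_eq', Finset.mem_univ, if_true, dU, dV, oU, oV]
  by_cases a : i = k ∧ j = l
  · by_cases b : i = l ∧ j = k
    · obtain ⟨rfl, rfl⟩ := a
      obtain ⟨rfl, -⟩ := b
      simp [sub_eq_add_neg]
    · obtain ⟨rfl, rfl⟩ := a
      by_cases hij : i = j
      · simp [hij, sub_eq_add_neg]
      · simp [hij, sub_eq_add_neg, Ne.symm hij]
  · by_cases b : i = l ∧ j = k
    · obtain ⟨rfl, rfl⟩ := b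
      rcases lt_trichotomy i j with h | h | h
      · simp [h, h.ne, h.ne', h.not_gt]
      · simp [h] at a
      · simp [h, h.ne, h.ne', h.not_gt]
    · have h' : ¬(i = j ∧ i = k ∧ i = l) := by grind
      simp [a, b, h']

theorem trigR_mul_apply (q : ℂ) (u v : B) (X Y : Matrix (Fin N) (Fin N) B) (i j k l : Fin N) :
    (trigR N q u v * (X ⊗ₖ (1 : Matrix (Fin N) (Fin N) B)) *
      ((1 : Matrix (Fin N) (Fin N) B) ⊗ₖ Y)) (i, j) (k, l) =
      (dU q i j • u + dV q i j • v) * (X i k * Y j l) +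
        (oU q i j • u + oV q i j • v) * (X j k * Y i l) := by
  have e : (X ⊗ₖ 1 : Matrix (Fin N × Fin N) (Fin N × Fin N) B) * (1 ⊗ₖ Y) = of fun a b =>
      X a.1 b.1 * Y a.2 b.2 := by
    ext ⟨a, b⟩ ⟨a', b'⟩
    simp [Matrix.mul_apply, Fintype.sum_prod_type, kroneckerMap_apply, Matrix.one_apply]
  rw [Matrix.mul_assoc, e]
  simp only [Matrix.mul_apply, Fintype.sum_prod_type, trigR_apply, of_apply, add_mul,
    Finset.sum_add_distrib, ite_and, ite_mul, zero_mul, Finset.sum_ite_eq, Finset.mem_univ, if_true]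
  simp [Finset.sum_ite_irrel]

theorem mul_trigR_apply (q : ℂ) (u v : B) (X Y : Matrix (Fin N) (Fin N) B) (i j k l : Fin N) :
    (((1 : Matrix (Fin N) (Fin N) B) ⊗ₖ Y) * (X ⊗ₖ (1 : Matrix (Fin N) (Fin N) B)) *
      trigR N q u v) (i, j) (k, l) =
      Y j l * X i k * (dU q k l • u + dV q k l • v) +
        Y j k * X i l * (oU q l k • u + oV q l k • v) := by
  have e : (1 ⊗ₖ Y : Matrix (Fin N × Fin N) (Fin N × Fin N) B) * (X ⊗ₖ 1) = of fun a b =>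
      Y a.2 b.2 * X a.1 b.1 := by
    ext ⟨a, b⟩ ⟨a', b'⟩
    simp [Matrix.mul_apply, Fintype.sum_prod_type, kroneckerMap_apply, Matrix.one_apply]
  rw [e]
  simp only [Matrix.mul_apply, Fintype.sum_prod_type, trigR_apply, of_apply, mul_add,
    Finset.sum_add_distrib, ite_and, mul_ite, mul_zero]
  congr 1
  · simp [Finset.sum_ite_irrel]
  · simp [Finset.sum_ite_irrel]

theorem coeffRXY_sub_coeffYXR (q : ℂ) (X Y : ℤ → Matrix (Fin N) (Fin N) B) (a b : ℤ)
    (i j k l : Fin N) :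
    coeffRXY q X Y a b (i, j) (k, l) - coeffYXR q X Y a b (i, j) (k, l) =
      exch (dU q) (oU q) (X (a - 1)) (Y b) i j k l + exch (dV q) (oV q) (X a) (Y (b - 1)) i j k l := by
  simp only [coeffRXY, coeffYXR, Matrix.add_apply, trigR_mul_apply, mul_trigR_apply, exch,
    smul_zero, add_zero, zero_add, smul_mul_assoc, one_mul, mul_smul_comm, mul_one]
  abel

theorem exch_map {B' : Type*} [Ring B'] [Algebra ℂ B'] (φ : B →ₐ[ℂ] B') (d o : Fin N → Fin N → ℂ)
    (X Y : Matrix (Fin N) (Fin N) B) (i j k l : Fin N) :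
    φ (exch d o X Y i j k l) = exch d o (X.map φ) (Y.map φ) i j k l := by
  simp [exch]

@[simp]
theorem exch_zero_left (d o : Fin N → Fin N → ℂ) (Y : Matrix (Fin N) (Fin N) B) (i j k l : Fin N) :
    exch d o 0 Y i j k l = 0 := by
  simp [exch]

@[simp]
theorem exch_zero_right (d o : Fin N → Fin N → ℂ) (X : Matrix (Fin N) (Fin N) B)
    (i j k l : Fin N) : exch d o X 0 i j k l = 0 := by
  simp [exch]

end Exchange

/-! ### From relations between coefficients to relations between series. -/

section Series

variable {N : ℕ} {B : Type*} [Ring B] [Algebra ℂ B]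

/-- The matrix of power series `∑ x_r c^r z^r`. -/
noncomputable def seriesMat (c : ℂ) (x : ℕ → Matrix (Fin N) (Fin N) B) :
    Matrix (Fin N) (Fin N) (PowerSeries B) :=
  of fun i j => PowerSeries.mk fun r => c ^ r • x r i j

theorem coeff_exch_seriesMat (d o : Fin N → Fin N → ℂ) (c e : ℂ)
    (x y : ℕ → Matrix (Fin N) (Fin N) B) (i j k l : Fin N) (n : ℕ) :
    PowerSeries.coeff n (exch d o (seriesMat c x) (seriesMat e y) i j k l) =
      ∑ a ∈ Finset.HasAntidiagonal.antidiagonal n,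
        (c ^ a.1 * e ^ a.2) • exch d o (x a.1) (y a.2) i j k l := by
  have h1 : ∀ i j k l, PowerSeries.coeff n (seriesMat c x i k * seriesMat e y j l) =
      ∑ a ∈ Finset.HasAntidiagonal.antidiagonal n, (c ^ a.1 * e ^ a.2) • (x a.1 i k * y a.2 j l) := by
    intro i j k l
    rw [PowerSeries.coeff_mul]
    refine Finset.sum_congr rfl fun a _ => ?_
    simp only [seriesMat, of_apply, PowerSeries.coeff_mk, smul_mul_assoc, mul_smul_comm, smul_smul]
    rw [mul_comm]
  have h2 : ∀ i j k l, PowerSeries.coeff n (seriesMat e y j l * seriesMat c x i k) =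
      ∑ a ∈ Finset.HasAntidiagonal.antidiagonal n, (c ^ a.1 * e ^ a.2) • (y a.2 j l * x a.1 i k) := by
    intro i j k l
    rw [PowerSeries.coeff_mul, ← Finset.Nat.sum_antidiagonal_swap]
    refine Finset.sum_congr rfl fun a _ => ?_
    simp only [seriesMat, of_apply, PowerSeries.coeff_mk, smul_mul_assoc, mul_smul_comm, smul_smul,
      Prod.fst_swap, Prod.snd_swap]
  have h3 : ∀ (z : ℂ) (f : PowerSeries B), PowerSeries.coeff n (z • f) =
      z • PowerSeries.coeff n f := fun _ _ => rfl
  simp only [exch, map_sub, map_add, h3, h1, h2, Finset.smul_sum, ← Finset.sum_add_distrib,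
    ← Finset.sum_sub_distrib]
  refine Finset.sum_congr rfl fun a _ => ?_
  module

/-- The terms with `P 0 b` and `Q a 0` vanish, and after a shift of one index in each sum the others
cancel in pairs. -/
theorem sum_antidiagonal_eq_zero {V : Type*} [AddCommGroup V] [Module ℂ V] {P Q : ℕ → ℕ → V}
    (hP : ∀ b, P 0 b = 0) (hQ : ∀ a, Q a 0 = 0) (h : ∀ a b, P (a + 1) b + Q a (b + 1) = 0)
    (c e : ℂ) (n : ℕ) :
    e • (∑ a ∈ Finset.HasAntidiagonal.antidiagonal n, (c ^ a.1 * e ^ a.2) • P a.1 a.2) +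
      c • (∑ a ∈ Finset.HasAntidiagonal.antidiagonal n, (c ^ a.1 * e ^ a.2) • Q a.1 a.2) = 0 := by
  cases n with
  | zero => simp [hP, hQ]
  | succ n =>
    rw [Finset.Nat.sum_antidiagonal_succ (f := fun a : ℕ × ℕ => (c ^ a.1 * e ^ a.2) • P a.1 a.2),
      Finset.Nat.sum_antidiagonal_succ' (f := fun a : ℕ × ℕ => (c ^ a.1 * e ^ a.2) • Q a.1 a.2)]
    simp only [hP, hQ, smul_zero, zero_add, Finset.smul_sum, ← Finset.sum_add_distrib]
    refine Finset.sum_eq_zero fun a _ => ?_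
    rw [eq_neg_of_add_eq_zero_left (h a.1 a.2)]
    module

theorem exch_seriesMat_eq_zero {d o d' o' : Fin N → Fin N → ℂ} {i j k l : Fin N}
    {x y : ℕ → Matrix (Fin N) (Fin N) B}
    (hP : ∀ b, exch d o (x 0) (y b) i j k l = 0) (hQ : ∀ a, exch d' o' (x a) (y 0) i j k l = 0)
    (h : ∀ a b, exch d o (x (a + 1)) (y b) i j k l + exch d' o' (x a) (y (b + 1)) i j k l = 0)
    (c e : ℂ) :
    e • exch d o (seriesMat c x) (seriesMat e y) i j k l +
      c • exch d' o' (seriesMat c x) (seriesMat e y) i j k l = 0 := by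
  ext n
  have h3 : ∀ (z : ℂ) (f : PowerSeries B), PowerSeries.coeff n (z • f) =
      z • PowerSeries.coeff n f := fun _ _ => rfl
  rw [map_add, h3, h3, coeff_exch_seriesMat, coeff_exch_seriesMat, map_zero]
  exact sum_antidiagonal_eq_zero (P := fun a b => exch d o (x a) (y b) i j k l)
    (Q := fun a b => exch d' o' (x a) (y b) i j k l) hP hQ h c e n

/-- Here the two spectral parameters are proportional to $u^{-1}$ and to $u$. After division by the
second one the first carries $u^{-2}$, which is `PowerSeries.X ^ 2` and shifts both indices by one.
-/
theorem exch_seriesMat_eq_zero_of_mixed {d o d' o' : Fin N → Fin N → ℂ} {i j k l : Fin N}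
    {x y : ℕ → Matrix (Fin N) (Fin N) B}
    (hx : ∀ b, exch d' o' (x 0) (y b) i j k l = 0) (hy : ∀ a, exch d' o' (x a) (y 0) i j k l = 0)
    (h : ∀ a b, exch d o (x a) (y b) i j k l + exch d' o' (x (a + 1)) (y (b + 1)) i j k l = 0)
    (c e : ℂ) :
    (c * e) • (PowerSeries.X ^ 2 * exch d o (seriesMat c x) (seriesMat e y) i j k l) +
      exch d' o' (seriesMat c x) (seriesMat e y) i j k l = 0 := by
  ext n
  have h3 : ∀ (z : ℂ) (f : PowerSeries B), PowerSeries.coeff n (z • f) =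
      z • PowerSeries.coeff n f := fun _ _ => rfl
  rw [map_add, h3, PowerSeries.coeff_X_pow_mul', coeff_exch_seriesMat, coeff_exch_seriesMat,
    map_zero]
  match n with
  | 0 => simp [hx]
  | 1 => simp [Finset.Nat.antidiagonal_succ, hx, hy]
  | n + 2 =>
    rw [if_pos (by omega), Nat.add_sub_cancel, Finset.Nat.antidiagonal_succ_succ']
    simp only [Finset.sum_cons, Finset.sum_map, hx, hy, smul_zero, zero_add,
      Embedding.coe_prodMap, Prod.map_fst, Prod.map_snd, Embedding.coeFn_mk, Finset.smul_sum,
      ← Finset.sum_add_distrib]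
    refine Finset.sum_eq_zero fun a _ => ?_
    rw [eq_neg_of_add_eq_zero_left (h a.1 a.2)]
    simp only [Nat.succ_eq_add_one]
    module

theorem ofPowerSeriesAlg_exch (d o : Fin N → Fin N → ℂ) (X Y : Matrix (Fin N) (Fin N) (PowerSeries B))
    (i j k l : Fin N) : HahnSeries.ofPowerSeriesAlg ℤ ℂ (exch d o X Y i j k l) =
      exch d o (X.map (HahnSeries.ofPowerSeriesAlg ℤ ℂ)) (Y.map (HahnSeries.ofPowerSeriesAlg ℤ ℂ))
        i j k l :=
  exch_map _ d o X Y i j k l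

end Series

/-! ### The defining relations in terms of coefficients -/

section Relations

variable {N : ℕ} (q : ℂ)

/-- The matrix of the generators `t_{ij}^{(r)}`. -/
noncomputable def tMat (N : ℕ) (r : ℕ) : Matrix (Fin N) (Fin N) (UqAff q N) :=
  of fun i j => t q i j r

/-- The matrix of the generators `t̄_{ij}^{(r)}`. -/
noncomputable def tbarMat (N : ℕ) (r : ℕ) : Matrix (Fin N) (Fin N) (UqAff q N) :=
  of fun i j => tbar q i j r

/-- The coefficient of `u^a` in `T(u)`. -/
noncomputable def tCoeff (N : ℕ) (a : ℤ) : Matrix (Fin N) (Fin N) (UqAff q N) :=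
  if a ≤ 0 then tMat q N (-a).toNat else 0

/-- The coefficient of `u^a` in `T̄(u)`. -/
noncomputable def tbarCoeff (N : ℕ) (a : ℤ) : Matrix (Fin N) (Fin N) (UqAff q N) :=
  if 0 ≤ a then tbarMat q N a.toNat else 0

theorem map_freeT (a : ℤ) : (freeT N a).map (RingQuot.mkAlgHom ℂ (Rel q N)) = tCoeff q N a := by
  ext i j
  rw [tCoeff, map_apply, freeT, of_apply]
  split_ifs <;> simp [tMat, t]

theorem map_freeTbar (a : ℤ) :
    (freeTbar N a).map (RingQuot.mkAlgHom ℂ (Rel q N)) = tbarCoeff q N a := by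
  ext i j
  rw [tbarCoeff, map_apply, freeTbar, of_apply]
  split_ifs <;> simp [tbarMat, tbar]

theorem exch_add_exch_eq_zero {X Y : ℤ → Matrix (Fin N) (Fin N) (FreeAlgebra ℂ (Gen N))} {a b : ℤ}
    {i j k l : Fin N} (h : Rel q N (coeffRXY q X Y a b (i, j) (k, l))
      (coeffYXR q X Y a b (i, j) (k, l))) :
    exch (dU q) (oU q) ((X (a - 1)).map (RingQuot.mkAlgHom ℂ (Rel q N)))
        ((Y b).map (RingQuot.mkAlgHom ℂ (Rel q N))) i j k l +
      exch (dV q) (oV q) ((X a).map (RingQuot.mkAlgHom ℂ (Rel q N)))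
        ((Y (b - 1)).map (RingQuot.mkAlgHom ℂ (Rel q N))) i j k l = 0 := by
  rw [← exch_map, ← exch_map, ← map_add, ← coeffRXY_sub_coeffYXR, map_sub,
    RingQuot.mkAlgHom_rel ℂ h, sub_self]

theorem exch_tCoeff (a b : ℤ) (i j k l : Fin N) :
    exch (dU q) (oU q) (tCoeff q N (a - 1)) (tCoeff q N b) i j k l +
      exch (dV q) (oV q) (tCoeff q N a) (tCoeff q N (b - 1)) i j k l = 0 := by
  have h := exch_add_exch_eq_zero q (Rel.rtt (q := q) a b (i, j) (k, l))
  simpa only [map_freeT] using h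

theorem exch_tbarCoeff (a b : ℤ) (i j k l : Fin N) :
    exch (dU q) (oU q) (tbarCoeff q N (a - 1)) (tbarCoeff q N b) i j k l +
      exch (dV q) (oV q) (tbarCoeff q N a) (tbarCoeff q N (b - 1)) i j k l = 0 := by
  have h := exch_add_exch_eq_zero q (Rel.rtbartbar (q := q) a b (i, j) (k, l))
  simpa only [map_freeTbar] using h

theorem exch_tbarCoeff_tCoeff (a b : ℤ) (i j k l : Fin N) :
    exch (dU q) (oU q) (tbarCoeff q N (a - 1)) (tCoeff q N b) i j k l +
      exch (dV q) (oV q) (tbarCoeff q N a) (tCoeff q N (b - 1)) i j k l = 0 := by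
  have h := exch_add_exch_eq_zero q (Rel.rtbart (q := q) a b (i, j) (k, l))
  simpa only [map_freeT, map_freeTbar] using h

theorem tCoeff_neg (r : ℕ) : tCoeff q N (-(r : ℤ)) = tMat q N r := by
  rw [tCoeff, if_pos (by omega)]; simp

theorem tCoeff_one : tCoeff q N 1 = 0 := by
  rw [tCoeff, if_neg (by omega)]

theorem tbarCoeff_nat (r : ℕ) : tbarCoeff q N (r : ℤ) = tbarMat q N r := by
  rw [tbarCoeff, if_pos (by omega)]; simp

theorem tbarCoeff_neg_one : tbarCoeff q N (-1) = 0 := by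
  rw [tbarCoeff, if_neg (by omega)]

theorem T_eq (c : ℂ) : T q N c =
    (seriesMat c⁻¹ (tMat q N)).map (HahnSeries.ofPowerSeriesAlg ℤ ℂ) := rfl

theorem Tbar_eq (c : ℂ) : Tbar q N c =
    (seriesMat c (tbarMat q N)).map (HahnSeries.ofPowerSeriesAlg ℤ ℂ) := rfl

variable {q}

theorem exch_T {c e : ℂ} (hc : c ≠ 0) (he : e ≠ 0) (i j k l : Fin N) :
    c • exch (dU q) (oU q) (T q N c) (T q N e) i j k l +
      e • exch (dV q) (oV q) (T q N c) (T q N e) i j k l = 0 := by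
  have h := exch_seriesMat_eq_zero (x := tMat q N) (y := tMat q N) (d := dU q) (o := oU q)
    (d' := dV q) (o' := oV q) (i := i) (j := j) (k := k) (l := l)
    -- The boundary relations come from the coefficients at exponent $1$, where $T$ has none, so one
    -- of the two terms drops out.
    (fun b => by
      have := exch_tCoeff q (N := N) 1 (-(b : ℤ)) i j k l
      rw [tCoeff_one, exch_zero_left, add_zero, tCoeff_neg] at this
      simpa using (tCoeff_neg q (N := N) 0).symm ▸ this)
    (fun a => by
      have := exch_tCoeff q (N := N) (-(a : ℤ)) 1 i j k l
      rw [tCoeff_one, exch_zero_right, zero_add, tCoeff_neg] at this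
      rw [← tCoeff_neg q 0]
      simpa using this)
    (fun a b => by
      have := exch_tCoeff q (N := N) (-(a : ℤ)) (-(b : ℤ)) i j k l
      rw [tCoeff_neg, tCoeff_neg] at this
      rw [← tCoeff_neg q (a + 1), ← tCoeff_neg q (b + 1)]
      convert this using 4 <;> push_cast <;> ring_nf)
    c⁻¹ e⁻¹
  have h2 := congrArg (fun z => (c * e) • HahnSeries.ofPowerSeriesAlg ℤ ℂ z) h
  simp only [map_add, map_smul, ofPowerSeriesAlg_exch, ← T_eq, map_zero, smul_zero, smul_add, smul_smul] at h2
  rwa [mul_assoc, mul_inv_cancel₀ he, mul_one, mul_right_comm, mul_inv_cancel₀ hc, one_mul] at h2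

theorem exch_Tbar (c e : ℂ) (i j k l : Fin N) :
    c • exch (dU q) (oU q) (Tbar q N c) (Tbar q N e) i j k l +
      e • exch (dV q) (oV q) (Tbar q N c) (Tbar q N e) i j k l = 0 := by
  -- $\overline T$ expands in nonnegative powers, so the parts $R(1,0)$ and $R(0,1)$ exchange their
  -- roles in the index shifts.
  have h := exch_seriesMat_eq_zero (x := tbarMat q N) (y := tbarMat q N) (d := dV q) (o := oV q)
    (d' := dU q) (o' := oU q) (i := i) (j := j) (k := k) (l := l)
    (fun b => by
      have := exch_tbarCoeff q (N := N) 0 (b + 1 : ℤ) i j k l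
      rw [zero_sub, tbarCoeff_neg_one, exch_zero_left, zero_add, add_sub_cancel_right,
        tbarCoeff_nat] at this
      rw [← tbarCoeff_nat q 0]
      simpa using this)
    (fun a => by
      have := exch_tbarCoeff q (N := N) (a + 1 : ℤ) 0 i j k l
      rw [zero_sub, tbarCoeff_neg_one, exch_zero_right, add_zero, add_sub_cancel_right,
        tbarCoeff_nat] at this
      rw [← tbarCoeff_nat q 0]
      simpa using this)
    (fun a b => by
      have := exch_tbarCoeff q (N := N) (a + 1 : ℤ) (b + 1 : ℤ) i j k l
      rw [add_sub_cancel_right, add_sub_cancel_right, tbarCoeff_nat, tbarCoeff_nat] at this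
      rw [add_comm, ← tbarCoeff_nat q (a + 1), ← tbarCoeff_nat q (b + 1)]
      exact_mod_cast this)
    c e
  have h2 := congrArg (HahnSeries.ofPowerSeriesAlg ℤ ℂ) h
  simp only [map_add, map_smul, ofPowerSeriesAlg_exch, ← Tbar_eq, map_zero] at h2
  rwa [add_comm]

theorem exch_Tbar_T (c : ℂ) {e : ℂ} (he : e ≠ 0) (i j k l : Fin N) :
    cuInv (UqAff q N) c * exch (dU q) (oU q) (Tbar q N c) (T q N e) i j k l +
      cu (UqAff q N) e * exch (dV q) (oV q) (Tbar q N c) (T q N e) i j k l = 0 := by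
  have h := exch_seriesMat_eq_zero_of_mixed (x := tbarMat q N) (y := tMat q N) (d := dU q)
    (o := oU q) (d' := dV q) (o' := oV q) (i := i) (j := j) (k := k) (l := l)
    (fun b => by
      have := exch_tbarCoeff_tCoeff q (N := N) 0 (-(b : ℤ) + 1) i j k l
      rw [zero_sub, tbarCoeff_neg_one, exch_zero_left, zero_add, add_sub_cancel_right,
        tCoeff_neg] at this
      rw [← tbarCoeff_nat q 0]
      simpa using this)
    (fun a => by
      have := exch_tbarCoeff_tCoeff q (N := N) (a : ℤ) 1 i j k l
      rw [tCoeff_one, exch_zero_right, zero_add, tbarCoeff_nat] at this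
      rw [← tCoeff_neg q 0]
      simpa using this)
    (fun a b => by
      have := exch_tbarCoeff_tCoeff q (N := N) (a + 1 : ℤ) (-(b : ℤ)) i j k l
      rw [add_sub_cancel_right, tbarCoeff_nat, tCoeff_neg] at this
      rw [← tbarCoeff_nat q (a + 1), ← tCoeff_neg q (b + 1)]
      convert this using 4 <;> push_cast <;> ring_nf)
    c e⁻¹
  have h2 := congrArg (HahnSeries.ofPowerSeriesAlg ℤ ℂ) h
  simp only [map_add, map_smul, map_mul, ofPowerSeriesAlg_exch, ← Tbar_eq, ← T_eq, map_zero] at h2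
  have h3 : HahnSeries.ofPowerSeriesAlg ℤ ℂ (PowerSeries.X ^ 2 : PowerSeries (UqAff q N)) =
      HahnSeries.single 2 1 := by
    have := HahnSeries.ofPowerSeries_X_pow (Γ := ℤ) (R := UqAff q N) 2
    exact_mod_cast this
  rw [h3] at h2
  -- Multiplication by $eu$ turns $ce^{-1}u^{-2}$ and $1$ into the parameters $cu^{-1}$ and $eu$.
  have h4 := congrArg (fun z => cu (UqAff q N) e * z) h2
  simp only [mul_add, mul_zero, mul_smul_comm] at h4
  rw [← h4]
  congr 1
  rw [← mul_assoc, ← smul_mul_assoc]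
  congr 1
  rw [cu, cuInv, HahnSeries.single_mul_single, mul_one]
  ext n
  rw [HahnSeries.coeff_smul, HahnSeries.coeff_single, HahnSeries.coeff_single]
  norm_num
  split_ifs
  · rw [Algebra.smul_def, ← map_mul, mul_assoc, inv_mul_cancel₀ he, mul_one]
  · simp

end Relations

/-! ### Relations at adjacent spectral parameters -/

section Adjacent

variable {N : ℕ} {A : Type*} [Ring A] [Algebra ℂ A]

theorem smul_exch_add_smul_exch (d o d' o' : Fin N → Fin N → ℂ) (c e : ℂ)
    (X Y : Matrix (Fin N) (Fin N) A) (i j k l : Fin N) :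
    c • exch d o X Y i j k l + e • exch d' o' X Y i j k l =
      exch (fun i j => c * d i j + e * d' i j) (fun i j => c * o i j + e * o' i j) X Y i j k l := by
  simp only [exch]
  module

/-- At the ratio $q^{-2}$ the matrix $R$ equals $c(1-q^{-2})(1-P^q)$, and the scalar is nonzero
because $q^2\ne1$. -/
theorem mul_sub_mul_of_exch {q c : ℂ} (hq : q ≠ 0) (hq2 : q ^ 2 ≠ 1) (hc : c ≠ 0)
    {X Y : Matrix (Fin N) (Fin N) A} {i j k l : Fin N}
    (h : c • exch (dU q) (oU q) X Y i j k l +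
      (q⁻¹ ^ 2 * c) • exch (dV q) (oV q) X Y i j k l = 0) :
    X i k * Y j l - pq q i j • (X j k * Y i l) = Y j l * X i k - pq q l k • (Y j k * X i l) := by
  have hs : c * (1 - q⁻¹ ^ 2) ≠ 0 := by
    refine mul_ne_zero hc (sub_ne_zero.2 fun h' => hq2 ?_)
    rw [inv_pow] at h'
    rw [← inv_inv (q ^ 2), ← h', inv_one]
  have hd : ∀ i j : Fin N, c * dU q i j + q⁻¹ ^ 2 * c * dV q i j =
      c * (1 - q⁻¹ ^ 2) * if i = j then 0 else 1 := by
    intro i j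
    simp only [dU, dV]
    split_ifs <;> field_simp <;> ring
  have ho : ∀ i j : Fin N, c * oU q i j + q⁻¹ ^ 2 * c * oV q i j =
      c * (1 - q⁻¹ ^ 2) * if i = j then 0 else -pq q i j := by
    intro i j
    rcases lt_trichotomy i j with h | h | h
    · simp only [oU, oV, pq, h, h.not_gt, h.ne, if_true, if_false]
      field_simp
      ring
    · simp [oU, oV, h]
    · simp only [oU, oV, pq, h, h.not_gt, h.ne', if_true, if_false]
      field_simp
      ring
  rw [smul_exch_add_smul_exch] at h
  simp only [hd, ho] at h
  have h2 : (c * (1 - q⁻¹ ^ 2)) • ((X i k * Y j l - pq q i j • (X j k * Y i l)) -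
      (Y j l * X i k - pq q l k • (Y j k * X i l))) = 0 := by
    rw [← h]
    simp only [exch]
    by_cases hij : i = j
    · subst hij
      by_cases hkl : k = l
      · subst hkl
        simp [pq_self]
      · simp only [pq_self, if_true, if_neg hkl, if_neg (Ne.symm hkl)]
        module
    · by_cases hkl : k = l
      · subst hkl
        simp only [pq_self, if_true, if_neg hij]
        module
      · simp only [if_neg hij, if_neg hkl, if_neg (Ne.symm hkl)]
        module
  exact sub_eq_zero.1 ((smul_eq_zero_iff_right hs).1 h2)

end Adjacent

/-! ### Entries of the exchange relations with $P^q$ and $R^t$. -/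

section PermMat

variable {N : ℕ} {K A : Type*} [Field K] [Ring A] [Algebra K A] (q : K)

theorem one_sub_permMat_mul_apply (X Y : Matrix (Fin N) (Fin N) A) (i j k l : Fin N) :
    ((1 - base A (permMat N q)) * (X ⊗ₖ (1 : Matrix (Fin N) (Fin N) A)) *
      ((1 : Matrix (Fin N) (Fin N) A) ⊗ₖ Y)) (i, j) (k, l) =
      X i k * Y j l - pq q i j • (X j k * Y i l) := by
  have e : (X ⊗ₖ 1 : Matrix (Fin N × Fin N) (Fin N × Fin N) A) * (1 ⊗ₖ Y) = of fun a b =>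
      X a.1 b.1 * Y a.2 b.2 := by
    ext ⟨a, b⟩ ⟨a', b'⟩
    simp [Matrix.mul_apply, Fintype.sum_prod_type, kroneckerMap_apply, Matrix.one_apply]
  rw [Matrix.mul_assoc, e, Matrix.sub_mul, Matrix.one_mul, Matrix.sub_apply, of_apply]
  congr 1
  simp only [Matrix.mul_apply, Fintype.sum_prod_type, permMat, map_apply, of_apply, ite_and,
    apply_ite (algebraMap K A), map_zero, ite_mul, zero_mul, Finset.sum_ite_eq,
    Finset.mem_univ, if_true, Algebra.smul_def]

theorem mul_one_sub_permMat_apply (X Y : Matrix (Fin N) (Fin N) A) (i j k l : Fin N) :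
    (((1 : Matrix (Fin N) (Fin N) A) ⊗ₖ Y) * (X ⊗ₖ (1 : Matrix (Fin N) (Fin N) A)) *
      (1 - base A (permMat N q))) (i, j) (k, l) =
      Y j l * X i k - pq q l k • (Y j k * X i l) := by
  have e : (1 ⊗ₖ Y : Matrix (Fin N × Fin N) (Fin N × Fin N) A) * (X ⊗ₖ 1) = of fun a b =>
      Y a.2 b.2 * X a.1 b.1 := by
    ext ⟨a, b⟩ ⟨a', b'⟩
    simp [Matrix.mul_apply, Fintype.sum_prod_type, kroneckerMap_apply, Matrix.one_apply]
  rw [e, Matrix.mul_sub, Matrix.mul_one, Matrix.sub_apply, of_apply]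
  congr 1
  simp only [Matrix.mul_apply, Fintype.sum_prod_type, permMat, map_apply, of_apply, ite_and,
    apply_ite (algebraMap K A), map_zero, mul_ite, mul_zero, Finset.sum_ite_irrel,
    Finset.sum_ite_eq', Finset.mem_univ, if_true, Finset.sum_const_zero, Algebra.smul_def,
    Algebra.commutes]

theorem mul_rtMat_mul_apply (x y : K) (X Y : Matrix (Fin N) (Fin N) A) (a j i b : Fin N) :
    ((Y ⊗ₖ (1 : Matrix (Fin N) (Fin N) A)) * base A (rtMat N q x y) *
      ((1 : Matrix (Fin N) (Fin N) A) ⊗ₖ X)) (a, j) (i, b) =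
      (if i = j then 0 else (x - y) • (Y a i * X j b)) + rho q x y j i • (Y a j * X i b) := by
  have e : ∀ m n, base A (rtMat N q x y) (m, j) (i, n) =
      (if n = i then if m = j then algebraMap K A (rho q x y j i) else 0 else 0) +
        (if n = j then if m = i then if i = j then 0 else algebraMap K A (x - y) else 0 else 0) := by
    intro m n
    simp only [rtMat, map_apply, of_apply, Prod.mk.injEq]
    split_ifs <;> grind
  simp only [Matrix.mul_apply, Fintype.sum_prod_type, kroneckerMap_apply, Matrix.one_apply,
    mul_ite, ite_mul, one_mul, mul_one, zero_mul, mul_zero, Finset.sum_ite_eq, Finset.mem_univ,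
    if_true, Finset.sum_ite_eq', e, mul_add, add_mul, Finset.sum_add_distrib,
    Finset.sum_ite_irrel, Finset.sum_const_zero, Finset.sum_mul, Algebra.smul_def]
  rw [add_comm]
  simp only [mul_assoc, Algebra.left_comm]

theorem mul_rtMat_mul_apply' (x y : K) (X Y : Matrix (Fin N) (Fin N) A) (a j i b : Fin N) :
    (((1 : Matrix (Fin N) (Fin N) A) ⊗ₖ X) * base A (rtMat N q x y) *
      (Y ⊗ₖ (1 : Matrix (Fin N) (Fin N) A))) (a, j) (i, b) =
      (if a = b then 0 else (x - y) • (X j b * Y a i)) + rho q x y a b • (X j a * Y b i) := by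
  have e : ∀ m n, base A (rtMat N q x y) (a, n) (m, b) =
      (if m = b then if n = a then algebraMap K A (rho q x y a b) else 0 else 0) +
        (if m = a then if n = b then if a = b then 0 else algebraMap K A (x - y) else 0 else 0) := by
    intro m n
    simp only [rtMat, map_apply, of_apply, Prod.mk.injEq]
    split_ifs <;> grind
  simp only [Matrix.mul_apply, Fintype.sum_prod_type, kroneckerMap_apply, Matrix.one_apply,
    mul_ite, ite_mul, one_mul, mul_one, zero_mul, mul_zero, Finset.sum_ite_eq, Finset.mem_univ,
    if_true, Finset.sum_ite_eq', e, mul_add, add_mul, Finset.sum_add_distrib,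
    Finset.sum_ite_irrel, Finset.sum_const_zero, Finset.sum_mul, Algebra.smul_def]
  rw [add_comm]
  simp only [mul_assoc, Algebra.left_comm]

end PermMat

/-- Transposing the first factor turns the diagonal and off-diagonal parts of $R$ into the two kinds
of terms of $R^t$. At coinciding indices the two monomials agree, and both parts merge into `rho`.
-/
theorem rho_smul_eq {N : ℕ} {K V : Type*} [Field K] [AddCommGroup V] [Module K V] {q x y : K}
    {i j a b : Fin N} {z₁ z₂ z₃ z₄ : V} (hij : i = j → z₁ = z₂) (hab : a = b → z₃ = z₄)
    (h : x • (dU q i j • z₁ + oU q i j • z₂ - dU q a b • z₃ - oU q b a • z₄) +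
      y • (dV q i j • z₁ + oV q i j • z₂ - dV q a b • z₃ - oV q b a • z₄) = 0) :
    (if i = j then 0 else (x - y) • z₁) + rho q x y j i • z₂ =
      (if a = b then 0 else (x - y) • z₃) + rho q x y a b • z₄ := by
  have h1 : (if i = j then 0 else (x - y) • z₁) + rho q x y j i • z₂ =
      x • (dU q i j • z₁ + oU q i j • z₂) + y • (dV q i j • z₁ + oV q i j • z₂) := by
    rcases lt_trichotomy i j with h | h | h
    · simp only [dU, dV, oU, oV, rho, if_true, if_false, h, h.not_gt, h.ne]
      module
    · rw [hij h]
      simp only [dU, dV, oU, oV, rho, if_true, if_false, h, lt_irrefl]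
      module
    · simp only [dU, dV, oU, oV, rho, if_true, if_false, h, h.not_gt, h.ne']
      module
  have h2 : (if a = b then 0 else (x - y) • z₃) + rho q x y a b • z₄ =
      x • (dU q a b • z₃ + oU q b a • z₄) + y • (dV q a b • z₃ + oV q b a • z₄) := by
    rcases lt_trichotomy a b with h | h | h
    · simp only [dU, dV, oU, oV, rho, if_true, if_false, h, h.not_gt, h.ne]
      module
    · rw [hab h]
      simp only [dU, dV, oU, oV, rho, if_true, if_false, h, lt_irrefl]
      module
    · simp only [dU, dV, oU, oV, rho, if_true, if_false, h, h.not_gt, h.ne']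
      module
  rw [h1, h2, ← sub_eq_zero, ← h]
  module

/-! ### The quantum affine algebra -/

section Affine

variable {N : ℕ} {q : ℂ}

/-- The base field is $\mathbb C((u^{-1}))$ and not $\mathbb C$, so that the spectral parameters are
scalars and $\gamma_N(u)$ is invertible. -/
noncomputable instance : Algebra (LaurentSeries ℂ) (USeries q N) :=
  (laurentMap (UqAff q N)).toAlgebra' laurentMap_mul_comm

theorem algebraMap_eq_laurentMap (x : LaurentSeries ℂ) :
    algebraMap (LaurentSeries ℂ) (USeries q N) x = laurentMap (UqAff q N) x := rfl

theorem C_smul (z : ℂ) (a : USeries q N) : (HahnSeries.C z : LaurentSeries ℂ) • a = z • a := by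
  rw [Algebra.smul_def, algebraMap_eq_laurentMap, laurentMap_C, ← Algebra.smul_def]

theorem pq_C (i j : Fin N) : pq (HahnSeries.C q : LaurentSeries ℂ) i j = HahnSeries.C (pq q i j) := by
  simp only [pq, ← map_inv₀]
  split_ifs <;> simp

theorem coeff_T_zero (c : ℂ) (i j : Fin N) : (T q N c i j).coeff 0 = t q i j 0 := by
  have := HahnSeries.ofPowerSeries_apply_coeff (Γ := ℤ)
    (PowerSeries.mk fun r => (c⁻¹) ^ r • t q i j r) 0
  simpa [T] using this

theorem coeff_Tbar_zero (c : ℂ) (i j : Fin N) : (Tbar q N c i j).coeff 0 = tbar q i j 0 := by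
  have := HahnSeries.ofPowerSeries_apply_coeff (Γ := ℤ)
    (PowerSeries.mk fun r => c ^ r • tbar q i j r) 0
  simpa [Tbar] using this

theorem coeff_ofPowerSeries_of_neg {B : Type*} [Ring B] (p : PowerSeries B) {k : ℤ} (hk : k < 0) :
    (HahnSeries.ofPowerSeries ℤ B p).coeff k = 0 := by
  rw [HahnSeries.ofPowerSeries_apply]
  refine HahnSeries.embDomain_of_notMem_range ?_
  rintro ⟨n, rfl⟩
  simp at hk
  omega

theorem t_zero_of_lt {i j : Fin N} (h : i < j) : t q i j 0 = 0 := by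
  rw [t, RingQuot.mkAlgHom_rel ℂ (Rel.t_zero i j h), map_zero]

theorem tbar_zero_of_lt {i j : Fin N} (h : i < j) : tbar q j i 0 = 0 := by
  rw [tbar, RingQuot.mkAlgHom_rel ℂ (Rel.tbar_zero i j h), map_zero]

theorem t_mul_tbar (i : Fin N) : t q i i 0 * tbar q i i 0 = 1 := by
  rw [t, tbar, ← map_mul, RingQuot.mkAlgHom_rel ℂ (Rel.t_tbar i), map_one]

theorem tbar_mul_t (i : Fin N) : tbar q i i 0 * t q i i 0 = 1 := by
  rw [t, tbar, ← map_mul, RingQuot.mkAlgHom_rel ℂ (Rel.tbar_t i), map_one]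

theorem cuInv_sub_cu_ne_zero {c e : ℂ} (he : e ≠ 0) : cuInv ℂ c - cu ℂ e ≠ 0 := by
  intro h
  have := congrArg (fun f : LaurentSeries ℂ => f.coeff (-1)) h
  simp [cuInv, cu] at this
  exact he this

theorem C_mul_cuInv (z c : ℂ) : HahnSeries.C z * cuInv ℂ c = cuInv ℂ (z * c) := by
  simp [cuInv, HahnSeries.C_apply]

theorem C_mul_cu (z c : ℂ) : HahnSeries.C z * cu ℂ c = cu ℂ (z * c) := by
  simp [cu, HahnSeries.C_apply]

theorem C_dU (i j : Fin N) : HahnSeries.C (dU q i j) = dU (HahnSeries.C q : LaurentSeries ℂ) i j := by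
  simp only [dU, apply_ite (HahnSeries.C : ℂ →+* LaurentSeries ℂ), map_inv₀, map_one]

theorem C_dV (i j : Fin N) : HahnSeries.C (dV q i j) = dV (HahnSeries.C q : LaurentSeries ℂ) i j := by
  simp only [dV, apply_ite (HahnSeries.C : ℂ →+* LaurentSeries ℂ), map_neg, map_one]

theorem C_oU (i j : Fin N) : HahnSeries.C (oU q i j) = oU (HahnSeries.C q : LaurentSeries ℂ) i j := by
  simp only [oU, apply_ite (HahnSeries.C : ℂ →+* LaurentSeries ℂ), map_sub, map_inv₀, map_zero]

theorem C_oV (i j : Fin N) : HahnSeries.C (oV q i j) = oV (HahnSeries.C q : LaurentSeries ℂ) i j := by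
  simp only [oV, apply_ite (HahnSeries.C : ℂ →+* LaurentSeries ℂ), map_sub, map_inv₀, map_zero]

/-- The matrices `T(u_k)` and `T̄(u_k⁻¹)ᵗ` over the quantum affine algebra. -/
noncomputable def affineData (hq : q ≠ 0) (hq2 : q ^ 2 ≠ 1) (N : ℕ) :
    RTTData N (HahnSeries.C q : LaurentSeries ℂ) (USeries q N) where
  x k := cuInv ℂ (q ^ (2 * (k : ℤ)))
  y k := cu ℂ (q ^ (-2 * (k : ℤ)))
  X k := T q N (q ^ (-2 * (k : ℤ)))
  Y k := (Tbar q N (q ^ (2 * (k : ℤ)))).transpose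
  y_succ k := by
    rw [← map_inv₀, ← map_pow, C_mul_cu]
    congr 1
    rw [inv_pow, ← zpow_natCast, ← _root_.zpow_neg, ← zpow_add₀ hq]
    congr 1
    push_cast
    ring
  ne_zero k := by
    rw [← map_inv₀, C_mul_cu, C_mul_cuInv]
    exact cuInv_sub_cu_ne_zero (mul_ne_zero hq (zpow_ne_zero _ hq))
  rXX k := by
    refine Matrix.ext fun ⟨i, j⟩ ⟨k', l⟩ => ?_
    rw [one_sub_permMat_mul_apply, mul_one_sub_permMat_apply, pq_C, pq_C, C_smul, C_smul]
    refine mul_sub_mul_of_exch hq hq2 (c := q ^ (-2 * (k : ℤ))) (zpow_ne_zero _ hq) ?_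
    have e : q⁻¹ ^ 2 * q ^ (-2 * (k : ℤ)) = q ^ (-2 * ((k + 1 : ℕ) : ℤ)) := by
      rw [inv_pow, ← zpow_natCast, ← _root_.zpow_neg, ← zpow_add₀ hq]
      congr 1
      push_cast
      ring
    rw [e]
    exact exch_T (zpow_ne_zero _ hq) (zpow_ne_zero _ hq) i j k' l
  rYY k := by
    refine Matrix.ext fun ⟨i, j⟩ ⟨k', l⟩ => ?_
    rw [one_sub_permMat_mul_apply, mul_one_sub_permMat_apply, pq_C, pq_C, C_smul, C_smul]
    -- As $u_k^{-1}=q^{-2}u_{k+1}^{-1}$, the relation for $\overline T$ is taken at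
    -- $(u_{k+1}^{-1},u_k^{-1})$. Transposing and exchanging the two tensor factors restores the
    -- order of the sites.
    have e : q⁻¹ ^ 2 * q ^ (2 * ((k + 1 : ℕ) : ℤ)) = q ^ (2 * (k : ℤ)) := by
      rw [inv_pow, ← zpow_natCast, ← _root_.zpow_neg, ← zpow_add₀ hq]
      congr 1
      push_cast
      ring
    have h := exch_Tbar (q := q) (N := N) (q ^ (2 * ((k + 1 : ℕ) : ℤ))) (q ^ (2 * (k : ℤ))) l k' j i
    rw [← e] at h
    have := mul_sub_mul_of_exch hq hq2 (zpow_ne_zero _ hq) h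
    rw [e] at this
    exact this.symm
  rYX k m := by
    refine Matrix.ext fun ⟨a, j⟩ ⟨i, b⟩ => ?_
    rw [mul_rtMat_mul_apply, mul_rtMat_mul_apply']
    have h := exch_Tbar_T (q := q) (N := N) (q ^ (2 * (k : ℤ))) (e := q ^ (-2 * (m : ℤ)))
      (zpow_ne_zero _ hq) i j a b
    rw [← laurentMap_cuInv, ← laurentMap_cu, ← algebraMap_eq_laurentMap,
      ← algebraMap_eq_laurentMap, ← Algebra.smul_def, ← Algebra.smul_def] at h
    simp only [transpose_apply]
    simp only [exch, ← C_smul, C_dU, C_dV, C_oU, C_oV] at h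
    exact rho_smul_eq (by rintro rfl; rfl) (by rintro rfl; rfl) h
  cancelX k g h := by
    refine eq_zero_of_vecMul_eq_zero (fun i j k hk => coeff_ofPowerSeries_of_neg _ hk)
      (fun i j hij => ?_) (fun i => ⟨tbar q i i 0, ?_⟩) g h
    · exact (coeff_T_zero _ i j).trans (t_zero_of_lt hij)
    · exact (congrArg (· * _) (coeff_T_zero _ i i)).trans (t_mul_tbar i)
  cancelY k g h := by
    refine eq_zero_of_vecMul_eq_zero (fun i j k hk => coeff_ofPowerSeries_of_neg _ hk)
      (fun i j hij => ?_) (fun i => ⟨t q i i 0, ?_⟩) g h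
    · exact (coeff_Tbar_zero _ j i).trans (tbar_zero_of_lt hij)
    · exact (congrArg (· * _) (coeff_Tbar_zero _ i i)).trans (tbar_mul_t i)

end Affine

/-! ### The recursive Sklyanin product in closed form. -/

namespace RTTData

variable {N : ℕ} {K A : Type*} [Field K] [Ring A] [Algebra K A] {q : K} (d : RTTData N q A)

theorem skl_eq_prod (r s : ℕ) : d.skl r s = ((List.finRange r).map fun k : Fin r =>
    oneSite (d.S (s + k)) k * (((List.finRange r).filter fun l => k < l).map fun l : Fin r =>
      twoSite (base A (rtMat N q (d.x (s + k)) (d.y (s + l)))) k l).prod).prod := by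
  induction r generalizing s with
  | zero => simp [skl]
  | succ r ih =>
    rw [skl, ih, List.finRange_succ, List.map_cons, List.prod_cons, liftCons_prod, List.map_map,
      List.map_map]
    congr 1
    · congr 1
      rw [head, List.filter_cons_of_neg (by simp), List.filter_map, List.map_map]
      have : ((fun l : Fin (r + 1) => decide (0 < l)) ∘ Fin.succ) = fun _ : Fin r => true := by
        ext l; simp
      rw [this, List.filter_true]
      congr 1
      refine List.map_congr_left fun l _ => ?_
      simp [add_assoc, add_comm (l : ℕ) 1]
    · congr 1
      refine List.map_congr_left fun k _ => ?_
      simp only [Function.comp_apply]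
      rw [List.filter_cons_of_neg (by simp), List.filter_map, List.map_map, liftCons_mul,
        liftCons_oneSite, liftCons_prod, List.map_map]
      have : ((fun l : Fin (r + 1) => decide (k.succ < l)) ∘ Fin.succ) =
          fun l : Fin r => decide (k < l) := by
        ext l; simp
      rw [this]
      congr 1
      · simp [add_assoc, add_comm (k : ℕ) 1]
      · congr 1
        refine List.map_congr_left fun l _ => ?_
        simp [liftCons_twoSite, add_assoc, add_comm (k : ℕ) 1, add_comm (l : ℕ) 1]

end RTTData

/-! ### Application to the quantum affine algebra. -/

section Main

variable {N : ℕ} {q : ℂ} (hq : q ≠ 0) (hq2 : q ^ 2 ≠ 1)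

theorem affineData_S (k : ℕ) : (affineData hq hq2 N).S k = S q N (q ^ (-2 * (k : ℤ))) := by
  rw [RTTData.S, S]
  simp only [affineData]
  congr 3
  rw [← _root_.zpow_neg]
  congr 1
  ring

theorem affineData_Sb (k : ℕ) :
    (affineData hq hq2 N).Sb k = (Sbar q N (q ^ (2 * (k : ℤ)))).transpose := by
  refine Matrix.ext fun i j => ?_
  rw [RTTData.Sb, Sbar, transpose_apply, Matrix.mul_apply, of_apply]
  simp only [affineData, transpose_apply, ← _root_.zpow_neg, neg_mul]

theorem transpose₁_trigR (x y : LaurentSeries ℂ) :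
    transpose₁ (trigR N q (laurentMap (UqAff q N) x) (laurentMap (UqAff q N) y)) =
      base (USeries q N) (rtMat N (HahnSeries.C q) x y) := by
  refine Matrix.ext fun ⟨a, j⟩ ⟨i, b⟩ => ?_
  simp only [transpose₁, of_apply, trigR_apply, rtMat, map_apply, Prod.mk.injEq,
    ← algebraMap_eq_laurentMap, ← C_smul, C_dU, C_dV, C_oU, C_oV]
  simp only [Algebra.smul_def, ← map_mul, ← map_add]
  by_cases hib : i = b
  · subst hib
    by_cases haj : a = j
    · subst haj
      rw [if_pos rfl, if_pos rfl]
      rcases lt_trichotomy a i with h | h | h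
      · simp [h.ne, h.ne', h, h.not_gt, rho, oU, oV]
      · simp [h, rho, dU, dV, oU, oV, sub_eq_add_neg]
      · simp [h.ne, h.ne', h, h.not_gt, rho, oU, oV]
    · have h1 : ¬(i = a ∧ j = i) := fun h => haj (h.1.symm.trans h.2.symm)
      have h2 : ¬(i = i ∧ j = a) := fun h => haj h.2.symm
      simp [haj, h1, Ne.symm haj]
  · by_cases h : a = i ∧ j = b
    · obtain ⟨rfl, rfl⟩ := h
      simp [hib, dU, dV, sub_eq_add_neg]
    · have h1 : ¬(i = a ∧ j = b) := fun h' => h ⟨h'.1.symm, h'.2⟩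
      simp [hib, h, h1]

theorem Rt_eq (k l : Fin N) : Rt q N k l = twoSite (base (USeries q N) (rtMat N (HahnSeries.C q)
    ((affineData hq hq2 N).x k) ((affineData hq hq2 N).y l))) k l := by
  rw [Rt, ← laurentMap_cu, ← laurentMap_cuInv, transpose₁_trigR]
  simp only [affineData]

theorem sklyaninProduct_eq : sklyaninProduct q N = (affineData hq hq2 N).skl N 0 := by
  simp only [RTTData.skl_eq_prod, sklyaninProduct, affineData_S, zero_add, ← Rt_eq hq hq2]

instance : NeZero (2 : LaurentSeries ℂ) := ⟨by
  have : (2 : LaurentSeries ℂ) = HahnSeries.C 2 := (map_ofNat HahnSeries.C 2).symm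
  rw [this]
  exact HahnSeries.C_ne_zero two_ne_zero⟩

theorem Asym.map_C {r : ℕ} {f : (Fin r → Fin N) → ℂ} (hf : Asym q f) :
    Asym (HahnSeries.C q : LaurentSeries ℂ) fun b => (HahnSeries.C (f b) : LaurentSeries ℂ) := by
  intro k b
  have := congrArg (HahnSeries.C : ℂ →+* LaurentSeries ℂ) (hf k b)
  beta_reduce
  rw [this, map_neg, smul_eq_mul, map_mul, pq_C, smul_eq_mul]

/-- The identity is checked row by row: each row of $A^q_N$ is an antisymmetric scalar vector, on
which the Sklyanin product acts by `det`. -/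
theorem isSklyaninDet_det :
    IsSklyaninDet q N (affineData hq hq2 N).det := by
  rw [IsSklyaninDet, sklyaninProduct_eq hq hq2]
  refine Matrix.ext fun a b => ?_
  have hA : Asym q (qAntisym N N q a) := by
    have := asym_vecMul_qAntisym (N := N) (r := N) hq (Pi.single a 1)
    rwa [single_one_vecMul] at this
  have h := (affineData hq hq2 N).vecMul_toAlg_of_asym (HahnSeries.C_ne_zero hq) hA.map_C b
  have e : RTTData.toAlg (USeries q N) (fun b => (HahnSeries.C (qAntisym N N q a b) : LaurentSeries ℂ)) =
      ((qAntisym N N q).map (algebraMap ℂ (USeries q N))) a := by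
    funext b
    rw [RTTData.toAlg, algebraMap_eq_laurentMap, laurentMap_C, map_apply]
  rw [e, C_smul] at h
  rw [Matrix.smul_apply, map_apply, smul_eq_mul, ← Algebra.commutes, ← Algebra.smul_def, ← h]
  rfl

theorem IsSklyaninDet.unique (hq : q ≠ 0) {D D' : USeries q N} (hD : IsSklyaninDet q N D)
    (hD' : IsSklyaninDet q N D') : D = D' := by
  have h := congrFun (congrFun (hD.symm.trans hD') id) id
  simpa [qAntisym_id hq] using h

theorem gamma_eq : gamma q N = (affineData hq hq2 N).gam N 0 := by
  simp [gamma, RTTData.gam, affineData]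

theorem gamma_ne_zero (hq : q ≠ 0) : gamma q N ≠ 0 := by
  refine Finset.prod_ne_zero_iff.2 fun i _ => Finset.prod_ne_zero_iff.2 fun j _ => ?_
  split_ifs
  · exact cuInv_sub_cu_ne_zero (zpow_ne_zero _ hq)
  · exact one_ne_zero

theorem algebraMap_inv_mul_smul {K A : Type*} [Field K] [Ring A] [Algebra K A] {g : K} (hg : g ≠ 0)
    (a : A) : algebraMap K A g⁻¹ * (g • a) = a := by
  rw [Algebra.smul_def, ← mul_assoc, ← map_mul, inv_mul_cancel₀ hg, map_one, one_mul]

theorem c_eq : c q N = ∑ p : Equiv.Perm (Fin N),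
    (-q) ^ (-(length p : ℤ) + (length (piMap p) : ℤ)) •
      (affineData hq hq2 N).entryProd N 0 p (piMap p) := by
  have hdet := isSklyaninDet_det (N := N) hq hq2
  have hs : sdet q N = (affineData hq hq2 N).det :=
    IsSklyaninDet.unique hq (Classical.epsilon_spec ⟨_, hdet⟩) hdet
  rw [c, hs, RTTData.det_eq _ (HahnSeries.C_ne_zero hq), ← gamma_eq]
  refine (algebraMap_inv_mul_smul (A := USeries q N) (gamma_ne_zero hq) _).trans ?_
  refine Finset.sum_congr rfl fun p _ => ?_
  rw [← map_neg, ← map_zpow₀, C_smul]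

end Main

end TwistedQYangian

theorem theorem4p7 (q : ℂ) (hq : q ≠ 0) (hroot : ∀ k : ℕ, 0 < k → q ^ k ≠ 1) (N : ℕ) :
    (∃! D, TwistedQYangian.IsSklyaninDet q N D) ∧
    TwistedQYangian.c q N =
      ∑ p : Equiv.Perm (Fin N),
        (-q) ^ (-(TwistedQYangian.length p : ℤ)
            + (TwistedQYangian.length (TwistedQYangian.piMap p) : ℤ)) •
          ((List.finRange N).map fun i : Fin N =>
            if (i : ℕ) < N / 2 then
              (TwistedQYangian.Sbar q N (q ^ (2 * ((i : ℕ) : ℤ)))).transpose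
                (p i) (TwistedQYangian.piMap p i)
            else
              TwistedQYangian.S q N (q ^ (-2 * ((i : ℕ) : ℤ)))
                (p i) (TwistedQYangian.piMap p i)).prod := by
  open TwistedQYangian in
  have hq2 : q ^ 2 ≠ 1 := hroot 2 two_pos
  have hdet := isSklyaninDet_det (N := N) hq hq2
  refine ⟨⟨_, hdet, fun D hD => IsSklyaninDet.unique hq hD hdet⟩, ?_⟩
  rw [c_eq hq hq2]
  refine Finset.sum_congr rfl fun p _ => ?_
  rw [RTTData.entryProd]
  simp only [affineData_S, affineData_Sb, zero_add]
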